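/- A monoid means a pointed commutative monoid, i.e. a commutative monoid with an absorbing element $0$. It is partially cancellative (pc) if it is a quotient $C/I$ of a cancellative monoid $C$ (one in which $ab=ac$, $a\neq 0$ imply $b=c$) by an ideal $I$, all elements of $I$ being identified with $0$. A monoid scheme is a topological space $X$ with a sheaf $\mathcal A$ of monoids which is locally isomorphic to $\operatorname{MSpec}(A)$, the set of prime ideals of a monoid $A$ with the Zariski topology and its natural structure sheaf; it is pc if it is covered by affine opens $\operatorname{MSpec}(A)$ with $A$ pc. A morphism is a continuous map together with a map of sheaves of monoids which is local on stalks. A monoid $B$ is seminormal if it is reduced and whenever $b,c\in B$ satisfy $b^3=c^2$ there is $a\in B$ with $a^2=b$, $a^3=c$. A seminormalization of a monoid $A$ is a homomorphism $A\to B$ with $B$ seminormal such that $A_{\rm red}=A/\mathrm{nil}(A)\to B$ is injective and for every $b\in B$ one has $b^n\in A_{\rm red}$ for all $n\gg 0$. A seminormalization of a monoid scheme $X$ is a morphism $p:X_{\rm sn}\to X$ such that $X$ is covered by affine opens $U$ for which $p^{-1}(U)$ is affine and $\mathcal A(U)\to\mathcal A_{\rm sn}(p^{-1}U)$ is a seminormalization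 of monoids. $\operatorname{Pic}(X)$ denotes the group, under the smash product $\wedge_{\mathcal A}$, of isomorphism classes of invertible sheaves on $X$, i.e. sheaves of $\mathcal A$-sets (sheaves of pointed sets with an action of $\mathcal A$) which are locally isomorphic to $\mathcal A$. Proposition. Let $X$ be a pc monoid scheme. Then $X$ has a seminormalization, and for every seminormalization $p:X_{\rm sn}\to X$ the inverse image $L\mapsto p^*L=p^{-1}L\wedge_{p^{-1}\mathcal A}\mathcal A_{\rm sn}$ induces an isomorphism of groups $\operatorname{Pic}(X)\xrightarrow{\ \cong\ }\operatorname{Pic}(X_{\rm sn})$. -/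

import Mathlib

open CategoryTheory TopologicalSpace Opposite

universe u

namespace MonoidGeom

noncomputable section

/-! ## Sheaves of sets: sections, restrictions, germs -/

section SetSheaf

variable {X : TopCat.{u}} (F : TopCat.Sheaf (Type u) X)

/-- The set of sections of `F` over `U`. -/
abbrev Sec (U : Opens X) : Type u := F.obj.obj (op U)

/-- Restriction of sections. -/
def res {U V : Opens X} (h : V ≤ U) (s : Sec F U) : Sec F V := F.obj.map (homOfLE h).op s

/-- The stalk of `F` at `x`. -/
abbrev Stalk (x : X) : Type u := TopCat.Presheaf.stalk F.obj x

/-- The germ at `x` of a section. -/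
def germ {U : Opens X} {x : X} (hx : x ∈ U) (s : Sec F U) : Stalk F x :=
  TopCat.Presheaf.germ F.obj U x hx s

variable {F}

@[simp] theorem res_self {U : Opens X} (s : Sec F U) : res F le_rfl s = s := by
  change F.obj.map (𝟙 (op U)) s = s
  simp

@[simp] theorem res_res {U V W : Opens X} (h : V ≤ U) (k : W ≤ V) (s : Sec F U) :
    res F k (res F h s) = res F (k.trans h) s := by
  unfold res
  rw [← ConcreteCategory.comp_apply, ← F.obj.map_comp]
  rfl

@[simp] theorem germ_res {U V : Opens X} (h : V ≤ U) {x : X} (hx : x ∈ V) (s : Sec F U) :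
    germ F hx (res F h s) = germ F (h hx) s :=
  TopCat.Presheaf.germ_res_apply F.obj (homOfLE h) x hx s

theorem exists_germ {x : X} (t : Stalk F x) :
    ∃ (U : Opens X) (hx : x ∈ U) (s : Sec F U), germ F hx s = t := by
  obtain ⟨U, hx, s, h⟩ := TopCat.Presheaf.exists_germ_eq F.obj t
  exact ⟨U, hx, s, h⟩

theorem germ_eq {x : X} {U V : Opens X} {hU : x ∈ U} {hV : x ∈ V} {s : Sec F U} {t : Sec F V}
    (h : germ F hU s = germ F hV t) :
    ∃ (W : Opens X) (_ : x ∈ W) (i : W ≤ U) (j : W ≤ V), res F i s = res F j t := by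
  obtain ⟨W, hW, i, j, e⟩ := TopCat.Presheaf.germ_eq F.obj x hU hV s t h
  exact ⟨W, hW, i.le, j.le, e⟩

theorem sec_ext {U : Opens X} {s t : Sec F U}
    (h : ∀ x (hx : x ∈ U), germ F hx s = germ F hx t) : s = t :=
  TopCat.Presheaf.section_ext F U s t h

theorem exists_sec {U : Opens X} (a : ∀ x : X, x ∈ U → Stalk F x)
    (h : ∀ x ∈ U, ∃ (W : Opens X) (_ : x ∈ W) (i : W ≤ U) (t : Sec F W),
      ∀ y (hy : y ∈ W), germ F hy t = a y (i hy)) :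
    ∃ s : Sec F U, ∀ x (hx : x ∈ U), germ F hx s = a x hx := by
  choose W hxW i t ht using h
  obtain ⟨s, hs, -⟩ := TopCat.Sheaf.existsUnique_gluing' F (ι := U)
    (fun x => W x.1 x.2) U (fun x => homOfLE (i x.1 x.2))
    (fun x hx => Opens.mem_iSup.mpr ⟨⟨x, hx⟩, hxW x hx⟩) (fun x => t x.1 x.2) (by
      intro x y
      change res F _ _ = res F _ _
      apply sec_ext
      intro z hz
      rw [germ_res, germ_res, ht, ht])
  refine ⟨s, fun x hx => ?_⟩
  have := hs ⟨x, hx⟩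
  change res F (i x hx) s = t x hx at this
  rw [← germ_res (i x hx) (hxW x hx), this, ht]

variable {G H : TopCat.Sheaf (Type u) X}

/-- The operation on stalks induced by a family of operations on sections. -/
def stalkMap₂ (m : ∀ U : Opens X, Sec F U → Sec G U → Sec H U) {x : X}
    (a : Stalk F x) (b : Stalk G x) : Stalk H x :=
  germ H (U := (exists_germ a).choose ⊓ (exists_germ b).choose)
    ⟨(exists_germ a).choose_spec.choose, (exists_germ b).choose_spec.choose⟩
    (m _ (res F inf_le_left (exists_germ a).choose_spec.choose_spec.choose)
      (res G inf_le_right (exists_germ b).choose_spec.choose_spec.choose))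

theorem stalkMap₂_germ (m : ∀ U : Opens X, Sec F U → Sec G U → Sec H U)
    (hm : ∀ {U V : Opens X} (h : V ≤ U) (s : Sec F U) (t : Sec G U),
      res H h (m U s t) = m V (res F h s) (res G h t)) {x : X} {U : Opens X} (hx : x ∈ U)
    (s : Sec F U) (t : Sec G U) :
    stalkMap₂ m (germ F hx s) (germ G hx t) = germ H hx (m U s t) := by
  obtain ⟨W, hW, i, j, e⟩ := germ_eq
    (exists_germ (germ F hx s)).choose_spec.choose_spec.choose_spec
  obtain ⟨W', hW', i', j', e'⟩ := germ_eq
    (exists_germ (germ G hx t)).choose_spec.choose_spec.choose_spec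
  have hx' : x ∈ W ⊓ W' := ⟨hW, hW'⟩
  unfold stalkMap₂
  rw [← germ_res (V := W ⊓ W') (le_inf (inf_le_left.trans i) (inf_le_right.trans i')) hx', hm,
    ← germ_res (V := W ⊓ W') (inf_le_left.trans j) hx' (m U s t), hm]
  congr 2
  · rw [res_res, ← res_res j inf_le_left, ← e, res_res]
  · rw [res_res, ← res_res j' inf_le_right, ← e', res_res]

theorem exists_germ₂ {x : X} (a : Stalk F x) (b : Stalk G x) :
    ∃ (U : Opens X) (hx : x ∈ U) (s : Sec F U) (t : Sec G U),
      germ F hx s = a ∧ germ G hx t = b := by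
  obtain ⟨U, hU, s, rfl⟩ := exists_germ a
  obtain ⟨V, hV, t, rfl⟩ := exists_germ b
  exact ⟨U ⊓ V, ⟨hU, hV⟩, res F inf_le_left s, res G inf_le_right t, germ_res _ _ _, germ_res _ _ _⟩

theorem exists_germ₃ {x : X} (a : Stalk F x) (b : Stalk G x) (c : Stalk H x) :
    ∃ (U : Opens X) (hx : x ∈ U) (s : Sec F U) (t : Sec G U) (w : Sec H U),
      germ F hx s = a ∧ germ G hx t = b ∧ germ H hx w = c := by
  obtain ⟨U, hU, s, t, rfl, rfl⟩ := exists_germ₂ a b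
  obtain ⟨V, hV, w, rfl⟩ := exists_germ c
  exact ⟨U ⊓ V, ⟨hU, hV⟩, res F inf_le_left s, res G inf_le_left t, res H inf_le_right w,
    germ_res _ _ _, germ_res _ _ _, germ_res _ _ _⟩

end SetSheaf

/-! ## Pointed monoids

A pointed abelian monoid is a `CommMonoidWithZero`. -/

section Monoids

variable {A B : Type u} [CommMonoidWithZero A] [CommMonoidWithZero B]

/-- An ideal of a pointed monoid. -/
structure IsIdeal (I : Set A) : Prop where
  zero_mem : (0 : A) ∈ I
  mul_mem : ∀ a : A, ∀ x ∈ I, a * x ∈ I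

/-- A (proper) prime ideal of a pointed monoid. -/
structure IsPrimeIdeal (p : Set A) : Prop extends IsIdeal p where
  one_notMem : (1 : A) ∉ p
  mem_or_mem : ∀ x y : A, x * y ∈ p → x ∈ p ∨ y ∈ p

variable (A) in
/-- `A` is partially cancellative: it is the quotient `C / I` of a cancellative monoid `C` by an
ideal `I`, the quotient being the one that identifies all elements of `I` with `0`. -/
def IsPartiallyCancellative : Prop :=
  ∃ (C : Type u) (_ : CommMonoidWithZero C) (_ : IsCancelMulZero C) (I : Set C) (π : C →*₀ A),
    IsIdeal I ∧ Function.Surjective π ∧ ∀ c d : C, π c = π d ↔ c = d ∨ (c ∈ I ∧ d ∈ I)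

variable (A) in
/-- A seminormal monoid: a reduced monoid such that whenever `b ^ 3 = c ^ 2` there is an `a` with
`a ^ 2 = b` and `a ^ 3 = c`. -/
structure IsSeminormal : Prop where
  reduced : IsReduced A
  exists_root : ∀ b c : A, b ^ 3 = c ^ 2 → ∃ a : A, a ^ 2 = b ∧ a ^ 3 = c

/-- `φ : A → B` exhibits `B` as the seminormalization of `A`: the monoid `B` is seminormal, `φ`
induces an injective map on `A_red = A / nil(A)` (the quotient identifying all nilpotent elements
with `0`), and for every `b : B` one has `b ^ n ∈ A_red` for all `n ≫ 0`. -/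
structure IsMonoidSeminormalization (φ : A →*₀ B) : Prop where
  seminormal : IsSeminormal B
  injective_red : ∀ a a' : A, φ a = φ a' ↔ a = a' ∨ (IsNilpotent a ∧ IsNilpotent a')
  pow_mem : ∀ b : B, ∃ N : ℕ, ∀ n ≥ N, b ^ n ∈ Set.range φ

end Monoids

/-! ## Spaces with a sheaf of pointed monoids -/

/-- A topological space with a sheaf of pointed abelian monoids. -/
structure MonoidedSpace : Type (u + 1) where
  /-- the underlying space -/
  space : TopCat.{u}
  /-- the sheaf of sets underlying the structure sheaf -/
  sheaf : TopCat.Sheaf (Type u) space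
  /-- the monoid structure on sections -/
  [mon : ∀ U : Opens space, CommMonoidWithZero (Sec sheaf U)]
  res_zero : ∀ {U V : Opens space} (h : V ≤ U), res sheaf h 0 = 0
  res_one : ∀ {U V : Opens space} (h : V ≤ U), res sheaf h 1 = 1
  res_mul : ∀ {U V : Opens space} (h : V ≤ U) (s t : Sec sheaf U),
    res sheaf h (s * t) = res sheaf h s * res sheaf h t

attribute [instance] MonoidedSpace.mon

namespace MonoidedSpace

variable (X : MonoidedSpace.{u})

/-- The pointed monoid of sections of the structure sheaf over `U`. -/
abbrev sec (U : Opens X.space) : Type u := Sec X.sheaf U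

/-- The stalk of the structure sheaf at `x`. -/
abbrev stalk (x : X.space) : Type u := Stalk X.sheaf x

variable {X} {x : X.space}

instance : Mul (X.stalk x) := ⟨stalkMap₂ fun _ s t => s * t⟩
instance : One (X.stalk x) := ⟨germ X.sheaf (U := ⊤) (Opens.mem_top _) 1⟩
instance : Zero (X.stalk x) := ⟨germ X.sheaf (U := ⊤) (Opens.mem_top _) 0⟩

theorem germ_mul {U : Opens X.space} (hx : x ∈ U) (s t : X.sec U) :
    germ X.sheaf hx (s * t) = germ X.sheaf hx s * germ X.sheaf hx t :=
  (stalkMap₂_germ (fun _ s t => s * t) X.res_mul hx s t).symm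

theorem germ_one {U : Opens X.space} (hx : x ∈ U) : germ X.sheaf hx (1 : X.sec U) = 1 := by
  change _ = germ X.sheaf (U := ⊤) (Opens.mem_top _) 1
  rw [← germ_res (F := X.sheaf) (le_top : U ≤ ⊤) hx, X.res_one]

theorem germ_zero {U : Opens X.space} (hx : x ∈ U) : germ X.sheaf hx (0 : X.sec U) = 0 := by
  change _ = germ X.sheaf (U := ⊤) (Opens.mem_top _) 0
  rw [← germ_res (F := X.sheaf) (le_top : U ≤ ⊤) hx, X.res_zero]

/-- The stalks of the structure sheaf are pointed monoids. -/
instance : CommMonoidWithZero (X.stalk x) where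
  mul_assoc a b c := by
    obtain ⟨U, hx, a, b, c, rfl, rfl, rfl⟩ := exists_germ₃ a b c
    simp only [← germ_mul, mul_assoc]
  mul_comm a b := by
    obtain ⟨U, hx, a, b, rfl, rfl⟩ := exists_germ₂ a b
    simp only [← germ_mul, mul_comm]
  one_mul a := by
    obtain ⟨U, hx, a, rfl⟩ := exists_germ a
    rw [← germ_one hx, ← germ_mul, one_mul]
  mul_one a := by
    obtain ⟨U, hx, a, rfl⟩ := exists_germ a
    rw [← germ_one hx, ← germ_mul, mul_one]
  zero_mul a := by
    obtain ⟨U, hx, a, rfl⟩ := exists_germ a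
    rw [← germ_zero hx, ← germ_mul, zero_mul]
  mul_zero a := by
    obtain ⟨U, hx, a, rfl⟩ := exists_germ a
    rw [← germ_zero hx, ← germ_mul, mul_zero]

/-- A morphism `Y ⟶ X` of spaces with a sheaf of pointed monoids: a continuous map and a morphism
of sheaves of pointed monoids from the structure sheaf of `X` to the direct image of that of `Y`,
such that the maps induced on stalks are local, i.e. reflect units. -/
structure Hom (Y X : MonoidedSpace.{u}) where
  /-- the continuous map -/
  base : C(Y.space, X.space)
  /-- the maps on sections -/
  app : ∀ U : Opens X.space, X.sec U →*₀ Y.sec (Opens.comap base U)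
  app_res : ∀ {U V : Opens X.space} (h : V ≤ U) (s : X.sec U),
    app V (res X.sheaf h s) = res Y.sheaf (Opens.comap_mono base h) (app U s)
  isLocal : ∀ (y : Y.space) (U : Opens X.space) (hy : base y ∈ U) (s : X.sec U),
    IsUnit (germ Y.sheaf (Opens.mem_comap.mpr hy) (app U s)) →
      IsUnit (germ X.sheaf hy s)

namespace Hom

variable {Y X : MonoidedSpace.{u}} (f : Hom Y X)

/-- The map `X.stalk (f y) → Y.stalk y` underlying `Hom.stalkMap`. -/
def stalkFun (y : Y.space) (a : X.stalk (f.base y)) : Y.stalk y :=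
  germ Y.sheaf (Opens.mem_comap.mpr (exists_germ a).choose_spec.choose)
    (f.app _ (exists_germ a).choose_spec.choose_spec.choose)

theorem stalkFun_germ (y : Y.space) {U : Opens X.space} (hy : f.base y ∈ U) (s : X.sec U) :
    f.stalkFun y (germ X.sheaf hy s) =
      germ Y.sheaf (Opens.mem_comap.mpr hy) (f.app U s) := by
  obtain ⟨W, hW, i, j, e⟩ := germ_eq
    (exists_germ (germ X.sheaf hy s)).choose_spec.choose_spec.choose_spec
  unfold stalkFun
  rw [← germ_res (F := Y.sheaf) (V := Opens.comap f.base W) (Opens.comap_mono f.base i)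
    (Opens.mem_comap.mpr hW),
    ← f.app_res, e, f.app_res, germ_res]
  exact i

/-- The map induced on stalks by a morphism. -/
def stalkMap (y : Y.space) : X.stalk (f.base y) →*₀ Y.stalk y where
  toFun := f.stalkFun y
  map_zero' := by
    rw [← germ_zero (U := ⊤) (Opens.mem_top _), stalkFun_germ, map_zero, germ_zero]
  map_one' := by
    rw [← germ_one (U := ⊤) (Opens.mem_top _), stalkFun_germ, map_one, germ_one]
  map_mul' a b := by
    obtain ⟨U, hx, a, b, rfl, rfl⟩ := exists_germ₂ a b
    rw [← germ_mul, stalkFun_germ, map_mul, germ_mul, stalkFun_germ, stalkFun_germ]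

theorem stalkMap_germ (y : Y.space) {U : Opens X.space} (hy : f.base y ∈ U) (s : X.sec U) :
    f.stalkMap y (germ X.sheaf hy s) =
      germ Y.sheaf (Opens.mem_comap.mpr hy) (f.app U s) :=
  f.stalkFun_germ y hy s

/-- `f` is an open immersion: an isomorphism from `Y` onto an open subspace of `X`. -/
structure IsOpenImmersion : Prop where
  isOpenEmbedding : Topology.IsOpenEmbedding f.base
  bijective : ∀ U : Opens X.space, (U : Set X.space) ⊆ Set.range f.base →
    Function.Bijective (f.app U)

end Hom

end MonoidedSpace

/-! ## The prime spectrum of a pointed monoid -/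

section MSpec

variable (A : Type u) [CommMonoidWithZero A]

/-- The set of prime ideals of `A`. -/
def PrimeIdeals : Type u := {p : Set A // IsPrimeIdeal p}

variable {A} in
/-- The multiplicative set `A \ p`. -/
def PrimeIdeals.compl (p : PrimeIdeals A) : Submonoid A where
  carrier := {s | s ∉ p.1}
  one_mem' := p.2.one_notMem
  mul_mem' ha hb h := (p.2.mem_or_mem _ _ h).elim ha hb

/-- The Zariski topology, with basis the sets `D(s) = {p | s ∉ p}`. -/
instance : TopologicalSpace (PrimeIdeals A) :=
  TopologicalSpace.generateFrom (Set.range fun s : A => {p : PrimeIdeals A | s ∉ p.1})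

/-- The local predicate defining the structure sheaf of `MSpec A`: a family of elements
`f p` of the localizations `A_p`, `p ∈ U`, which is locally given by a fraction `a / s`. -/
def isLocallyFraction :
    TopCat.LocalPredicate (X := TopCat.of (PrimeIdeals A)) fun p => Localization p.compl where
  pred {U} f := ∀ x : U, ∃ (V : Opens (TopCat.of (PrimeIdeals A))) (_ : x.1 ∈ V) (i : V ≤ U)
    (a s : A), ∀ p : V, ∃ hs : s ∈ p.1.compl, f ⟨p.1, i p.2⟩ = Localization.mk a ⟨s, hs⟩
  res {V U} i f h x := by
    obtain ⟨W, hW, j, a, s, e⟩ := h ⟨x.1, i.le x.2⟩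
    exact ⟨W ⊓ V, ⟨hW, x.2⟩, inf_le_right, a, s, fun p => e ⟨p.1, p.2.1⟩⟩
  locality {U} f h x := by
    obtain ⟨V, hV, i, e⟩ := h x
    obtain ⟨W, hW, j, a, s, e⟩ := e ⟨x.1, hV⟩
    exact ⟨W, hW, j.trans i.le, a, s, e⟩

/-- The structure sheaf of `MSpec A`. -/
def structureSheaf : TopCat.Sheaf (Type u) (TopCat.of (PrimeIdeals A)) :=
  TopCat.subsheafToTypes (isLocallyFraction A)

variable {A} in
/-- The value at `p` of a section of the structure sheaf. -/
def structureSheaf.val {U : Opens (TopCat.of (PrimeIdeals A))} (f : Sec (structureSheaf A) U) :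
    ∀ p : U, Localization (p : PrimeIdeals A).compl := Subtype.val f

theorem isLocallyFraction_const {U : Opens (TopCat.of (PrimeIdeals A))} (a : A) :
    (isLocallyFraction A).pred fun p : U => Localization.mk a (1 : (p : PrimeIdeals A).compl) :=
  fun x => ⟨U, x.2, le_rfl, a, 1, fun p => ⟨p.1.compl.one_mem, rfl⟩⟩

theorem isLocallyFraction_mul {U : Opens (TopCat.of (PrimeIdeals A))}
    {f g : ∀ p : U, Localization (p : PrimeIdeals A).compl}
    (hf : (isLocallyFraction A).pred f) (hg : (isLocallyFraction A).pred g) :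
    (isLocallyFraction A).pred fun p => f p * g p := by
  intro x
  obtain ⟨V, hV, i, a, s, e⟩ := hf x
  obtain ⟨W, hW, j, b, t, e'⟩ := hg x
  refine ⟨V ⊓ W, ⟨hV, hW⟩, inf_le_left.trans i, a * b, s * t, fun p => ?_⟩
  obtain ⟨hs, e⟩ := e ⟨p.1, p.2.1⟩
  obtain ⟨ht, e'⟩ := e' ⟨p.1, p.2.2⟩
  refine ⟨p.1.compl.mul_mem hs ht, ?_⟩
  exact (congrArg₂ (· * ·) e e').trans (Localization.mk_mul _ _ _ _)

/-- Sections of the structure sheaf form a pointed monoid under pointwise multiplication. -/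
instance (U : Opens (TopCat.of (PrimeIdeals A))) :
    CommMonoidWithZero (Sec (structureSheaf A) U) where
  mul f g := ⟨fun p => f.1 p * g.1 p, isLocallyFraction_mul A f.2 g.2⟩
  one := ⟨fun _ => 1, by
    have := isLocallyFraction_const A (U := U) 1
    simpa only [Localization.mk_one] using this⟩
  zero := ⟨fun _ => 0, by
    have := isLocallyFraction_const A (U := U) 0
    simpa only [Localization.mk_zero] using this⟩
  mul_assoc f g h := Subtype.ext (funext fun p => mul_assoc _ _ _)
  mul_comm f g := Subtype.ext (funext fun p => mul_comm _ _)
  one_mul f := Subtype.ext (funext fun p => one_mul _)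
  mul_one f := Subtype.ext (funext fun p => mul_one _)
  zero_mul f := Subtype.ext (funext fun p => zero_mul _)
  mul_zero f := Subtype.ext (funext fun p => mul_zero _)

/-- The affine monoid scheme `MSpec A`. -/
def MSpec : MonoidedSpace.{u} where
  space := TopCat.of (PrimeIdeals A)
  sheaf := structureSheaf A
  res_zero _ := rfl
  res_one _ := rfl
  res_mul _ _ _ := rfl

end MSpec

namespace MonoidedSpace

variable (X : MonoidedSpace.{u})

/-- An open subspace `U` of `X` is affine if it is isomorphic to `MSpec A` for some `A`. -/
def IsAffineOpen (U : Opens X.space) : Prop :=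
  ∃ (A : Type u) (_ : CommMonoidWithZero A) (j : Hom (MSpec A) X),
    j.IsOpenImmersion ∧ Set.range j.base = U

/-- A monoid scheme: a space with a sheaf of pointed monoids which is locally affine. -/
def IsMonoidScheme : Prop := ∀ x : X.space, ∃ U : Opens X.space, x ∈ U ∧ X.IsAffineOpen U

/-- A partially cancellative monoid scheme: one which is covered by affine open subschemes
`U = MSpec A` with `A = X.sec U` partially cancellative. -/
def IsPCMonoidScheme : Prop :=
  ∀ x : X.space, ∃ U : Opens X.space, x ∈ U ∧ X.IsAffineOpen U ∧ IsPartiallyCancellative (X.sec U)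

variable {X}

/-- `p : Y ⟶ X` exhibits `Y` as the seminormalization of the monoid scheme `X`: it is obtained by
glueing the maps `MSpec (A_sn) → MSpec A`, i.e. `X` is covered by affine opens `U = MSpec A` such
that `p⁻¹ U = MSpec B` is affine and `A → B` is the seminormalization of the monoid `A`. -/
def Hom.IsSeminormalization {Y : MonoidedSpace.{u}} (p : Hom Y X) : Prop :=
  ∀ x : X.space, ∃ U : Opens X.space, x ∈ U ∧ X.IsAffineOpen U ∧
    Y.IsAffineOpen (Opens.comap p.base U) ∧ IsMonoidSeminormalization (p.app U)

end MonoidedSpace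

/-! ## Smash products of sets with an action of a pointed monoid

For a pointed monoid `A`, an `A`-set is a pointed set `M` with an action of `A`, such that the zero
of `A` and the base point of `M` are absorbing: `MulActionWithZero A M`. -/

section Smash

variable (A : Type u) [CommMonoidWithZero A] (M N : Type u) [Zero M] [Zero N]
  [MulActionWithZero A M] [MulActionWithZero A N]

/-- The relations `(a m, n) ~ (m, a n)` defining the smash product. -/
def SmashRel (p q : M × N) : Prop := ∃ (a : A) (m : M) (n : N), p = (a • m, n) ∧ q = (m, a • n)

/-- The smash product `M ∧_A N`: the quotient of `M × N` by the equivalence relation generated by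
`(a m, n) ~ (m, a n)`. The axes `M × 0` and `0 × N` are collapsed to the base point, because
`(m, 0) = (m, 0 • 0) ~ (0 • m, 0) = (0, 0)`, and similarly for `(0, n)`. -/
def Smash : Type u := Quot (SmashRel A M N)

variable {M N}

/-- `g` is a free generator of the `A`-set `M`. -/
def IsFreeGen (g : M) : Prop := Function.Bijective fun a : A => a • g

namespace Smash

/-- The class of `(m, n)` in the smash product. -/
def mk (m : M) (n : N) : Smash A M N := Quot.mk _ (m, n)

theorem mk_balanced (a : A) (m : M) (n : N) : mk A (a • m) n = mk A m (a • n) :=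
  Quot.sound ⟨a, m, n, rfl, rfl⟩

instance : Zero (Smash A M N) := ⟨mk A 0 0⟩

theorem mk_zero_left (n : N) : mk A (0 : M) n = 0 := by
  conv_lhs => rw [← zero_smul A (0 : M), mk_balanced, zero_smul]
  rfl

theorem mk_zero_right (m : M) : mk A m (0 : N) = 0 := by
  conv_lhs => rw [← zero_smul A (0 : N), ← mk_balanced, zero_smul]
  rfl

variable {A}

theorem ind {P : Smash A M N → Prop} (h : ∀ m n, P (mk A m n)) (t : Smash A M N) : P t :=
  Quot.ind (fun p => h p.1 p.2) t

/-- Maps out of the smash product. -/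
def lift {P : Type u} (f : M → N → P) (hf : ∀ (a : A) m n, f (a • m) n = f m (a • n)) :
    Smash A M N → P :=
  Quot.lift (fun p => f p.1 p.2) (by rintro _ _ ⟨a, m, n, rfl, rfl⟩; exact hf a m n)

@[simp] theorem lift_mk {P : Type u} (f : M → N → P)
    (hf : ∀ (a : A) m n, f (a • m) n = f m (a • n)) (m : M) (n : N) :
    lift f hf (mk A m n) = f m n := rfl

instance : SMul A (Smash A M N) :=
  ⟨fun a => lift (fun m n => mk A (a • m) n) fun b m n => by
    rw [← mk_balanced, smul_smul, smul_smul, mul_comm]⟩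

theorem smul_mk (a : A) (m : M) (n : N) : a • mk A m n = mk A (a • m) n := rfl

theorem smul_mk' (a : A) (m : M) (n : N) : a • mk A m n = mk A m (a • n) := mk_balanced A a m n

instance : MulActionWithZero A (Smash A M N) where
  one_smul t := by induction t using ind; rw [smul_mk, one_smul]
  mul_smul a b t := by induction t using ind; rw [smul_mk, smul_mk, smul_mk, mul_smul]
  smul_zero a := by change a • mk A 0 0 = mk A 0 0; rw [smul_mk, smul_zero]
  zero_smul t := by induction t using ind; rw [smul_mk, zero_smul, mk_zero_left]

theorem isFreeGen {g : M} {h : N} (hg : IsFreeGen A g) (hh : IsFreeGen A h) :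
    IsFreeGen A (mk A g h) := by
  constructor
  · intro a b hab
    let c : M → A := fun m => (hg.2 m).choose
    let d : N → A := fun n => (hh.2 n).choose
    have hc : ∀ m, c m • g = m := fun m => (hg.2 m).choose_spec
    have hd : ∀ n, d n • h = n := fun n => (hh.2 n).choose_spec
    have hc' : ∀ a m, c (a • m) = a * c m := fun a m => hg.1 (by simp only [hc, mul_smul])
    have hd' : ∀ a n, d (a • n) = a * d n := fun a n => hh.1 (by simp only [hd, mul_smul])
    have key := congrArg (lift (fun m n => c m * d n) fun a m n => by
      rw [hc', hd', mul_left_comm, mul_assoc]) hab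
    simp only [smul_mk, lift_mk] at key
    have hcg : ∀ a, c (a • g) = a := fun a => hg.1 (hc _)
    have hdh : d h = 1 := hh.1 (by simp only [hd, one_smul])
    rwa [hcg, hcg, hdh, mul_one, mul_one] at key
  · intro t
    induction t using ind with
    | h m n =>
      obtain ⟨a, rfl⟩ := hg.2 m
      obtain ⟨b, rfl⟩ := hh.2 n
      refine ⟨a * b, ?_⟩
      dsimp only
      rw [mul_smul, smul_mk', smul_mk]

end Smash

end Smash

section BaseChange

variable {A B : Type u} [CommMonoidWithZero A] [CommMonoidWithZero B] (φ : A →*₀ B)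
  (M : Type u) [Zero M] [MulActionWithZero A M]

/-- The relations `(a m, b) ~ (m, φ(a) b)`. -/
def BaseChangeRel (p q : M × B) : Prop :=
  ∃ (a : A) (m : M) (b : B), p = (a • m, b) ∧ q = (m, φ a * b)

/-- The `B`-set `M ∧_A B` obtained from the `A`-set `M` by base change along `φ : A → B`. -/
def BaseChange : Type u := Quot (BaseChangeRel φ M)

namespace BaseChange

variable {M}

/-- The class of `(m, b)` in `M ∧_A B`. -/
def mk (m : M) (b : B) : BaseChange φ M := Quot.mk _ (m, b)

theorem mk_balanced (a : A) (m : M) (b : B) : mk φ (a • m) b = mk φ m (φ a * b) :=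
  Quot.sound ⟨a, m, b, rfl, rfl⟩

variable {φ}

theorem ind {P : BaseChange φ M → Prop} (h : ∀ m b, P (mk φ m b)) (t : BaseChange φ M) : P t :=
  Quot.ind (fun p => h p.1 p.2) t

/-- Maps out of the base change. -/
def lift {P : Type u} (f : M → B → P) (hf : ∀ (a : A) m b, f (a • m) b = f m (φ a * b)) :
    BaseChange φ M → P :=
  Quot.lift (fun p => f p.1 p.2) (by rintro _ _ ⟨a, m, n, rfl, rfl⟩; exact hf a m n)

@[simp] theorem lift_mk {P : Type u} (f : M → B → P)
    (hf : ∀ (a : A) m b, f (a • m) b = f m (φ a * b)) (m : M) (b : B) :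
    lift f hf (mk φ m b) = f m b := rfl

instance : Zero (BaseChange φ M) := ⟨mk φ 0 0⟩

theorem mk_zero (m : M) : mk φ m 0 = 0 := by
  change _ = mk φ 0 0
  rw [← zero_smul A m, mk_balanced, mul_zero]

instance : SMul B (BaseChange φ M) :=
  ⟨fun c => lift (fun m b => mk φ m (c * b)) fun a m b => by
    rw [mk_balanced, mul_left_comm]⟩

theorem smul_mk (c : B) (m : M) (b : B) : c • mk φ m b = mk φ m (c * b) := rfl

instance : MulActionWithZero B (BaseChange φ M) where
  one_smul t := by induction t using ind; rw [smul_mk, one_mul]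
  mul_smul a b t := by induction t using ind; rw [smul_mk, smul_mk, smul_mk, mul_assoc]
  smul_zero a := by change a • mk φ 0 0 = mk φ 0 0; rw [smul_mk, mul_zero]
  zero_smul t := by induction t using ind; rw [smul_mk, zero_mul, mk_zero]

theorem isFreeGen {g : M} (hg : IsFreeGen A g) : IsFreeGen B (mk φ g 1) := by
  constructor
  · intro b b' hb
    let c : M → A := fun m => (hg.2 m).choose
    have hc : ∀ m, c m • g = m := fun m => (hg.2 m).choose_spec
    have hc' : ∀ a m, c (a • m) = a * c m := fun a m => hg.1 (by simp only [hc, mul_smul])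
    have key := congrArg (lift (fun m b => φ (c m) * b) fun a m b => by
      rw [hc', map_mul, mul_left_comm, mul_assoc]) hb
    simp only [smul_mk, lift_mk] at key
    have hcg : c g = 1 := hg.1 (by simp only [hc, one_smul])
    simpa only [hcg, map_one, one_mul, mul_one] using key
  · intro t
    induction t using ind with
    | h m b =>
      obtain ⟨a, rfl⟩ := hg.2 m
      refine ⟨φ a * b, ?_⟩
      dsimp only
      rw [smul_mk, mk_balanced, mul_one]

end BaseChange

end BaseChange

section Dual

variable (A : Type u) [CommMonoidWithZero A] (M : Type u) [Zero M] [MulActionWithZero A M]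

/-- The `A`-set `Hom_A(M, A)`. -/
def Dual : Type u := M →[A] A

variable {A M}

instance : FunLike (Dual A M) M A := inferInstanceAs (FunLike (M →[A] A) M A)

theorem Dual.map_smul (f : Dual A M) (a : A) (m : M) : f (a • m) = a * f m :=
  MulActionHom.map_smul (f : M →[A] A) a m

theorem Dual.ext {f g : Dual A M} (h : ∀ m, f m = g m) : f = g := DFunLike.ext _ _ h

/-- Constructor for elements of `Hom_A(M, A)`. -/
def Dual.of (f : M → A) (hf : ∀ (a : A) m, f (a • m) = a * f m) : Dual A M :=
  { toFun := f, map_smul' := hf }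

@[simp] theorem Dual.of_apply (f : M → A) (hf : ∀ (a : A) m, f (a • m) = a * f m) (m : M) :
    Dual.of f hf m = f m := rfl

instance : Zero (Dual A M) := ⟨Dual.of (fun _ => 0) fun a _ => (mul_zero a).symm⟩

instance : SMul A (Dual A M) :=
  ⟨fun a f => Dual.of (fun m => a * f m) fun b m => by rw [f.map_smul, mul_left_comm]⟩

@[simp] theorem Dual.zero_apply (m : M) : (0 : Dual A M) m = 0 := rfl

@[simp] theorem Dual.smul_apply (a : A) (f : Dual A M) (m : M) : (a • f) m = a * f m := rfl

instance : MulActionWithZero A (Dual A M) where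
  one_smul _ := Dual.ext fun _ => one_mul _
  mul_smul _ _ _ := Dual.ext fun _ => mul_assoc _ _ _
  smul_zero _ := Dual.ext fun _ => mul_zero _
  zero_smul _ := Dual.ext fun _ => zero_mul _

theorem Dual.eq_of_gen {g : M} (hg : IsFreeGen A g) {f f' : Dual A M} (h : f g = f' g) :
    f = f' := Dual.ext fun m => by
  obtain ⟨a, rfl⟩ := hg.2 m
  dsimp only
  rw [f.map_smul, f'.map_smul, h]

/-- The coordinate with respect to a free generator. -/
def Dual.coord {g : M} (hg : IsFreeGen A g) : Dual A M :=
  Dual.of (fun m => (hg.2 m).choose) fun a m => hg.1 (by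
    have h : ∀ m, (hg.2 m).choose • g = m := fun m => (hg.2 m).choose_spec
    simp only [h, mul_smul])

theorem Dual.coord_gen {g : M} (hg : IsFreeGen A g) : Dual.coord hg g = 1 :=
  hg.1 (by
    have h : Dual.coord hg g • g = g := (hg.2 g).choose_spec
    simp only [h, one_smul])

theorem Dual.isFreeGen_coord {g : M} (hg : IsFreeGen A g) :
    IsFreeGen A (Dual.coord hg) := by
  constructor
  · intro a b h
    have := congrArg (fun f : Dual A M => f g) h
    simpa [Dual.coord_gen] using this
  · intro f
    refine ⟨f g, Dual.eq_of_gen hg ?_⟩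
    simp [Dual.coord_gen]

end Dual

/-! ## Sheaves of sets with an action of the structure sheaf -/

open MonoidedSpace

/-- A sheaf of `𝒜`-sets on `(X, 𝒜)`: a sheaf of pointed sets with an action of the sheaf of pointed
monoids `𝒜`. (Restriction maps preserve base points since `0 = 0 • s`.) -/
structure ActSheaf (X : MonoidedSpace.{u}) : Type (u + 1) where
  /-- the underlying sheaf of sets -/
  sheaf : TopCat.Sheaf (Type u) X.space
  /-- the base points -/
  [zero : ∀ U : Opens X.space, Zero (Sec sheaf U)]
  /-- the action -/
  [act : ∀ U : Opens X.space, MulActionWithZero (X.sec U) (Sec sheaf U)]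
  res_smul : ∀ {U V : Opens X.space} (h : V ≤ U) (a : X.sec U) (s : Sec sheaf U),
    res sheaf h (a • s) = res X.sheaf h a • res sheaf h s

attribute [instance] ActSheaf.zero ActSheaf.act

namespace ActSheaf

variable {X : MonoidedSpace.{u}}

/-- Sections of a sheaf of `𝒜`-sets. -/
abbrev sec (L : ActSheaf X) (U : Opens X.space) : Type u := Sec L.sheaf U

/-- The stalk of a sheaf of `𝒜`-sets. -/
abbrev stalk (L : ActSheaf X) (x : X.space) : Type u := Stalk L.sheaf x

section Stalk

variable {L : ActSheaf X} {x : X.space}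

instance : Zero (L.stalk x) := ⟨germ L.sheaf (Opens.mem_top x) 0⟩
instance : SMul (X.stalk x) (L.stalk x) := ⟨stalkMap₂ fun _ a s => a • s⟩

theorem germ_smul {U : Opens X.space} (hx : x ∈ U) (a : X.sec U) (s : L.sec U) :
    germ L.sheaf hx (a • s) = germ X.sheaf hx a • germ L.sheaf hx s :=
  (stalkMap₂_germ (fun _ a s => a • s) L.res_smul hx a s).symm

theorem res_zero {U V : Opens X.space} (h : V ≤ U) : res L.sheaf h 0 = 0 := by
  rw [← zero_smul (X.sec U) (0 : L.sec U), L.res_smul, X.res_zero, zero_smul]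

theorem germ_zero {U : Opens X.space} (hx : x ∈ U) : germ L.sheaf hx (0 : L.sec U) = 0 := by
  change _ = germ L.sheaf (Opens.mem_top x) 0
  rw [← germ_res (F := L.sheaf) (le_top : U ≤ ⊤) hx, res_zero]

/-- The stalk of a sheaf of `𝒜`-sets at `x` is an `𝒜_x`-set. -/
instance : MulActionWithZero (X.stalk x) (L.stalk x) where
  one_smul s := by
    obtain ⟨U, hx, s, rfl⟩ := exists_germ s
    rw [← germ_one hx, ← germ_smul, one_smul]
  mul_smul a b s := by
    obtain ⟨U, hx, a, b, s, rfl, rfl, rfl⟩ := exists_germ₃ a b s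
    simp only [← germ_mul, ← germ_smul, mul_smul]
  smul_zero a := by
    obtain ⟨U, hx, a, rfl⟩ := exists_germ a
    rw [← germ_zero hx, ← germ_smul, smul_zero]
  zero_smul s := by
    obtain ⟨U, hx, s, rfl⟩ := exists_germ s
    rw [← MonoidedSpace.germ_zero hx, ← germ_smul, zero_smul, germ_zero]

end Stalk

/-- The structure sheaf as a sheaf of `𝒜`-sets. -/
def unit (X : MonoidedSpace.{u}) : ActSheaf X where
  sheaf := X.sheaf
  zero := fun _ => inferInstance
  act := fun _ => MonoidWithZero.toMulActionWithZero _
  res_smul := X.res_mul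

/-- An isomorphism over the open subset `U` between two sheaves of `𝒜`-sets. -/
structure IsoOn (U : Opens X.space) (L M : ActSheaf X) where
  /-- the bijections on sections -/
  equiv : ∀ V : Opens X.space, V ≤ U → (L.sec V ≃ M.sec V)
  map_smul : ∀ (V : Opens X.space) (h : V ≤ U) (a : X.sec V) (s : L.sec V),
    equiv V h (a • s) = a • equiv V h s
  map_res : ∀ (V W : Opens X.space) (h : V ≤ U) (k : W ≤ V) (s : L.sec V),
    equiv W (k.trans h) (res L.sheaf k s) = res M.sheaf k (equiv V h s)

/-- Isomorphisms of sheaves of `𝒜`-sets. -/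
abbrev Iso (L M : ActSheaf X) := IsoOn ⊤ L M

/-- An invertible sheaf: a sheaf of `𝒜`-sets which is locally isomorphic to `𝒜`. -/
def IsInvertible (L : ActSheaf X) : Prop :=
  ∀ x : X.space, ∃ U : Opens X.space, x ∈ U ∧ Nonempty (IsoOn U (unit X) L)

/-- The identity isomorphism. -/
def Iso.refl (L : ActSheaf X) : Iso L L := ⟨fun _ _ => Equiv.refl _, fun _ _ _ _ => rfl,
  fun _ _ _ _ _ => rfl⟩

/-- The inverse isomorphism. -/
def Iso.symm {L M : ActSheaf X} (e : Iso L M) : Iso M L where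
  equiv V h := (e.equiv V h).symm
  map_smul V h a s := (e.equiv V h).injective (by
    rw [e.map_smul, Equiv.apply_symm_apply, Equiv.apply_symm_apply])
  map_res V W h k s := (e.equiv W (k.trans h)).injective (by
    rw [e.map_res V W h, Equiv.apply_symm_apply, Equiv.apply_symm_apply])

/-- The composition of two isomorphisms. -/
def Iso.trans {L M N : ActSheaf X} (e : Iso L M) (e' : Iso M N) : Iso L N where
  equiv V h := (e.equiv V h).trans (e'.equiv V h)
  map_smul V h a s := by
    rw [Equiv.trans_apply, e.map_smul, e'.map_smul, Equiv.trans_apply]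
  map_res V W h k s := by
    rw [Equiv.trans_apply, e.map_res V W h, e'.map_res V W h, Equiv.trans_apply]

/-! ### Isomorphisms on stalks -/

/-- A family of isomorphisms of stalks over the points of `U`, which maps sections to sections. -/
structure IsStalkIso (U : Opens X.space) {L M : ActSheaf X}
    (φ : ∀ x : X.space, x ∈ U → L.stalk x → M.stalk x) : Prop where
  bijective : ∀ x hx, Function.Bijective (φ x hx)
  map_smul : ∀ x hx (a : X.stalk x) t, φ x hx (a • t) = a • φ x hx t
  map_sec : ∀ (V : Opens X.space) (h : V ≤ U) (s : L.sec V), ∀ x ∈ V,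
    ∃ (W : Opens X.space) (_ : x ∈ W) (i : W ≤ V) (t : M.sec W), ∀ y (hy : y ∈ W),
      φ y (h (i hy)) (germ L.sheaf (i hy) s) = germ M.sheaf hy t

theorem IsStalkIso.isoOn {U : Opens X.space} {L M : ActSheaf X}
    {φ : ∀ x : X.space, x ∈ U → L.stalk x → M.stalk x} (hφ : IsStalkIso U φ) :
    Nonempty (IsoOn U L M) := by
  have key : ∀ (V : Opens X.space) (h : V ≤ U) (s : L.sec V), ∃ t : M.sec V,
      ∀ x (hx : x ∈ V), germ M.sheaf hx t = φ x (h hx) (germ L.sheaf hx s) := by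
    intro V h s
    refine exists_sec (F := M.sheaf) (fun x hx => φ x (h hx) (germ L.sheaf hx s)) fun x hx => ?_
    obtain ⟨W, hW, i, t, ht⟩ := hφ.map_sec V h s x hx
    exact ⟨W, hW, i, t, fun y hy => (ht y hy).symm⟩
  choose f hf using key
  have inj : ∀ V h, Function.Injective (f V h) := by
    intro V h s t hst
    refine sec_ext fun x hx => (hφ.bijective x (h hx)).1 ?_
    rw [← hf, ← hf, hst]
  have surj : ∀ V h, Function.Surjective (f V h) := by
    intro V h t
    have ha : ∀ x (hx : x ∈ V), ∃ a, φ x (h hx) a = germ M.sheaf hx t :=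
      fun x hx => (hφ.bijective x (h hx)).2 _
    choose a ha using ha
    obtain ⟨s, hs⟩ := exists_sec (F := L.sheaf) a (by
      intro x hx
      obtain ⟨W, hW, l, hl⟩ := exists_germ (a x hx)
      have hx' : x ∈ W ⊓ V := Opens.mem_inf.mpr ⟨hW, hx⟩
      have e : germ M.sheaf hx' (f (W ⊓ V) (inf_le_right.trans h) (res L.sheaf inf_le_left l)) =
          germ M.sheaf hx t := by
        rw [hf, germ_res, hl, ha]
      obtain ⟨W', hW', i, j, e⟩ := germ_eq e
      refine ⟨W', hW', j, res L.sheaf (i.trans inf_le_left) l, fun y hy => ?_⟩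
      apply (hφ.bijective y (h (j hy))).1
      rw [ha, ← germ_res j hy t, ← e, germ_res i hy, hf, germ_res, germ_res])
    refine ⟨s, sec_ext fun x hx => ?_⟩
    rw [hf, hs, ha]
  refine ⟨⟨fun V h => Equiv.ofBijective (f V h) ⟨inj V h, surj V h⟩, ?_, ?_⟩⟩
  · intro V h a s
    refine sec_ext fun x hx => ?_
    change germ M.sheaf hx (f V h (a • s)) = germ M.sheaf hx (a • f V h s)
    rw [hf, germ_smul, germ_smul, hφ.map_smul, hf]
  · intro V W h k s
    refine sec_ext fun x hx => ?_
    change germ M.sheaf hx (f W (k.trans h) (MonoidGeom.res L.sheaf k s)) =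
      germ M.sheaf hx (MonoidGeom.res M.sheaf k (f V h s))
    rw [hf, germ_res, germ_res, hf]

theorem IsoOn.exists_isStalkIso {U : Opens X.space} {L M : ActSheaf X} (e : IsoOn U L M) :
    ∃ φ : ∀ x : X.space, x ∈ U → L.stalk x → M.stalk x, IsStalkIso U φ ∧
      ∀ (V : Opens X.space) (h : V ≤ U) (s : L.sec V) (x) (hx : x ∈ V),
        φ x (h hx) (germ L.sheaf hx s) = germ M.sheaf hx (e.equiv V h s) := by
  have rep : ∀ x (_ : x ∈ U) (t : L.stalk x), ∃ (V : Opens X.space) (_ : V ≤ U) (hx : x ∈ V)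
      (s : L.sec V), germ L.sheaf hx s = t := by
    intro x hx t
    obtain ⟨V, hV, s, rfl⟩ := exists_germ t
    exact ⟨V ⊓ U, inf_le_right, Opens.mem_inf.mpr ⟨hV, hx⟩, res L.sheaf inf_le_left s,
      germ_res _ _ _⟩
  choose V h hV s hs using rep
  have key : ∀ (V' : Opens X.space) (h' : V' ≤ U) (s' : L.sec V') (x) (hx : x ∈ V'),
      germ M.sheaf (hV x (h' hx) (germ L.sheaf hx s'))
        (e.equiv _ (h x (h' hx) (germ L.sheaf hx s')) (s x (h' hx) (germ L.sheaf hx s'))) =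
      germ M.sheaf hx (e.equiv V' h' s') := by
    intro V' h' s' x hx
    obtain ⟨W, hW, i, j, q⟩ := germ_eq (hs x (h' hx) (germ L.sheaf hx s'))
    rw [← germ_res i hW, ← e.map_res, ← germ_res j hW (e.equiv V' h' s'), ← e.map_res V' W h', q]
  refine ⟨fun x hx t => germ M.sheaf (hV x hx t) (e.equiv _ (h x hx t) (s x hx t)),
    ⟨?_, ?_, ?_⟩, key⟩
  · intro x hx
    constructor
    · intro t t' q
      obtain ⟨W, hW, i, j, q⟩ := germ_eq q
      rw [← e.map_res, ← e.map_res] at q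
      rw [← hs x hx t, ← hs x hx t', ← germ_res i hW, (e.equiv _ _).injective q, germ_res]
    · intro t
      obtain ⟨W, hW, t, rfl⟩ := exists_germ t
      have hx' : x ∈ W ⊓ U := Opens.mem_inf.mpr ⟨hW, hx⟩
      refine ⟨germ L.sheaf hx' ((e.equiv _ inf_le_right).symm (res M.sheaf inf_le_left t)), ?_⟩
      refine (key _ inf_le_right _ _ hx').trans ?_
      rw [Equiv.apply_symm_apply, germ_res]
  · intro x hx a t
    obtain ⟨W, hW, a, t, rfl, rfl⟩ := exists_germ₂ a t
    have hx' : x ∈ W ⊓ U := Opens.mem_inf.mpr ⟨hW, hx⟩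
    rw [← germ_res inf_le_left hx' a, ← germ_res inf_le_left hx' t, ← germ_smul]
    refine (key _ inf_le_right _ _ hx').trans ?_
    rw [e.map_smul, germ_smul]
    exact congrArg _ (key _ inf_le_right _ _ hx').symm
  · intro V' h' s' x hx
    exact ⟨V', hx, le_rfl, e.equiv V' h' s', fun y hy => key _ _ _ _ _⟩

/-- `g` generates `L` freely over `U`. -/
def IsGen {U : Opens X.space} (L : ActSheaf X) (g : L.sec U) : Prop :=
  ∀ x (hx : x ∈ U), IsFreeGen (X.stalk x) (germ L.sheaf hx g)

theorem IsGen.res {U V : Opens X.space} {L : ActSheaf X} {g : L.sec U} (hg : L.IsGen g)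
    (h : V ≤ U) : L.IsGen (MonoidGeom.res L.sheaf h g) := by
  intro x hx
  rw [germ_res]
  exact hg x (h hx)

/-- The section `1` of the structure sheaf. -/
def one (U : Opens X.space) : (unit X).sec U := (1 : X.sec U)

theorem smul_one_germ {U : Opens X.space} {x : X.space} (hx : x ∈ U) (a : X.stalk x) :
    a • germ (unit X).sheaf hx (one U) = a := by
  change a * germ X.sheaf hx (1 : X.sec U) = a
  rw [germ_one, mul_one]

theorem isGen_one {U : Opens X.space} : (unit X).IsGen (one U) := by
  intro x hx
  unfold IsFreeGen
  simp only [smul_one_germ]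
  exact Function.bijective_id

theorem isInvertible_iff {L : ActSheaf X} : L.IsInvertible ↔
    ∀ x : X.space, ∃ (U : Opens X.space) (_ : x ∈ U) (g : L.sec U), L.IsGen g := by
  refine forall_congr' fun x => exists_congr fun U => ?_
  constructor
  · rintro ⟨hx, ⟨e⟩⟩
    obtain ⟨φ, hφ, hk⟩ := e.exists_isStalkIso
    refine ⟨hx, e.equiv U le_rfl (one U), fun y hy => ?_⟩
    rw [← hk]
    have : (fun a : X.stalk y => a • φ y hy (germ (unit X).sheaf hy (one U))) =
        fun a => φ y hy (a • germ (unit X).sheaf hy (one U)) :=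
      funext fun a => (hφ.map_smul _ _ _ _).symm
    unfold IsFreeGen
    rw [this]
    exact (hφ.bijective y hy).comp (isGen_one y hy)
  · rintro ⟨hx, g, hg⟩
    refine ⟨hx, IsStalkIso.isoOn
      (φ := fun x hx (a : X.stalk x) => a • germ L.sheaf hx g) ⟨hg, ?_, ?_⟩⟩
    · intro x hx a t
      exact mul_smul a t _
    · intro V h s x hx
      exact ⟨V, hx, le_rfl, (show X.sec V from s) • MonoidGeom.res L.sheaf h g, fun y hy => by
        rw [germ_smul, germ_res]; rfl⟩

/-! ### Sheaves of families of elements of the stalks -/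

section OfPred

variable {T : X.space → Type u} [∀ x, Zero (T x)] [∀ x, MulActionWithZero (X.stalk x) (T x)]

/-- The sheaf of families of elements of the `𝒜_x`-sets `T x` satisfying a local condition. -/
def ofPred (P : TopCat.LocalPredicate T) (hzero : ∀ U : Opens X.space, P.pred fun _ : U => 0)
    (hsmul : ∀ {U : Opens X.space} (a : X.sec U) {f : ∀ x : U, T x}, P.pred f →
      P.pred fun x : U => germ X.sheaf x.2 a • f x) : ActSheaf X where
  sheaf := TopCat.subsheafToTypes P
  zero := fun U => ⟨⟨fun _ => 0, hzero U⟩⟩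
  act := fun U =>
    letI : Zero (Sec (TopCat.subsheafToTypes P) U) := ⟨⟨fun _ => 0, hzero U⟩⟩
    { smul := fun a f => ⟨fun x => germ X.sheaf x.2 a • f.1 x, hsmul a f.2⟩
      one_smul := fun f => Subtype.ext (funext fun x => by
        change germ X.sheaf x.2 1 • f.1 x = f.1 x
        rw [germ_one, one_smul])
      mul_smul := fun a b f => Subtype.ext (funext fun x => by
        change germ X.sheaf x.2 (a * b) • f.1 x =
          germ X.sheaf x.2 a • germ X.sheaf x.2 b • f.1 x
        rw [germ_mul, mul_smul])
      smul_zero := fun a => Subtype.ext (funext fun x => by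
        change germ X.sheaf x.2 a • (0 : T x) = 0
        rw [smul_zero])
      zero_smul := fun f => Subtype.ext (funext fun x => by
        change germ X.sheaf x.2 0 • f.1 x = 0
        rw [MonoidedSpace.germ_zero, zero_smul]) }
  res_smul h a f := Subtype.ext (funext fun x => by
    change germ X.sheaf (h x.2) a • f.1 ⟨x.1, h x.2⟩ =
      germ X.sheaf x.2 (res X.sheaf h a) • f.1 ⟨x.1, h x.2⟩
    rw [germ_res])

variable {P : TopCat.LocalPredicate T} {hzero : ∀ U : Opens X.space, P.pred fun _ : U => 0}
    {hsmul : ∀ {U : Opens X.space} (a : X.sec U) {f : ∀ x : U, T x}, P.pred f →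
      P.pred fun x : U => germ X.sheaf x.2 a • f x}

/-- Evaluation of the germ at `x` of a family. -/
def ev (x : X.space) : (ofPred P hzero hsmul).stalk x → T x := TopCat.stalkToFiber P x

theorem ev_germ {U : Opens X.space} {x : X.space} (hx : x ∈ U) (f : (ofPred P hzero hsmul).sec U) :
    ev x (germ (ofPred P hzero hsmul).sheaf hx f) = f.1 ⟨x, hx⟩ :=
  TopCat.stalkToFiber_germ P U x hx f

theorem ev_smul (x : X.space) (a : X.stalk x) (t : (ofPred P hzero hsmul).stalk x) :
    ev x (a • t) = a • ev x t := by
  obtain ⟨U, hx, a, t, rfl, rfl⟩ := exists_germ₂ a t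
  rw [← germ_smul, ev_germ, ev_germ]
  rfl

theorem ev_injective (x : X.space)
    (h : ∀ {U V : Opens X.space} (hU : x ∈ U) (hV : x ∈ V) (f : ∀ x : U, T x) (g : ∀ x : V, T x),
      P.pred f → P.pred g → f ⟨x, hU⟩ = g ⟨x, hV⟩ →
        ∃ (W : Opens X.space) (_ : x ∈ W) (i : W ≤ U) (j : W ≤ V),
          ∀ y : W, f ⟨y, i y.2⟩ = g ⟨y, j y.2⟩) :
    Function.Injective (ev x : (ofPred P hzero hsmul).stalk x → T x) := by
  intro s t hst
  obtain ⟨U, hU, s, rfl⟩ := exists_germ s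
  obtain ⟨V, hV, t, rfl⟩ := exists_germ t
  rw [ev_germ, ev_germ] at hst
  obtain ⟨W, hW, i, j, e⟩ := h hU hV s.1 t.1 s.2 t.2 hst
  rw [← germ_res i hW, ← germ_res j hW t]
  congr 1
  exact Subtype.ext (funext e)

theorem ev_surjective (x : X.space)
    (h : ∀ t : T x, ∃ (U : Opens X.space) (hx : x ∈ U) (f : ∀ x : U, T x),
      P.pred f ∧ f ⟨x, hx⟩ = t) :
    Function.Surjective (ev x : (ofPred P hzero hsmul).stalk x → T x) := by
  intro t
  obtain ⟨U, hx, f, hf, rfl⟩ := h t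
  exact ⟨germ (ofPred P hzero hsmul).sheaf hx (⟨f, hf⟩ : {f : ∀ x : U, T x // P.pred f}),
    ev_germ hx _⟩

end OfPred

/-! ### The smash product of two sheaves of `𝒜`-sets -/

section SmashSheaf

variable (L M : ActSheaf X)

/-- Families of elements of `L_x ∧_{𝒜_x} M_x` which are locally of the form `[l, m]` for sections
`l` of `L` and `m` of `M`. -/
def smashPred : TopCat.LocalPredicate
    fun x : X.space => Smash (X.stalk x) (L.stalk x) (M.stalk x) where
  pred {U} f := ∀ x : U, ∃ (V : Opens X.space) (_ : x.1 ∈ V) (i : V ≤ U) (l : L.sec V)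
    (m : M.sec V), ∀ y : V, f ⟨y.1, i y.2⟩ =
      Smash.mk (X.stalk y.1) (germ L.sheaf y.2 l) (germ M.sheaf y.2 m)
  res {V U} i f h x := by
    obtain ⟨W, hW, j, l, m, e⟩ := h ⟨x.1, i.le x.2⟩
    refine ⟨W ⊓ V, ⟨hW, x.2⟩, inf_le_right, res L.sheaf inf_le_left l,
      res M.sheaf inf_le_left m, fun y => ?_⟩
    rw [germ_res, germ_res]
    exact e ⟨y.1, y.2.1⟩
  locality {U} f h x := by
    obtain ⟨V, hV, i, h⟩ := h x
    obtain ⟨W, hW, j, l, m, e⟩ := h ⟨x.1, hV⟩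
    exact ⟨W, hW, j.trans i.le, l, m, e⟩

theorem smashPred_zero (U : Opens X.space) : (smashPred L M).pred fun _ : U => 0 :=
  fun x => ⟨U, x.2, le_rfl, 0, 0, fun y => by rw [germ_zero, germ_zero]; rfl⟩

theorem smashPred_smul {U : Opens X.space} (a : X.sec U)
    {f : ∀ x : U, Smash (X.stalk x.1) (L.stalk x.1) (M.stalk x.1)} (h : (smashPred L M).pred f) :
    (smashPred L M).pred fun x : U => germ X.sheaf x.2 a • f x := fun x => by
  obtain ⟨V, hV, i, l, m, e⟩ := h x
  refine ⟨V, hV, i, res X.sheaf i a • l, m, fun y => ?_⟩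
  rw [germ_smul, ← Smash.smul_mk, germ_res]
  exact congrArg _ (e y)

/-- The smash product `L ∧_𝒜 M`: the sheafification of the presheaf `U ↦ L(U) ∧_{𝒜(U)} M(U)`, whose
stalks are the `L_x ∧_{𝒜_x} M_x` and whose sections are the families of elements of these stalks
which are locally given by sections of the presheaf. -/
def smash : ActSheaf X := ofPred (smashPred L M) (smashPred_zero L M) (smashPred_smul L M)

variable {L M}

theorem smash_eq_near {x : X.space} {p q : L.stalk x × M.stalk x}
    (h : Relation.EqvGen (SmashRel (X.stalk x) (L.stalk x) (M.stalk x)) p q) :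
    ∀ {U U' : Opens X.space} (hU : x ∈ U) (hU' : x ∈ U') (l : L.sec U) (m : M.sec U)
      (l' : L.sec U') (m' : M.sec U'), germ L.sheaf hU l = p.1 → germ M.sheaf hU m = p.2 →
      germ L.sheaf hU' l' = q.1 → germ M.sheaf hU' m' = q.2 →
      ∃ (W : Opens X.space) (_ : x ∈ W) (i : W ≤ U) (j : W ≤ U'), ∀ y (hy : y ∈ W),
        Smash.mk (X.stalk y) (germ L.sheaf (i hy) l) (germ M.sheaf (i hy) m) =
          Smash.mk (X.stalk y) (germ L.sheaf (j hy) l') (germ M.sheaf (j hy) m') := by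
  have near : ∀ {U U' : Opens X.space} (hU : x ∈ U) (hU' : x ∈ U') (l : L.sec U) (m : M.sec U)
      (l' : L.sec U') (m' : M.sec U'), germ L.sheaf hU l = germ L.sheaf hU' l' →
      germ M.sheaf hU m = germ M.sheaf hU' m' →
      ∃ (W : Opens X.space) (_ : x ∈ W) (i : W ≤ U) (j : W ≤ U'), ∀ y (hy : y ∈ W),
        Smash.mk (X.stalk y) (germ L.sheaf (i hy) l) (germ M.sheaf (i hy) m) =
          Smash.mk (X.stalk y) (germ L.sheaf (j hy) l') (germ M.sheaf (j hy) m') := by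
    intro U U' hU hU' l m l' m' hl hm
    obtain ⟨W, hW, i, j, e⟩ := germ_eq hl
    obtain ⟨W', hW', i', j', e'⟩ := germ_eq hm
    refine ⟨W ⊓ W', ⟨hW, hW'⟩, inf_le_left.trans i, inf_le_left.trans j, fun y hy => ?_⟩
    rw [← germ_res i hy.1 l, ← germ_res j hy.1 l', e, ← germ_res i' hy.2 m,
      ← germ_res j' hy.2 m', e']
  induction h with
  | rel p q h =>
    obtain ⟨a, m₀, n₀, rfl, rfl⟩ := h
    intro U U' hU hU' l m l' m' h1 h2 h3 h4
    obtain ⟨V, hV, a, m₀, n₀, rfl, rfl, rfl⟩ := exists_germ₃ a m₀ n₀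
    dsimp only at h1 h2 h3 h4
    rw [← germ_smul] at h1 h4
    obtain ⟨W, hW, i, j, e⟩ := near hU hV l m (a • m₀) n₀ h1 h2
    obtain ⟨W', hW', i', j', e'⟩ := near hU' hV l' m' m₀ (a • n₀) h3 h4
    refine ⟨W ⊓ W', ⟨hW, hW'⟩, inf_le_left.trans i, inf_le_right.trans i', fun y hy => ?_⟩
    rw [e y hy.1, e' y hy.2, germ_smul, germ_smul, Smash.mk_balanced]
  | refl p =>
    intro U U' hU hU' l m l' m' h1 h2 h3 h4
    exact near hU hU' l m l' m' (h1.trans h3.symm) (h2.trans h4.symm)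
  | symm p q _ ih =>
    intro U U' hU hU' l m l' m' h1 h2 h3 h4
    obtain ⟨W, hW, i, j, e⟩ := ih hU' hU l' m' l m h3 h4 h1 h2
    exact ⟨W, hW, j, i, fun y hy => (e y hy).symm⟩
  | trans p q r _ _ ih ih' =>
    intro U U' hU hU' l m l' m' h1 h2 h3 h4
    obtain ⟨V, hV, l₀, m₀, h5, h6⟩ := exists_germ₂ q.1 q.2
    obtain ⟨W, hW, i, j, e⟩ := ih hU hV l m l₀ m₀ h1 h2 h5 h6
    obtain ⟨W', hW', i', j', e'⟩ := ih' hV hU' l₀ m₀ l' m' h5 h6 h3 h4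
    refine ⟨W ⊓ W', ⟨hW, hW'⟩, inf_le_left.trans i, inf_le_right.trans j', fun y hy => ?_⟩
    rw [e y hy.1, e' y hy.2]

variable (L M) in
/-- The stalk of the smash product. -/
def smashEv (x : X.space) :
    (smash L M).stalk x → Smash (X.stalk x) (L.stalk x) (M.stalk x) :=
  ev (hzero := smashPred_zero L M) (hsmul := smashPred_smul L M) x

theorem smashEv_smul (x : X.space) (a : X.stalk x) (t : (smash L M).stalk x) :
    smashEv L M x (a • t) = a • smashEv L M x t :=
  ev_smul (hzero := smashPred_zero L M) (hsmul := smashPred_smul L M) x a t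

theorem smashEv_bijective (x : X.space) : Function.Bijective (smashEv L M x) := by
  constructor
  · refine ev_injective (hzero := smashPred_zero L M) (hsmul := smashPred_smul L M) x ?_
    intro U V hU hV f g hf hg h
    obtain ⟨U', hU', i, l, m, e⟩ := hf ⟨x, hU⟩
    obtain ⟨V', hV', j, l', m', e'⟩ := hg ⟨x, hV⟩
    have h' := (e ⟨x, hU'⟩).symm.trans (h.trans (e' ⟨x, hV'⟩))
    obtain ⟨W, hW, k, k', q⟩ := smash_eq_near (Quot.eqvGen_exact h') hU' hV' l m l' m'
      rfl rfl rfl rfl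
    exact ⟨W, hW, k.trans i, k'.trans j, fun y =>
      (e ⟨y.1, k y.2⟩).trans ((q y.1 y.2).trans (e' ⟨y.1, k' y.2⟩).symm)⟩
  · refine ev_surjective (hzero := smashPred_zero L M) (hsmul := smashPred_smul L M) x ?_
    intro t
    induction t using Smash.ind with
    | h l m =>
      obtain ⟨U, hx, l, m, rfl, rfl⟩ := exists_germ₂ l m
      exact ⟨U, hx, fun y => Smash.mk _ (germ L.sheaf y.2 l) (germ M.sheaf y.2 m),
        fun y => ⟨U, y.2, le_rfl, l, m, fun _ => rfl⟩, rfl⟩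

/-- The section `[l, m]` of the smash product. -/
def smashMk {U : Opens X.space} (l : L.sec U) (m : M.sec U) : (smash L M).sec U :=
  ⟨fun y => Smash.mk _ (germ L.sheaf y.2 l) (germ M.sheaf y.2 m),
    fun y => ⟨U, y.2, le_rfl, l, m, fun _ => rfl⟩⟩

theorem smashEv_smashMk {U : Opens X.space} (l : L.sec U) (m : M.sec U) {x : X.space}
    (hx : x ∈ U) : smashEv L M x (germ (smash L M).sheaf hx (smashMk l m)) =
      Smash.mk _ (germ L.sheaf hx l) (germ M.sheaf hx m) :=
  ev_germ (hzero := smashPred_zero L M) (hsmul := smashPred_smul L M) hx _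

theorem smash_local {U : Opens X.space} (s : (smash L M).sec U) {x : X.space} (hx : x ∈ U) :
    ∃ (V : Opens X.space) (_ : x ∈ V) (i : V ≤ U) (l : L.sec V) (m : M.sec V),
      ∀ y (hy : y ∈ V), germ (smash L M).sheaf (i hy) s =
        germ (smash L M).sheaf hy (smashMk l m) := by
  obtain ⟨V, hV, i, l, m, e⟩ := s.2 ⟨x, hx⟩
  refine ⟨V, hV, i, l, m, fun y hy => (smashEv_bijective y).1 ?_⟩
  rw [smashEv_smashMk, ← e ⟨y, hy⟩]
  exact ev_germ (hzero := smashPred_zero L M) (hsmul := smashPred_smul L M) _ _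

/-- The pairing `L_x × M_x → (L ∧ M)_x`. -/
def smashPair (x : X.space) (l : L.stalk x) (m : M.stalk x) : (smash L M).stalk x :=
  (Equiv.ofBijective _ (smashEv_bijective (L := L) (M := M) x)).symm (Smash.mk _ l m)

theorem smashEv_pair (x : X.space) (l : L.stalk x) (m : M.stalk x) :
    smashEv L M x (smashPair x l m) = Smash.mk _ l m :=
  (Equiv.ofBijective _ (smashEv_bijective (L := L) (M := M) x)).apply_symm_apply _

theorem smashPair_germ {U : Opens X.space} (l : L.sec U) (m : M.sec U) {x : X.space}
    (hx : x ∈ U) : smashPair x (germ L.sheaf hx l) (germ M.sheaf hx m) =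
      germ (smash L M).sheaf hx (smashMk l m) :=
  (smashEv_bijective x).1 (by rw [smashEv_pair, smashEv_smashMk])

theorem smashPair_smul_left (x : X.space) (a : X.stalk x) (l : L.stalk x) (m : M.stalk x) :
    smashPair x (a • l) m = a • smashPair x l m :=
  (smashEv_bijective x).1 (by rw [smashEv_smul, smashEv_pair, smashEv_pair, Smash.smul_mk])

theorem smashPair_smul_right (x : X.space) (a : X.stalk x) (l : L.stalk x) (m : M.stalk x) :
    smashPair x l (a • m) = a • smashPair x l m :=
  (smashEv_bijective x).1 (by rw [smashEv_smul, smashEv_pair, smashEv_pair, Smash.smul_mk'])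

theorem smashPair_isFreeGen {x : X.space} {l : L.stalk x} {m : M.stalk x}
    (hl : IsFreeGen (X.stalk x) l) (hm : IsFreeGen (X.stalk x) m) :
    IsFreeGen (X.stalk x) (smashPair x l m) := by
  have h := Smash.isFreeGen hl hm
  unfold IsFreeGen at h ⊢
  rw [← smashEv_pair] at h
  simp only [← smashEv_smul] at h
  exact (Function.Bijective.of_comp_iff' (smashEv_bijective x)
    fun a : X.stalk x => a • smashPair x l m).mp h

theorem IsInvertible.exists_freeGen (hL : L.IsInvertible) (x : X.space) :
    ∃ l : L.stalk x, IsFreeGen (X.stalk x) l := by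
  obtain ⟨U, hU, l, hl⟩ := isInvertible_iff.mp hL x
  exact ⟨_, hl x hU⟩

theorem IsInvertible.smash (hL : L.IsInvertible) (hM : M.IsInvertible) :
    (L.smash M).IsInvertible := by
  rw [isInvertible_iff] at *
  intro x
  obtain ⟨U, hU, l, hl⟩ := hL x
  obtain ⟨V, hV, m, hm⟩ := hM x
  refine ⟨U ⊓ V, ⟨hU, hV⟩, smashMk (res L.sheaf inf_le_left l) (res M.sheaf inf_le_right m),
    fun y hy => ?_⟩
  rw [← smashPair_germ]
  exact smashPair_isFreeGen (hl.res inf_le_left y hy) (hm.res inf_le_right y hy)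

/-- A family of pairings `L_x × M_x → N_x` mapping sections to sections and a pair of generators
to a generator identifies `N` with `L ∧ M`. -/
theorem smash_iso_of_pairing {N : ActSheaf X}
    (β : ∀ x : X.space, L.stalk x → M.stalk x → N.stalk x)
    (hl : ∀ x (a : X.stalk x) l m, β x (a • l) m = a • β x l m)
    (hr : ∀ x (a : X.stalk x) l m, β x l (a • m) = a • β x l m)
    (hs : ∀ (U : Opens X.space) (l : L.sec U) (m : M.sec U) x (_ : x ∈ U),
      ∃ (W : Opens X.space) (_ : x ∈ W) (i : W ≤ U) (n : N.sec W), ∀ y (hy : y ∈ W),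
        β y (germ L.sheaf (i hy) l) (germ M.sheaf (i hy) m) = germ N.sheaf hy n)
    (hg : ∀ x, ∃ l m, IsFreeGen (X.stalk x) l ∧ IsFreeGen (X.stalk x) m ∧
      IsFreeGen (X.stalk x) (β x l m)) : Nonempty (Iso (L.smash M) N) := by
  let ψ : ∀ x : X.space, Smash (X.stalk x) (L.stalk x) (M.stalk x) → N.stalk x :=
    fun x => Smash.lift (β x) fun a l m => by rw [hl, hr]
  have ψ_mk : ∀ x l m, ψ x (Smash.mk _ l m) = β x l m := fun _ _ _ => rfl
  have ψ_smul : ∀ x (a : X.stalk x) t, ψ x (a • t) = a • ψ x t := by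
    intro x a t
    induction t using Smash.ind with
    | h l m => exact hl x a l m
  clear_value ψ
  refine IsStalkIso.isoOn (φ := fun x _ t => ψ x (smashEv L M x t)) ⟨?_, ?_, ?_⟩
  · intro x _
    refine Function.Bijective.comp (g := ψ x) ?_ (smashEv_bijective x)
    obtain ⟨l, m, h1, h2, h3⟩ := hg x
    refine (Function.Bijective.of_comp_iff (ψ x) (Smash.isFreeGen h1 h2)).mp ?_
    have : (ψ x ∘ fun a : X.stalk x => a • Smash.mk (X.stalk x) l m) = fun a => a • β x l m :=
      funext fun a => by rw [Function.comp_apply, ψ_smul, ψ_mk]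
    rw [this]
    exact h3
  · intro x _ a t
    rw [smashEv_smul, ψ_smul]
  · intro V h s x hx
    obtain ⟨W, hW, i, l, m, e⟩ := smash_local s hx
    obtain ⟨W', hW', j, n, e'⟩ := hs W l m x hW
    refine ⟨W', hW', j.trans i, n, fun y hy => ?_⟩
    rw [e y (j hy), smashEv_smashMk, ← e' y hy, ψ_mk]

theorem smash_comm (hL : L.IsInvertible) (hM : M.IsInvertible) :
    Nonempty (Iso (L.smash M) (M.smash L)) := by
  refine smash_iso_of_pairing (fun x l m => smashPair x m l)
    (fun x a l m => smashPair_smul_right x a m l) (fun x a l m => smashPair_smul_left x a m l)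
    (fun U l m x hx => ⟨U, hx, le_rfl, smashMk m l, fun y hy => smashPair_germ m l hy⟩)
    fun x => ?_
  obtain ⟨l, hl⟩ := hL.exists_freeGen x
  obtain ⟨m, hm⟩ := hM.exists_freeGen x
  exact ⟨l, m, hl, hm, smashPair_isFreeGen hm hl⟩

theorem smash_congr {L' M' : ActSheaf X} (hL : L.IsInvertible) (hM : M.IsInvertible)
    (e : Iso L L') (e' : Iso M M') : Nonempty (Iso (L.smash M) (L'.smash M')) := by
  obtain ⟨φ, hφ, k⟩ := e.exists_isStalkIso
  obtain ⟨φ', hφ', k'⟩ := e'.exists_isStalkIso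
  have gen : ∀ {K K' : ActSheaf X} {φ : ∀ x : X.space, x ∈ (⊤ : Opens X.space) →
      K.stalk x → K'.stalk x} (_ : IsStalkIso ⊤ φ) (x : X.space) (l : K.stalk x),
      IsFreeGen (X.stalk x) l → IsFreeGen (X.stalk x) (φ x (Opens.mem_top x) l) := by
    intro K K' φ hφ x l hl
    unfold IsFreeGen
    simp only [← hφ.map_smul]
    exact (hφ.bijective x (Opens.mem_top x)).comp hl
  refine smash_iso_of_pairing
    (fun x l m => smashPair x (φ x (Opens.mem_top x) l) (φ' x (Opens.mem_top x) m))
    (fun x a l m => by rw [hφ.map_smul, smashPair_smul_left])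
    (fun x a l m => by rw [hφ'.map_smul, smashPair_smul_right])
    (fun U l m x hx => ⟨U, hx, le_rfl, smashMk (e.equiv U le_top l) (e'.equiv U le_top m),
      fun y hy => by rw [← smashPair_germ, ← k, ← k']⟩)
    fun x => ?_
  obtain ⟨l, hl⟩ := hL.exists_freeGen x
  obtain ⟨m, hm⟩ := hM.exists_freeGen x
  exact ⟨l, m, hl, hm, smashPair_isFreeGen (gen hφ x l hl) (gen hφ' x m hm)⟩

theorem smash_assoc {N : ActSheaf X} (hL : L.IsInvertible) (hM : M.IsInvertible)
    (hN : N.IsInvertible) : Nonempty (Iso ((L.smash M).smash N) (L.smash (M.smash N))) := by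
  let γ : ∀ x : X.space, N.stalk x → Smash (X.stalk x) (L.stalk x) (M.stalk x) →
      (L.smash (M.smash N)).stalk x := fun x n => Smash.lift
    (fun l m => smashPair x l (smashPair x m n)) fun a l m => by
      rw [smashPair_smul_left, smashPair_smul_left, smashPair_smul_right]
  have γ_mk : ∀ x n l m, γ x n (Smash.mk _ l m) = smashPair x l (smashPair x m n) :=
    fun _ _ _ _ => rfl
  clear_value γ
  refine smash_iso_of_pairing (fun x t n => γ x n (smashEv L M x t)) ?_ ?_ ?_ ?_
  · intro x a t n
    rw [smashEv_smul]
    generalize smashEv L M x t = t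
    induction t using Smash.ind with
    | h l m => rw [Smash.smul_mk, γ_mk, γ_mk, smashPair_smul_left]
  · intro x a t n
    generalize smashEv L M x t = t
    induction t using Smash.ind with
    | h l m => rw [γ_mk, γ_mk, smashPair_smul_right, smashPair_smul_right]
  · intro U s n x hx
    obtain ⟨W, hW, i, l, m, e⟩ := smash_local s hx
    refine ⟨W, hW, i, smashMk l (smashMk m (res N.sheaf i n)), fun y hy => ?_⟩
    rw [e y hy, smashEv_smashMk, γ_mk, ← smashPair_germ, ← smashPair_germ, germ_res]
  · intro x
    obtain ⟨l, hl⟩ := hL.exists_freeGen x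
    obtain ⟨m, hm⟩ := hM.exists_freeGen x
    obtain ⟨n, hn⟩ := hN.exists_freeGen x
    refine ⟨smashPair x l m, n, smashPair_isFreeGen hl hm, hn, ?_⟩
    rw [smashEv_pair, γ_mk]
    exact smashPair_isFreeGen hl (smashPair_isFreeGen hm hn)

theorem isInvertible_unit (X : MonoidedSpace.{u}) : (unit X).IsInvertible :=
  fun x => ⟨⊤, Opens.mem_top x, ⟨Iso.refl _⟩⟩

theorem unit_smash (hL : L.IsInvertible) : Nonempty (Iso ((unit X).smash L) L) := by
  refine smash_iso_of_pairing (fun x (a : X.stalk x) l => a • l)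
    (fun x a b l => mul_smul a (show X.stalk x from b) l)
    (fun x a b l => by
      have h : ∀ p q : X.stalk x, p • q • l = q • p • l := fun p q => by
        rw [smul_smul, mul_comm, mul_smul]
      exact h b a)
    (fun U a l x hx => ⟨U, hx, le_rfl, (show X.sec U from a) • l, fun y hy => by
      rw [germ_smul]; rfl⟩) fun x => ?_
  obtain ⟨l, hl⟩ := hL.exists_freeGen x
  refine ⟨_, l, isGen_one x (Opens.mem_top x), hl, ?_⟩
  have : germ (unit X).sheaf (Opens.mem_top x) (one ⊤) = (1 : X.stalk x) :=
    MonoidedSpace.germ_one _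
  rw [this, one_smul]
  exact hl

end SmashSheaf

/-! ### The dual sheaf -/

section DualSheaf

variable (L : ActSheaf X)

/-- Families of elements `f_x` of `Hom_{𝒜_x}(L_x, 𝒜_x)` which map sections of `L` to sections of
`𝒜`. Over `U`, these are the morphisms of sheaves of `𝒜`-sets from `L|_U` to `𝒜|_U`. -/
def dualPred : TopCat.LocalPredicate fun x : X.space => Dual (X.stalk x) (L.stalk x) where
  pred {U} f := ∀ (V : Opens X.space) (i : V ≤ U) (l : L.sec V), ∃ a : X.sec V,
    ∀ x (hx : x ∈ V), f ⟨x, i hx⟩ (germ L.sheaf hx l) = germ X.sheaf hx a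
  res {V U} i f h W j l := h W (j.trans i.le) l
  locality {U} f h V i l := by
    obtain ⟨a, ha⟩ := exists_sec (F := X.sheaf)
      (fun x (hx : x ∈ V) => f ⟨x, i hx⟩ (germ L.sheaf hx l)) (by
        intro x hx
        obtain ⟨W, hW, j, h⟩ := h ⟨x, i hx⟩
        obtain ⟨a, ha⟩ := h (W ⊓ V) inf_le_left (res L.sheaf inf_le_right l)
        refine ⟨W ⊓ V, ⟨hW, hx⟩, inf_le_right, a, fun y hy => ?_⟩
        rw [← ha y hy, germ_res]
        rfl)
    exact ⟨a, fun x hx => (ha x hx).symm⟩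

theorem dualPred_zero (U : Opens X.space) : (dualPred L).pred fun _ : U => 0 :=
  fun V _ _ => ⟨0, fun x hx => by rw [MonoidedSpace.germ_zero]; rfl⟩

theorem dualPred_smul {U : Opens X.space} (a : X.sec U)
    {f : ∀ x : U, Dual (X.stalk x.1) (L.stalk x.1)} (h : (dualPred L).pred f) :
    (dualPred L).pred fun x : U => germ X.sheaf x.2 a • f x := fun V i l => by
  obtain ⟨b, hb⟩ := h V i l
  refine ⟨res X.sheaf i a * b, fun x hx => ?_⟩
  rw [Dual.smul_apply, hb x hx, germ_mul, germ_res]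

/-- The dual sheaf `L⁻¹ = Hom_𝒜(L, 𝒜)`. -/
def dual : ActSheaf X := ofPred (dualPred L) (dualPred_zero L) (dualPred_smul L)

/-- The map from the stalk of the dual sheaf to the dual of the stalk. -/
def dualEv (x : X.space) : (dual L).stalk x → Dual (X.stalk x) (L.stalk x) :=
  ev (hzero := dualPred_zero L) (hsmul := dualPred_smul L) x

variable {L}

theorem dualEv_smul (x : X.space) (a : X.stalk x) (t : (dual L).stalk x) :
    dualEv L x (a • t) = a • dualEv L x t :=
  ev_smul (hzero := dualPred_zero L) (hsmul := dualPred_smul L) x a t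

theorem dualEv_germ {U : Opens X.space} {x : X.space} (hx : x ∈ U) (f : (dual L).sec U) :
    dualEv L x (germ (dual L).sheaf hx f) = f.1 ⟨x, hx⟩ :=
  ev_germ (hzero := dualPred_zero L) (hsmul := dualPred_smul L) hx f

theorem dualPred_coord {U : Opens X.space} {g : L.sec U} (hg : L.IsGen g) :
    (dualPred L).pred fun y : U => Dual.coord (hg y.1 y.2) := by
  intro V i l
  obtain ⟨a, ha⟩ := exists_sec (F := X.sheaf)
    (fun x (hx : x ∈ V) => Dual.coord (hg x (i hx)) (germ L.sheaf hx l)) (by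
      intro x hx
      obtain ⟨a, ha⟩ := (hg x (i hx)).2 (germ L.sheaf hx l)
      obtain ⟨W, hW, a, rfl⟩ := exists_germ a
      have hx' : x ∈ W ⊓ V := ⟨hW, hx⟩
      have e : germ L.sheaf hx' (res X.sheaf (inf_le_left : W ⊓ V ≤ W) a •
          res L.sheaf ((inf_le_right : W ⊓ V ≤ V).trans i) g) = germ L.sheaf hx l := by
        rw [germ_smul, germ_res, germ_res]; exact ha
      obtain ⟨W', hW', j, k, e⟩ := germ_eq e
      refine ⟨W', hW', k, res X.sheaf (j.trans inf_le_left) a, fun y hy => ?_⟩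
      have q : germ L.sheaf (k hy) l = germ X.sheaf (j hy).1 a • germ L.sheaf (i (k hy)) g := by
        rw [← germ_res k hy l, ← e, germ_res j hy, germ_smul, germ_res, germ_res]
      rw [q, Dual.map_smul, Dual.coord_gen, mul_one, germ_res])
  exact ⟨a, fun x hx => (ha x hx).symm⟩

theorem dualEv_bijective (hL : L.IsInvertible) (x : X.space) :
    Function.Bijective (dualEv L x) := by
  obtain ⟨U₀, hU₀, g, hg⟩ := isInvertible_iff.mp hL x
  constructor
  · refine ev_injective (hzero := dualPred_zero L) (hsmul := dualPred_smul L) x ?_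
    intro U V hU hV f f' hf hf' h
    have hx' : x ∈ U₀ ⊓ (U ⊓ V) := ⟨hU₀, hU, hV⟩
    obtain ⟨a, ha⟩ := hf (U₀ ⊓ (U ⊓ V)) (inf_le_right.trans inf_le_left) (res _ inf_le_left g)
    obtain ⟨b, hb⟩ := hf' (U₀ ⊓ (U ⊓ V)) (inf_le_right.trans inf_le_right) (res _ inf_le_left g)
    have e : germ X.sheaf hx' a = germ X.sheaf hx' b := by
      rw [← ha x hx', ← hb x hx', h]
    obtain ⟨W, hW, i, j, e⟩ := germ_eq e
    refine ⟨W, hW, i.trans (inf_le_right.trans inf_le_left),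
      i.trans (inf_le_right.trans inf_le_right), fun y => ?_⟩
    refine Dual.eq_of_gen (hg y.1 (i y.2).1) ?_
    have h1 := ha y.1 (i y.2)
    have h2 := hb y.1 (i y.2)
    rw [germ_res] at h1 h2
    rw [h1, h2, ← germ_res i y.2 a, e, germ_res]
  · refine ev_surjective (hzero := dualPred_zero L) (hsmul := dualPred_smul L) x ?_
    intro t
    obtain ⟨a, rfl⟩ := (Dual.isFreeGen_coord (hg x hU₀)).2 t
    obtain ⟨V, hV, a, rfl⟩ := exists_germ a
    have := dualPred_smul L (res X.sheaf (inf_le_left : V ⊓ U₀ ≤ V) a)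
      (dualPred_coord (hg.res (inf_le_right : V ⊓ U₀ ≤ U₀)))
    refine ⟨V ⊓ U₀, ⟨hV, hU₀⟩, _, this, ?_⟩
    dsimp only
    rw [germ_res]
    congr 2
    exact germ_res _ _ _

theorem IsInvertible.dual (hL : L.IsInvertible) : (dual L).IsInvertible := by
  rw [isInvertible_iff]
  intro x
  obtain ⟨U, hU, g, hg⟩ := isInvertible_iff.mp hL x
  refine ⟨U, hU, ⟨_, dualPred_coord hg⟩, fun y hy => ?_⟩
  have h := Dual.isFreeGen_coord (hg y hy)
  refine (Function.Bijective.of_comp_iff' (dualEv_bijective hL y) _).mp ?_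
  have : (dualEv L y ∘ fun a : X.stalk y => a • germ (ActSheaf.dual L).sheaf hy
      (⟨_, dualPred_coord hg⟩ : (ActSheaf.dual L).sec U)) =
      fun a => a • Dual.coord (hg y hy) := funext fun a => by
    rw [Function.comp_apply, dualEv_smul]
    exact congrArg _ (dualEv_germ hy _)
  rw [this]
  exact h

theorem dual_smash (hL : L.IsInvertible) : Nonempty (Iso (L.dual.smash L) (unit X)) := by
  refine smash_iso_of_pairing (fun x f l => dualEv L x f l)
    (fun x a f l => by rw [dualEv_smul]; rfl) (fun x a f l => (Dual.map_smul (dualEv L x f) a l :))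
    (fun U f l x hx => ?_) fun x => ?_
  · obtain ⟨a, ha⟩ := f.2 U le_rfl l
    refine ⟨U, hx, le_rfl, a, fun y hy => ?_⟩
    rw [dualEv_germ]
    exact ha y hy
  · obtain ⟨l, hl⟩ := hL.exists_freeGen x
    obtain ⟨f, hf⟩ := (dualEv_bijective hL x).2 (Dual.coord hl)
    refine ⟨f, l, ?_, hl, ?_⟩
    · have h := Dual.isFreeGen_coord hl
      rw [← hf] at h
      unfold IsFreeGen at h ⊢
      simp only [← dualEv_smul] at h
      exact (Function.Bijective.of_comp_iff' (dualEv_bijective hL x)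
        fun a : X.stalk x => a • f).mp h
    · rw [hf, Dual.coord_gen]
      have : germ (unit X).sheaf (Opens.mem_top x) (one ⊤) = (1 : X.stalk x) :=
        MonoidedSpace.germ_one _
      rw [← this]
      exact isGen_one x (Opens.mem_top x)

end DualSheaf

/-! ### The inverse image of a sheaf of `𝒜`-sets -/

section Pullback

variable {Y : MonoidedSpace.{u}} (p : Hom Y X) (L : ActSheaf X)

/-- Families of elements of `L_{p(y)} ∧_{𝒜_{X, p(y)}} 𝒜_{Y, y}` which are locally of the form
`[l, b]` for sections `l` of `L` and `b` of `𝒜_Y`. -/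
def pullbackPred : TopCat.LocalPredicate
    fun y : Y.space => BaseChange (p.stalkMap y) (L.stalk (p.base y)) where
  pred {V} f := ∀ y : V, ∃ (W : Opens Y.space) (_ : y.1 ∈ W) (i : W ≤ V) (U : Opens X.space)
    (h : W ≤ Opens.comap p.base U) (l : L.sec U) (b : Y.sec W), ∀ z : W, f ⟨z.1, i z.2⟩ =
      BaseChange.mk (p.stalkMap z.1) (germ L.sheaf (Opens.mem_comap.mp (h z.2)) l)
        (germ Y.sheaf z.2 b)
  res {V' V} i f h y := by
    obtain ⟨W, hW, j, U, k, l, b, e⟩ := h ⟨y.1, i.le y.2⟩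
    refine ⟨W ⊓ V', ⟨hW, y.2⟩, inf_le_right, U, inf_le_left.trans k, l,
      res Y.sheaf inf_le_left b, fun z => ?_⟩
    rw [germ_res]
    exact e ⟨z.1, z.2.1⟩
  locality {V} f h y := by
    obtain ⟨V', hV, i, h⟩ := h y
    obtain ⟨W, hW, j, U, k, l, b, e⟩ := h ⟨y.1, hV⟩
    exact ⟨W, hW, j.trans i.le, U, k, l, b, e⟩

theorem pullbackPred_zero (V : Opens Y.space) : (pullbackPred p L).pred fun _ : V => 0 :=
  fun y => ⟨V, y.2, le_rfl, ⊤, fun _ _ => Opens.mem_top _, 0, 0, fun z => by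
    rw [germ_zero, MonoidedSpace.germ_zero]; rfl⟩

theorem pullbackPred_smul {V : Opens Y.space} (a : Y.sec V)
    {f : ∀ y : V, BaseChange (p.stalkMap y.1) (L.stalk (p.base y.1))}
    (h : (pullbackPred p L).pred f) :
    (pullbackPred p L).pred fun y : V => germ Y.sheaf y.2 a • f y := fun y => by
  obtain ⟨W, hW, j, U, k, l, b, e⟩ := h y
  refine ⟨W, hW, j, U, k, l, res Y.sheaf j a * b, fun z => ?_⟩
  rw [germ_mul, ← BaseChange.smul_mk, germ_res]
  exact congrArg _ (e z)

/-- The inverse image `p^* L = p⁻¹ L ∧_{p⁻¹ 𝒜_X} 𝒜_Y` of a sheaf of `𝒜_X`-sets. -/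
def pullback : ActSheaf Y :=
  ofPred (pullbackPred p L) (pullbackPred_zero p L) (pullbackPred_smul p L)

variable {p L}

theorem pullback_eq_near {y : Y.space} {s t : L.stalk (p.base y) × Y.stalk y}
    (h : Relation.EqvGen (BaseChangeRel (p.stalkMap y) (L.stalk (p.base y))) s t) :
    ∀ {U U' : Opens X.space} {V V' : Opens Y.space} (hU : p.base y ∈ U) (hU' : p.base y ∈ U')
      (hV : y ∈ V) (hV' : y ∈ V') (l : L.sec U) (b : Y.sec V)
      (l' : L.sec U') (b' : Y.sec V'), germ L.sheaf hU l = s.1 → germ Y.sheaf hV b = s.2 →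
      germ L.sheaf hU' l' = t.1 → germ Y.sheaf hV' b' = t.2 →
      ∃ (W : Opens Y.space) (_ : y ∈ W) (i : ∀ z ∈ W, p.base z ∈ U) (i' : ∀ z ∈ W, p.base z ∈ U')
        (j : W ≤ V) (j' : W ≤ V'), ∀ z (hz : z ∈ W),
        BaseChange.mk (p.stalkMap z) (germ L.sheaf (i z hz) l) (germ Y.sheaf (j hz) b) =
          BaseChange.mk (p.stalkMap z) (germ L.sheaf (i' z hz) l') (germ Y.sheaf (j' hz) b') := by
  have near : ∀ {U U' : Opens X.space} {V V' : Opens Y.space} (hU : p.base y ∈ U)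
      (hU' : p.base y ∈ U') (hV : y ∈ V) (hV' : y ∈ V') (l : L.sec U) (b : Y.sec V)
      (l' : L.sec U') (b' : Y.sec V'), germ L.sheaf hU l = germ L.sheaf hU' l' →
      germ Y.sheaf hV b = germ Y.sheaf hV' b' →
      ∃ (W : Opens Y.space) (_ : y ∈ W) (i : ∀ z ∈ W, p.base z ∈ U) (i' : ∀ z ∈ W, p.base z ∈ U')
        (j : W ≤ V) (j' : W ≤ V'), ∀ z (hz : z ∈ W),
        BaseChange.mk (p.stalkMap z) (germ L.sheaf (i z hz) l) (germ Y.sheaf (j hz) b) =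
          BaseChange.mk (p.stalkMap z) (germ L.sheaf (i' z hz) l') (germ Y.sheaf (j' hz) b') := by
    intro U U' V V' hU hU' hV hV' l b l' b' hl hb
    obtain ⟨W, hW, i, i', e⟩ := germ_eq hl
    obtain ⟨W', hW', j, j', e'⟩ := germ_eq hb
    refine ⟨Opens.comap p.base W ⊓ W', ⟨hW, hW'⟩, fun z hz => i hz.1, fun z hz => i' hz.1,
      inf_le_right.trans j, inf_le_right.trans j', fun z hz => ?_⟩
    have hzW : p.base z ∈ W := hz.1
    rw [← germ_res i hzW l, ← germ_res i' hzW l', e, ← germ_res j hz.2 b,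
      ← germ_res j' hz.2 b', e']
  induction h with
  | rel s t h =>
    obtain ⟨a, l₀, b₀, rfl, rfl⟩ := h
    intro U U' V V' hU hU' hV hV' l b l' b' h1 h2 h3 h4
    obtain ⟨U₀, hU₀, a, l₀, rfl, rfl⟩ := exists_germ₂ a l₀
    obtain ⟨V₀, hV₀, b₀, rfl⟩ := exists_germ b₀
    dsimp only at h1 h2 h3 h4
    have hy : y ∈ Opens.comap p.base U₀ ⊓ V₀ := ⟨hU₀, hV₀⟩
    rw [← germ_smul] at h1
    have h4' : germ Y.sheaf hV' b' = germ Y.sheaf hy (res Y.sheaf inf_le_left (p.app U₀ a) *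
        res Y.sheaf inf_le_right b₀) := by
      rw [h4, germ_mul, germ_res, germ_res, p.stalkMap_germ]
    obtain ⟨W, hW, i, i', j, j', e⟩ := near hU hU₀ hV hV₀ l b (a • l₀) b₀ h1 h2
    obtain ⟨W', hW', k, k', m, m', e'⟩ := near hU' hU₀ hV' hy l' b' l₀ _ h3 h4'
    refine ⟨W ⊓ W', ⟨hW, hW'⟩, fun z hz => i z hz.1, fun z hz => k z hz.2,
      inf_le_left.trans j, inf_le_right.trans m, fun z hz => ?_⟩
    rw [e z hz.1, e' z hz.2, germ_smul, BaseChange.mk_balanced, germ_mul, germ_res, germ_res,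
      p.stalkMap_germ]
  | refl s =>
    intro U U' V V' hU hU' hV hV' l b l' b' h1 h2 h3 h4
    exact near hU hU' hV hV' l b l' b' (h1.trans h3.symm) (h2.trans h4.symm)
  | symm s t _ ih =>
    intro U U' V V' hU hU' hV hV' l b l' b' h1 h2 h3 h4
    obtain ⟨W, hW, i, i', j, j', e⟩ := ih hU' hU hV' hV l' b' l b h3 h4 h1 h2
    exact ⟨W, hW, i', i, j', j, fun z hz => (e z hz).symm⟩
  | trans s t r _ _ ih ih' =>
    intro U U' V V' hU hU' hV hV' l b l' b' h1 h2 h3 h4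
    obtain ⟨U₀, hU₀, l₀, h5⟩ := exists_germ t.1
    obtain ⟨V₀, hV₀, b₀, h6⟩ := exists_germ t.2
    obtain ⟨W, hW, i, i', j, j', e⟩ := ih hU hU₀ hV hV₀ l b l₀ b₀ h1 h2 h5 h6
    obtain ⟨W', hW', k, k', m, m', e'⟩ := ih' hU₀ hU' hV₀ hV' l₀ b₀ l' b' h5 h6 h3 h4
    refine ⟨W ⊓ W', ⟨hW, hW'⟩, fun z hz => i z hz.1, fun z hz => k' z hz.2,
      inf_le_left.trans j, inf_le_right.trans m', fun z hz => ?_⟩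
    rw [e z hz.1, e' z hz.2]

variable (p L) in
/-- The stalk of the inverse image. -/
def pullbackEv (y : Y.space) :
    (pullback p L).stalk y → BaseChange (p.stalkMap y) (L.stalk (p.base y)) :=
  ev (hzero := pullbackPred_zero p L) (hsmul := pullbackPred_smul p L) y

theorem pullbackEv_smul (y : Y.space) (a : Y.stalk y) (t : (pullback p L).stalk y) :
    pullbackEv p L y (a • t) = a • pullbackEv p L y t :=
  ev_smul (hzero := pullbackPred_zero p L) (hsmul := pullbackPred_smul p L) y a t

theorem pullbackEv_germ {V : Opens Y.space} {y : Y.space} (hy : y ∈ V)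
    (f : (pullback p L).sec V) :
    pullbackEv p L y (germ (pullback p L).sheaf hy f) = f.1 ⟨y, hy⟩ :=
  ev_germ (hzero := pullbackPred_zero p L) (hsmul := pullbackPred_smul p L) hy f

theorem pullbackPred_mk {U : Opens X.space} {V : Opens Y.space} (h : V ≤ Opens.comap p.base U)
    (l : L.sec U) (b : Y.sec V) : (pullbackPred p L).pred fun z : V =>
      BaseChange.mk (p.stalkMap z.1) (germ L.sheaf (Opens.mem_comap.mp (h z.2)) l)
        (germ Y.sheaf z.2 b) :=
  fun y => ⟨V, y.2, le_rfl, U, h, l, b, fun _ => rfl⟩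

theorem pullbackEv_bijective (y : Y.space) : Function.Bijective (pullbackEv p L y) := by
  constructor
  · refine ev_injective (hzero := pullbackPred_zero p L) (hsmul := pullbackPred_smul p L) y ?_
    intro V V' hV hV' f g hf hg h
    obtain ⟨W, hW, i, U, k, l, b, e⟩ := hf ⟨y, hV⟩
    obtain ⟨W', hW', i', U', k', l', b', e'⟩ := hg ⟨y, hV'⟩
    have h' := (e ⟨y, hW⟩).symm.trans (h.trans (e' ⟨y, hW'⟩))
    obtain ⟨W'', hW'', c, c', d, d', q⟩ := pullback_eq_near (Quot.eqvGen_exact h')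
      (k hW) (k' hW') hW hW' l b l' b' rfl rfl rfl rfl
    exact ⟨W'', hW'', d.trans i, d'.trans i', fun z =>
      (e ⟨z.1, d z.2⟩).trans ((q z.1 z.2).trans (e' ⟨z.1, d' z.2⟩).symm)⟩
  · refine ev_surjective (hzero := pullbackPred_zero p L) (hsmul := pullbackPred_smul p L) y ?_
    intro t
    induction t using BaseChange.ind with
    | h l b =>
      obtain ⟨U, hU, l, rfl⟩ := exists_germ l
      obtain ⟨V, hV, b, rfl⟩ := exists_germ b
      have hy : y ∈ V ⊓ Opens.comap p.base U := ⟨hV, hU⟩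
      refine ⟨V ⊓ Opens.comap p.base U, hy, _,
        pullbackPred_mk inf_le_right l (res Y.sheaf inf_le_left b), ?_⟩
      rw [germ_res]

theorem IsInvertible.pullback (p : Hom Y X) (hL : L.IsInvertible) :
    (pullback p L).IsInvertible := by
  rw [isInvertible_iff]
  intro y
  obtain ⟨U, hU, g, hg⟩ := isInvertible_iff.mp hL (p.base y)
  refine ⟨Opens.comap p.base U, hU, ⟨_, pullbackPred_mk le_rfl g 1⟩, fun z hz => ?_⟩
  have h := BaseChange.isFreeGen (φ := p.stalkMap z) (hg (p.base z) hz)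
  refine (Function.Bijective.of_comp_iff' (pullbackEv_bijective z) _).mp ?_
  have : (pullbackEv p L z ∘ fun a : Y.stalk z => a • germ (ActSheaf.pullback p L).sheaf hz
      (⟨_, pullbackPred_mk le_rfl g 1⟩ : (ActSheaf.pullback p L).sec (Opens.comap p.base U))) =
      fun a => a • BaseChange.mk (p.stalkMap z)
        (germ L.sheaf (Opens.mem_comap.mp hz) g) 1 := funext fun a => by
    rw [Function.comp_apply, pullbackEv_smul]
    refine congrArg _ ((pullbackEv_germ hz _).trans ?_)
    dsimp only
    rw [germ_one]
  rw [this]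
  exact h

end Pullback

end ActSheaf

/-! ## The Picard group -/

/-- Invertible sheaves on `X`. -/
structure InvertibleSheaf (X : MonoidedSpace.{u}) : Type (u + 1) where
  /-- the underlying sheaf of `𝒜`-sets -/
  toActSheaf : ActSheaf X
  isInvertible : toActSheaf.IsInvertible

namespace InvertibleSheaf

variable {X : MonoidedSpace.{u}}

/-- Two invertible sheaves are equivalent if they are isomorphic. -/
instance setoid (X : MonoidedSpace.{u}) : Setoid (InvertibleSheaf X) where
  r L M := Nonempty (ActSheaf.Iso L.toActSheaf M.toActSheaf)
  iseqv := ⟨fun _ => ⟨ActSheaf.Iso.refl _⟩, fun ⟨e⟩ => ⟨e.symm⟩, fun ⟨e⟩ ⟨e'⟩ => ⟨e.trans e'⟩⟩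

/-- The smash product of invertible sheaves. -/
def smash (L M : InvertibleSheaf X) : InvertibleSheaf X :=
  ⟨L.toActSheaf.smash M.toActSheaf, L.isInvertible.smash M.isInvertible⟩

/-- The structure sheaf. -/
def unit (X : MonoidedSpace.{u}) : InvertibleSheaf X :=
  ⟨ActSheaf.unit X, ActSheaf.isInvertible_unit X⟩

/-- The dual of an invertible sheaf. -/
def dual (L : InvertibleSheaf X) : InvertibleSheaf X :=
  ⟨L.toActSheaf.dual, L.isInvertible.dual⟩

/-- The inverse image of an invertible sheaf. -/
def pullback {Y : MonoidedSpace.{u}} (p : Hom Y X) (L : InvertibleSheaf X) : InvertibleSheaf Y :=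
  ⟨L.toActSheaf.pullback p, L.isInvertible.pullback p⟩

end InvertibleSheaf

/-- The Picard group of `X`: the set of isomorphism classes of invertible sheaves. -/
def Pic (X : MonoidedSpace.{u}) : Type (u + 1) := Quotient (InvertibleSheaf.setoid X)

namespace Pic

variable {X : MonoidedSpace.{u}}

/-- The isomorphism class of an invertible sheaf. -/
def mk (L : InvertibleSheaf X) : Pic X := Quotient.mk _ L

theorem mk_eq_mk {L M : InvertibleSheaf X} :
    mk L = mk M ↔ Nonempty (ActSheaf.Iso L.toActSheaf M.toActSheaf) := Quotient.eq

instance : Mul (Pic X) := ⟨Quotient.map₂ InvertibleSheaf.smash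
  fun L _ ⟨e⟩ M _ ⟨e'⟩ => ActSheaf.smash_congr L.isInvertible M.isInvertible e e'⟩

instance : One (Pic X) := ⟨mk (InvertibleSheaf.unit X)⟩

theorem mk_mul_mk (L M : InvertibleSheaf X) : mk L * mk M = mk (L.smash M) := rfl

theorem one_def : (1 : Pic X) = mk (InvertibleSheaf.unit X) := rfl

theorem ind {P : Pic X → Prop} (h : ∀ L, P (mk L)) (a : Pic X) : P a := Quotient.ind h a

theorem mul_comm_aux (a b : Pic X) : a * b = b * a := by
  induction a using ind with
  | h L =>
    induction b using ind with
    | h M => exact mk_eq_mk.mpr (ActSheaf.smash_comm L.isInvertible M.isInvertible)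

theorem one_mul_aux (a : Pic X) : 1 * a = a := by
  induction a using ind with
  | h L => exact mk_eq_mk.mpr (ActSheaf.unit_smash L.isInvertible)

instance : CommMonoid (Pic X) where
  mul_assoc a b c := by
    induction a using ind with
    | h L =>
      induction b using ind with
      | h M =>
        induction c using ind with
        | h N =>
          exact mk_eq_mk.mpr
            (ActSheaf.smash_assoc L.isInvertible M.isInvertible N.isInvertible)
  one_mul := one_mul_aux
  mul_one a := by rw [mul_comm_aux, one_mul_aux]
  mul_comm := mul_comm_aux

theorem mk_dual_mul (L : InvertibleSheaf X) : mk L.dual * mk L = 1 :=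
  mk_eq_mk.mpr (ActSheaf.dual_smash L.isInvertible)

instance : Inv (Pic X) := ⟨Quotient.lift (fun L => mk L.dual) fun L M h => by
  have e : mk L = mk M := Quotient.sound h
  exact left_inv_eq_right_inv (mk_dual_mul L) (by rw [e, mul_comm, mk_dual_mul])⟩

theorem inv_mk (L : InvertibleSheaf X) : (mk L)⁻¹ = mk L.dual := rfl

/-- `Pic X` is an abelian group under the smash product, the inverse being given by the dual. -/
instance : CommGroup (Pic X) where
  inv_mul_cancel a := by
    induction a using ind with
    | h L => exact mk_dual_mul L

end Pic

end

end MonoidGeom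

namespace MonoidGeom
noncomputable section

/-! ## Functoriality of the inverse image -/

/-! Two free generators of a stalk of an invertible sheaf differ by a unit. So the Picard group sees
only the topological space and the units of the stalks of `𝒜`; in cohomological terms it is the
first cohomology of the sheaf of units. It therefore suffices that a seminormalization `p` is a
homeomorphism and is bijective on units of stalks. This is the notion `IsUnitEquiv`, and
`IsSeminormalization.isUnitEquiv` establishes it on affine charts. For `A → B` a seminormalization
of monoids, every `b` has all its large powers in the image, and prime ideals do not distinguish an
element from its positive powers, so the primes of `A` and `B` correspond. A unit `b` of a stalk
equals `b ^ (n + 1) / b ^ n`, hence comes from below. Units with the same image agree, because `A →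
B` identifies distinct elements only if they are nilpotent, and a nilpotent unit would force `0 = 1`
in the stalk.

The passage from `IsUnitEquiv` to Picard groups is made by hand on stalks. If `p^* L` is trivial,
the generators of the stalks of `L` which go to `1` are unique, hence glue to a global generator
(`IsUnitEquiv.unit_iso`). Conversely, given an invertible `M` on `Y`, choose a free generator `g y`
of each stalk, with no compatibility. The sheaf `descent` consists of the families `f` in the stalks
of `𝒜_X` for which `f • g` is locally a multiple, by a section of `𝒜_X`, of a local generator `m` of
`M`. Another local generator differs from `m` by a unit, which lifts locally to `X`, so the choice
of `m` does not matter, and `f ↦ f • g` identifies the inverse image of this sheaf with `M`.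

For existence, an element of the seminormalization is encoded by its large powers: `SN A` is the
monoid of germs at infinity of sequences in `A` with `a (m + n) = a m * a n` for large `m` and `n`.
All large integers are combinations of `N` and `N + 1`. So an element is determined by two
consecutive powers (`SN.ext_pow`), and elements with `x ^ (N + 1) = y ^ N` are consecutive powers of
an element (`SN.exists_root`), which for `N = 2` is seminormality. Since this is finite data, `SN`
commutes with localization and with stalks. Hence `X.sn`, a sheaf on the same space with stalks `SN
(X.stalk x)`, is affine on the affine charts of `X`, with sections `SN (X.sec U)`. Partial
cancellativity enters in `SN.of_eq_of_iff`: `A → SN A` identifies only nilpotent elements.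

Affine opens are handled through `IsChart`, which expresses in terms of germs that the points of `U`
are the primes of `A`, that the stalks are localizations, and that the sets `D(s)` form a basis. -/

theorem IsFreeGen.isUnit {A : Type u} [CommMonoidWithZero A] {a : A} (h : IsFreeGen A a) :
    IsUnit a := by
  obtain ⟨b, hb⟩ := h.2 1
  exact IsUnit.of_mul_eq_one_right b hb

theorem isFreeGen_of_isUnit {A : Type u} [CommMonoidWithZero A] {a : A} (h : IsUnit a) :
    IsFreeGen A a :=
  ⟨fun _ _ e => h.mul_right_cancel e, fun b => by
    obtain ⟨u, rfl⟩ := h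
    exact ⟨b * ↑u⁻¹, by simp⟩⟩

theorem IsFreeGen.smul {A M : Type u} [CommMonoidWithZero A] [Zero M] [MulActionWithZero A M]
    {g : M} (hg : IsFreeGen A g) {u : A} (hu : IsUnit u) : IsFreeGen A (u • g) := by
  have : (fun a : A => a • u • g) = (fun a => a • g) ∘ fun a => a * u :=
    funext fun a => smul_smul a u g
  unfold IsFreeGen
  rw [this]
  exact hg.comp (isFreeGen_of_isUnit hu)

theorem IsFreeGen.isUnit_of_smul {A M : Type u} [CommMonoidWithZero A] [Zero M]
    [MulActionWithZero A M] {g : M} {u : A} (hg : IsFreeGen A g) (h : IsFreeGen A (u • g)) :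
    IsUnit u := by
  obtain ⟨b, hb⟩ := h.2 g
  refine IsUnit.of_mul_eq_one_right b (hg.1 ?_)
  simpa only [mul_smul, one_smul] using hb

namespace ActSheaf

open MonoidedSpace

section PullbackMap

variable {X Y : MonoidedSpace.{u}} {p : Hom Y X} {L M : ActSheaf X}

/-- The canonical map from the stalk of `L` to the stalk of `p^* L`. -/
def pullbackUnit (p : Hom Y X) (L : ActSheaf X) (y : Y.space) (l : L.stalk (p.base y)) :
    (pullback p L).stalk y :=
  (Equiv.ofBijective _ (pullbackEv_bijective (p := p) (L := L) y)).symm (BaseChange.mk _ l 1)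

theorem pullbackEv_unit (y : Y.space) (l : L.stalk (p.base y)) :
    pullbackEv p L y (pullbackUnit p L y l) = BaseChange.mk _ l 1 :=
  (Equiv.ofBijective _ (pullbackEv_bijective (p := p) (L := L) y)).apply_symm_apply _

theorem pullbackUnit_smul (y : Y.space) (a : X.stalk (p.base y)) (l : L.stalk (p.base y)) :
    pullbackUnit p L y (a • l) = p.stalkMap y a • pullbackUnit p L y l :=
  (pullbackEv_bijective y).1 (by
    rw [pullbackEv_smul, pullbackEv_unit, pullbackEv_unit, BaseChange.smul_mk,
      BaseChange.mk_balanced])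

theorem pullbackUnit_isFreeGen {y : Y.space} {l : L.stalk (p.base y)}
    (hl : IsFreeGen (X.stalk (p.base y)) l) :
    IsFreeGen (Y.stalk y) (pullbackUnit p L y l) := by
  have h := BaseChange.isFreeGen (φ := p.stalkMap y) hl
  unfold IsFreeGen at h ⊢
  rw [← pullbackEv_unit] at h
  simp only [← pullbackEv_smul] at h
  exact (Function.Bijective.of_comp_iff' (pullbackEv_bijective y)
    fun b : Y.stalk y => b • pullbackUnit p L y l).mp h

/-- The inverse image of a section. -/
def pullbackSec (p : Hom Y X) {U : Opens X.space} (l : L.sec U) :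
    (pullback p L).sec (Opens.comap p.base U) :=
  ⟨_, pullbackPred_mk le_rfl l 1⟩

theorem germ_pullbackSec {U : Opens X.space} (l : L.sec U) {y : Y.space} (hy : p.base y ∈ U) :
    germ (pullback p L).sheaf (Opens.mem_comap.mpr hy) (pullbackSec p l) =
      pullbackUnit p L y (germ L.sheaf hy l) :=
  (pullbackEv_bijective y).1 (by
    rw [pullbackEv_unit]
    refine (pullbackEv_germ _ _).trans ?_
    change BaseChange.mk _ _ (germ Y.sheaf _ 1) = _
    rw [germ_one])

/-- A family of semilinear maps `L_{p(y)} → N_y` mapping sections to sections and a generator to a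
generator identifies `N` with `p^* L`. -/
theorem pullback_iso_of_map {N : ActSheaf Y} (β : ∀ y : Y.space, L.stalk (p.base y) → N.stalk y)
    (hβ : ∀ y a l, β y (a • l) = p.stalkMap y a • β y l)
    (hs : ∀ (U : Opens X.space) (l : L.sec U) (y : Y.space) (_ : p.base y ∈ U),
      ∃ (W : Opens Y.space) (_ : y ∈ W) (i : ∀ z ∈ W, p.base z ∈ U) (n : N.sec W),
        ∀ z (hz : z ∈ W), β z (germ L.sheaf (i z hz) l) = germ N.sheaf hz n)
    (hg : ∀ y, ∃ l, IsFreeGen (X.stalk (p.base y)) l ∧ IsFreeGen (Y.stalk y) (β y l)) :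
    Nonempty (Iso (pullback p L) N) := by
  let ψ : ∀ y : Y.space, BaseChange (p.stalkMap y) (L.stalk (p.base y)) → N.stalk y :=
    fun y => BaseChange.lift (fun l b => b • β y l) fun a l b => by
      rw [hβ, smul_smul, mul_comm]
  have ψ_mk : ∀ y l b, ψ y (BaseChange.mk _ l b) = b • β y l := fun _ _ _ => rfl
  have ψ_smul : ∀ y (a : Y.stalk y) t, ψ y (a • t) = a • ψ y t := by
    intro y a t
    induction t using BaseChange.ind with
    | h l b => rw [BaseChange.smul_mk, ψ_mk, ψ_mk, mul_smul]
  clear_value ψ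
  refine IsStalkIso.isoOn (φ := fun y _ t => ψ y (pullbackEv p L y t)) ⟨?_, ?_, ?_⟩
  · intro y _
    refine Function.Bijective.comp (g := ψ y) ?_ (pullbackEv_bijective y)
    obtain ⟨l, h1, h2⟩ := hg y
    -- Since `[l, 1]` freely generates the base change, it suffices to test `ψ` on its multiples,
    -- where it becomes `a ↦ a • β l`.
    refine (Function.Bijective.of_comp_iff (ψ y) (BaseChange.isFreeGen h1)).mp ?_
    have : (ψ y ∘ fun a : Y.stalk y => a • BaseChange.mk (p.stalkMap y) l 1) =
        fun a => a • β y l :=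
      funext fun a => by rw [Function.comp_apply, ψ_smul, ψ_mk, one_smul]
    rw [this]
    exact h2
  · intro y _ a t
    rw [pullbackEv_smul, ψ_smul]
  · intro V h s y hy
    obtain ⟨W, hW, i, U, k, l, b, e⟩ := s.2 ⟨y, hy⟩
    obtain ⟨W', hW', i', n, e'⟩ := hs U l y (k hW)
    refine ⟨W ⊓ W', ⟨hW, hW'⟩, inf_le_left.trans i,
      res Y.sheaf (inf_le_left : W ⊓ W' ≤ W) b • res N.sheaf inf_le_right n, fun z hz => ?_⟩
    rw [germ_smul, germ_res, germ_res, ← e' z hz.2, pullbackEv_germ, ← ψ_mk]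
    exact congrArg _ (e ⟨z, hz.1⟩)

theorem IsStalkIso.isFreeGen {φ : ∀ x : X.space, x ∈ (⊤ : Opens X.space) → L.stalk x → M.stalk x}
    (hφ : IsStalkIso ⊤ φ) {x : X.space} {l : L.stalk x} (hl : IsFreeGen (X.stalk x) l) :
    IsFreeGen (X.stalk x) (φ x (Opens.mem_top x) l) := by
  unfold IsFreeGen
  simp only [← hφ.map_smul]
  exact (hφ.bijective x (Opens.mem_top x)).comp hl

theorem pullback_congr (hL : L.IsInvertible) (e : Iso L M) :
    Nonempty (Iso (pullback p L) (pullback p M)) := by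
  obtain ⟨φ, hφ, k⟩ := e.exists_isStalkIso
  refine pullback_iso_of_map
    (fun y l => pullbackUnit p M y (φ (p.base y) (Opens.mem_top _) l)) ?_ ?_ ?_
  · intro y a l
    rw [hφ.map_smul, pullbackUnit_smul]
  · intro U l y hy
    refine ⟨Opens.comap p.base U, hy, fun z hz => Opens.mem_comap.mp hz,
      pullbackSec p (e.equiv U le_top l), fun z hz => ?_⟩
    rw [k U le_top l]
    exact (germ_pullbackSec _ _).symm
  · intro y
    obtain ⟨l, hl⟩ := hL.exists_freeGen (p.base y)
    exact ⟨l, hl, pullbackUnit_isFreeGen (hφ.isFreeGen hl)⟩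

/-- On stalks the isomorphism comes from `[l, m] ↦ [[l, 1], [m, 1]]`. It takes a pair of free
generators to a free generator, which is all that `pullback_iso_of_map` asks for beyond
semilinearity and compatibility with sections. -/
theorem pullback_smash (hL : L.IsInvertible) (hM : M.IsInvertible) :
    Nonempty (Iso (pullback p (L.smash M)) ((pullback p L).smash (pullback p M))) := by
  let γ : ∀ y : Y.space, Smash (X.stalk (p.base y)) (L.stalk (p.base y)) (M.stalk (p.base y)) →
      ((pullback p L).smash (pullback p M)).stalk y := fun y => Smash.lift
    (fun l m => smashPair y (pullbackUnit p L y l) (pullbackUnit p M y m)) fun a l m => by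
      rw [pullbackUnit_smul, pullbackUnit_smul, smashPair_smul_left, smashPair_smul_right]
  have γ_mk : ∀ y l m, γ y (Smash.mk _ l m) =
    smashPair y (pullbackUnit p L y l) (pullbackUnit p M y m) := fun _ _ _ => rfl
  clear_value γ
  refine pullback_iso_of_map (fun y t => γ y (smashEv L M _ t)) ?_ ?_ ?_
  · intro y a t
    rw [smashEv_smul]
    generalize smashEv L M _ t = t
    induction t using Smash.ind with
    | h l m => rw [Smash.smul_mk, γ_mk, γ_mk, pullbackUnit_smul, smashPair_smul_left]
  · intro U s y hy
    obtain ⟨V, hV, i, l, m, e⟩ := smash_local s hy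
    refine ⟨Opens.comap p.base V, hV, fun z hz => i (Opens.mem_comap.mp hz),
      smashMk (pullbackSec p l) (pullbackSec p m), fun z hz => ?_⟩
    rw [e (p.base z) (Opens.mem_comap.mp hz), smashEv_smashMk, γ_mk, ← smashPair_germ]
    exact congrArg₂ (smashPair z) (germ_pullbackSec l hz).symm (germ_pullbackSec m hz).symm
  · intro y
    obtain ⟨l, hl⟩ := hL.exists_freeGen (p.base y)
    obtain ⟨m, hm⟩ := hM.exists_freeGen (p.base y)
    refine ⟨smashPair _ l m, smashPair_isFreeGen hl hm, ?_⟩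
    rw [smashEv_pair, γ_mk]
    exact smashPair_isFreeGen (pullbackUnit_isFreeGen hl) (pullbackUnit_isFreeGen hm)

theorem unit_iso_of_gen {s : L.sec ⊤} (hs : L.IsGen s) : Nonempty (Iso (unit X) L) := by
  refine IsStalkIso.isoOn
      (φ := fun x hx (a : X.stalk x) => a • germ L.sheaf hx s) ⟨hs, ?_, ?_⟩
  · intro x hx a t
    exact mul_smul a t _
  · intro V h t x hx
    exact ⟨V, hx, le_rfl, (show X.sec V from t) • MonoidGeom.res L.sheaf h s, fun y hy => by
      rw [germ_smul, germ_res]; rfl⟩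

end PullbackMap

end ActSheaf

/-! ### Morphisms which are homeomorphisms and identify the units of the stalks -/

namespace MonoidedSpace.Hom

open ActSheaf

variable {X Y : MonoidedSpace.{u}} (p : Hom Y X)

/-- `p` is a homeomorphism of the underlying spaces which identifies the units of the stalks of the
structure sheaves. -/
structure IsUnitEquiv : Prop where
  bijective : Function.Bijective p.base
  exists_comap_le : ∀ (y : Y.space) (V : Opens Y.space), y ∈ V →
    ∃ W : Opens X.space, p.base y ∈ W ∧ Opens.comap p.base W ≤ V
  eq_of_isUnit : ∀ (y : Y.space) (a b : X.stalk (p.base y)), IsUnit a → IsUnit b →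
    p.stalkMap y a = p.stalkMap y b → a = b
  exists_isUnit : ∀ (y : Y.space) (b : Y.stalk y), IsUnit b →
    ∃ a : X.stalk (p.base y), IsUnit a ∧ p.stalkMap y a = b

variable {p}

/-- Families indexed by `X` can be defined over the points of `Y`. -/
theorem IsUnitEquiv.exists_family (hp : p.IsUnitEquiv) {T : X.space → Type u}
    {P : ∀ y : Y.space, T (p.base y) → Prop} (h : ∀ y, ∃ t, P y t) :
    ∃ f : ∀ x, T x, ∀ y, P y (f (p.base y)) := by
  -- The value at `x` has to satisfy the condition for every `y` over `x`; injectivity leaves one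
  -- such `y`, for which the transport is trivial.
  have : ∀ x, ∃ t : T x, ∀ y (e : p.base y = x), P y (e ▸ t) := by
    intro x
    obtain ⟨y, rfl⟩ := hp.bijective.2 x
    obtain ⟨t, ht⟩ := h y
    refine ⟨t, fun y' e => ?_⟩
    obtain rfl : y' = y := hp.bijective.1 e
    exact ht
  choose f hf using this
  exact ⟨f, fun y => hf _ y rfl⟩

/-- An inverse of the germ extends to a section near `x`, and the relation `s * t = 1` between germs
persists on a neighbourhood: invertibility is an open condition. -/
theorem isUnit_germ_near {x : X.space} {U : Opens X.space} (hx : x ∈ U) (s : X.sec U)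
    (h : IsUnit (germ X.sheaf hx s)) :
    ∃ (W : Opens X.space) (_ : x ∈ W) (i : W ≤ U), ∀ z (hz : z ∈ W),
      IsUnit (germ X.sheaf (i hz) s) := by
  obtain ⟨t, ht⟩ := h.exists_right_inv
  obtain ⟨V, hV, t, rfl⟩ := exists_germ t
  have hx' : x ∈ U ⊓ V := ⟨hx, hV⟩
  have e : germ X.sheaf hx' (res X.sheaf inf_le_left s * res X.sheaf inf_le_right t) =
      germ X.sheaf hx' 1 := by
    rw [germ_mul, germ_res, germ_res, germ_one, ht]
  obtain ⟨W, hW, i, j, e⟩ := germ_eq e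
  refine ⟨W, hW, i.trans inf_le_left, fun z hz => ?_⟩
  refine IsUnit.of_mul_eq_one (germ X.sheaf (i hz).2 t) ?_
  have := congrArg (germ X.sheaf hz) e
  rwa [germ_res, germ_res, germ_mul, germ_res, germ_res, germ_one] at this

/-- A section all of whose germs are units is a unit. -/
theorem isUnit_of_germ {W : Opens X.space} (a : X.sec W)
    (h : ∀ x (hx : x ∈ W), IsUnit (germ X.sheaf hx a)) : IsUnit a := by
  have h1 : ∀ x : X.space, ∃ v : X.stalk x, ∀ hx : x ∈ W, germ X.sheaf hx a * v = 1 := by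
    intro x
    by_cases hx : x ∈ W
    · obtain ⟨v, hv⟩ := (h x hx).exists_right_inv
      exact ⟨v, fun _ => hv⟩
    · exact ⟨0, fun h => absurd h hx⟩
  choose v hv using h1
  obtain ⟨w, hw⟩ := exists_sec (F := X.sheaf) (U := W) (fun x _ => v x) (by
    intro x hx
    obtain ⟨V, hV, t, ht⟩ := exists_germ (v x)
    have hx' : x ∈ W ⊓ V := ⟨hx, hV⟩
    have q : germ X.sheaf hx' (res X.sheaf inf_le_left a * res X.sheaf inf_le_right t) =
        germ X.sheaf hx' 1 := by
      rw [germ_mul, germ_res, germ_res, germ_one, ht, hv]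
    obtain ⟨V', hV', i', j', q⟩ := germ_eq q
    refine ⟨V', hV', i'.trans inf_le_left, res X.sheaf (i'.trans inf_le_right) t,
      fun z hz => ?_⟩
    have q := congrArg (germ X.sheaf hz) q
    rw [germ_res, germ_res, germ_mul, germ_res, germ_res, germ_one] at q
    rw [germ_res]
    -- Uniqueness of inverses makes the local inverse agree with the inverses chosen pointwise, so
    -- the latter glue.
    exact left_inv_eq_right_inv (by rw [mul_comm, q]) (hv z (i' hz).1))
  refine IsUnit.of_mul_eq_one w (sec_ext fun x hx => ?_)
  rw [germ_mul, germ_one, hw, hv]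

/-- Sections of units lift locally. -/
theorem IsUnitEquiv.exists_near (hp : p.IsUnitEquiv) {y : Y.space} {V : Opens Y.space}
    (hy : y ∈ V) (b : Y.sec V) (hb : IsUnit (germ Y.sheaf hy b)) :
    ∃ (W : Opens X.space) (_ : p.base y ∈ W) (a : X.sec W) (i : Opens.comap p.base W ≤ V),
      ∀ z (hz : p.base z ∈ W), IsUnit (germ X.sheaf hz a) ∧
        p.stalkMap z (germ X.sheaf hz a) = germ Y.sheaf (i hz) b := by
  obtain ⟨a, ha, e⟩ := hp.exists_isUnit y _ hb
  obtain ⟨U, hU, a, rfl⟩ := exists_germ a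
  obtain ⟨W₁, hW₁, i₁, hu⟩ := isUnit_germ_near hU a ha
  rw [p.stalkMap_germ] at e
  obtain ⟨W₂, hW₂, i, j, e⟩ := germ_eq e
  -- The equality of germs spreads out to an open `W₂` of `Y`; it is replaced by a smaller
  -- neighbourhood which is the preimage of an open subset of `X`.
  obtain ⟨W₃, hW₃, k⟩ := hp.exists_comap_le y W₂ hW₂
  refine ⟨W₁ ⊓ W₃, ⟨hW₁, hW₃⟩, res X.sheaf (inf_le_left.trans i₁) a,
    fun z hz => j (k hz.2), fun z hz => ?_⟩
  rw [germ_res]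
  refine ⟨hu _ hz.1, ?_⟩
  have := congrArg (germ Y.sheaf (k hz.2)) e
  rw [germ_res, germ_res] at this
  rw [p.stalkMap_germ, this]

/-- An invertible sheaf with trivial inverse image is trivial. -/
theorem IsUnitEquiv.unit_iso (hp : p.IsUnitEquiv) {L : ActSheaf X} (hL : L.IsInvertible)
    (e : Iso (pullback p L) (unit Y)) : Nonempty (Iso (unit X) L) := by
  obtain ⟨φ, hφ, k⟩ := e.exists_isStalkIso
  -- `ε` is `l ↦ [l, 1]` followed by the trivialization of `p^* L`. The sought global generator of
  -- `L` is the one with `ε = 1` everywhere.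
  let ε : ∀ y : Y.space, L.stalk (p.base y) → Y.stalk y :=
    fun y l => φ y (Opens.mem_top y) (pullbackUnit p L y l)
  have ε_smul : ∀ y (a : X.stalk (p.base y)) l, ε y (a • l) = p.stalkMap y a * ε y l := by
    intro y a l
    change φ _ _ _ = _
    rw [pullbackUnit_smul, hφ.map_smul]
    rfl
  have ε_unit : ∀ y l, IsFreeGen (X.stalk (p.base y)) l → IsUnit (ε y l) := fun y l hl =>
    IsFreeGen.isUnit (hφ.isFreeGen (pullbackUnit_isFreeGen hl))
  -- Such generators differ by a unit `a` with image `1`, and `a = 1` by injectivity on units.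
  have uniq : ∀ y (l l' : L.stalk (p.base y)), IsFreeGen (X.stalk (p.base y)) l →
      IsFreeGen (X.stalk (p.base y)) l' → ε y l = 1 → ε y l' = 1 → l = l' := by
    intro y l l' hl hl' h h'
    obtain ⟨a, rfl⟩ := hl.2 l'
    dsimp only at hl' h' ⊢
    rw [ε_smul, h, mul_one] at h'
    rw [hp.eq_of_isUnit y a 1 (hl.isUnit_of_smul hl') isUnit_one (h'.trans (map_one _).symm),
      one_smul]
  have loc : ∀ y, ∃ (W : Opens X.space) (_ : p.base y ∈ W) (l : L.sec W),
      ∀ z (hz : p.base z ∈ W), IsFreeGen (X.stalk (p.base z)) (germ L.sheaf hz l) ∧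
        ε z (germ L.sheaf hz l) = 1 := by
    intro y
    obtain ⟨U, hU, g, hg⟩ := isInvertible_iff.mp hL (p.base y)
    let b : Y.sec (Opens.comap p.base U) := e.equiv _ le_top (pullbackSec p g)
    have hb : ∀ z (hz : p.base z ∈ U), ε z (germ L.sheaf hz g) =
        germ Y.sheaf (Opens.mem_comap.mpr hz) b := by
      intro z hz
      change φ _ _ _ = _
      rw [← germ_pullbackSec g hz]
      exact k _ le_top _ _ _
    obtain ⟨W, hW, a, i, ha⟩ := hp.exists_near (y := y) (V := Opens.comap p.base U) hU b (by
      rw [← hb y hU]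
      exact ε_unit y _ (hg _ hU))
    have hW' : ∀ z, p.base z ∈ W → p.base z ∈ U := fun z hz => i hz
    have hWU : W ≤ U := by
      intro x hx
      obtain ⟨z, rfl⟩ := hp.bijective.2 x
      exact hW' z hx
    have inv : ∀ z (hz : p.base z ∈ W), IsUnit (germ X.sheaf hz a) := fun z hz => (ha z hz).1
    -- Here `a` lifts the unit `ε g` of `Y` to `X`, and dividing the local generator `g` by `a`
    -- normalizes its image to `1`.
    obtain ⟨v, hv⟩ := (isUnit_of_germ a fun x hx => by
      obtain ⟨z, rfl⟩ := hp.bijective.2 x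
      exact inv z hx).exists_right_inv
    refine ⟨W, hW, v • MonoidGeom.res L.sheaf hWU g, fun z hz => ?_⟩
    have hvz : germ X.sheaf hz a * germ X.sheaf hz v = 1 := by rw [← germ_mul, hv, germ_one]
    have hvu : IsUnit (germ X.sheaf hz v) := IsUnit.of_mul_eq_one_right _ hvz
    rw [germ_smul, germ_res]
    refine ⟨(hg _ (hWU hz)).smul hvu, ?_⟩
    rw [ε_smul, hb z (hWU hz), ← (ha z hz).2, ← map_mul, mul_comm, hvz, map_one]
  obtain ⟨f, hf⟩ := hp.exists_family (T := fun x => L.stalk x)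
    (P := fun y l => IsFreeGen (X.stalk (p.base y)) l ∧ ε y l = 1) fun y => by
      obtain ⟨W, hW, l, h⟩ := loc y
      exact ⟨_, h y hW⟩
  -- The pointwise normalized generators glue, because by uniqueness they agree with the local
  -- sections found above.
  obtain ⟨s, hs⟩ := exists_sec (F := L.sheaf) (U := ⊤) (fun x _ => f x) (by
    intro x _
    obtain ⟨y, rfl⟩ := hp.bijective.2 x
    obtain ⟨W, hW, l, h⟩ := loc y
    refine ⟨W, hW, le_top, l, fun x hx => ?_⟩
    obtain ⟨z, rfl⟩ := hp.bijective.2 x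
    exact uniq z _ _ (h z hx).1 (hf z).1 (h z hx).2 (hf z).2)
  refine unit_iso_of_gen (s := s) fun x hx => ?_
  obtain ⟨y, rfl⟩ := hp.bijective.2 x
  rw [hs]
  exact (hf y).1

end MonoidedSpace.Hom
end
end MonoidGeom

namespace MonoidGeom
noncomputable section
namespace MonoidedSpace.Hom

open ActSheaf

/-! ### Descent of an invertible sheaf along a unit equivalence -/

section Descent

variable {X Y : MonoidedSpace.{u}} (p : Hom Y X) (M : ActSheaf Y) (g : ∀ y, M.stalk y)

/-- Given free generators `g y` of the stalks of `M`, the local condition on families of elements of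
the stalks of `X` which describes the sheaf on `X` with inverse image `M`. -/
def descentPred : TopCat.LocalPredicate fun x : X.space => X.stalk x where
  pred {U} f := ∀ x : U, ∃ (W : Opens X.space) (_ : x.1 ∈ W) (i : W ≤ U) (a : X.sec W)
    (m : M.sec (Opens.comap p.base W)), ∀ (y : Y.space) (hy : p.base y ∈ W),
      -- The unit `u` is the coordinate of `m` with respect to `g y`, so the condition says `f • g =
      -- a • m`, where `m` is forced to be a local generator when the `g y` are free generators.
      ∃ u : X.stalk (p.base y), IsUnit u ∧
        p.stalkMap y u • g y = germ M.sheaf (Opens.mem_comap.mpr hy) m ∧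
        f ⟨p.base y, i hy⟩ = germ X.sheaf hy a * u
  res {V' V} i f h x := by
    obtain ⟨W, hW, j, a, m, e⟩ := h ⟨x.1, i.le x.2⟩
    refine ⟨W ⊓ V', ⟨hW, x.2⟩, inf_le_right, res X.sheaf inf_le_left a,
      res M.sheaf (Opens.comap_mono p.base inf_le_left) m, fun y hy => ?_⟩
    obtain ⟨u, hu, h1, h2⟩ := e y hy.1
    refine ⟨u, hu, ?_, ?_⟩
    · rw [germ_res, h1]
    · rw [germ_res]
      exact h2
  locality {V} f h x := by
    obtain ⟨V', hV, i, h⟩ := h x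
    obtain ⟨W, hW, j, a, m, e⟩ := h ⟨x.1, hV⟩
    exact ⟨W, hW, j.trans i.le, a, m, e⟩

variable {p M g}

/-- A local generator `m` of `M` can be taken over the preimage of an open `W`, since `p` is a
homeomorphism. Its coordinate with respect to `g y` is a unit because both are free generators, and
so it lifts to a unit of the stalk of `X`. -/
theorem IsUnitEquiv.exists_coord (hp : p.IsUnitEquiv) (hM : M.IsInvertible)
    (hg : ∀ y, IsFreeGen (Y.stalk y) (g y)) (x : X.space) :
    ∃ (W : Opens X.space) (_ : x ∈ W) (m : M.sec (Opens.comap p.base W))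
      (f : ∀ x, X.stalk x), ∀ (y : Y.space) (hy : p.base y ∈ W), IsUnit (f (p.base y)) ∧
        p.stalkMap y (f (p.base y)) • g y = germ M.sheaf (Opens.mem_comap.mpr hy) m := by
  obtain ⟨y, rfl⟩ := hp.bijective.2 x
  obtain ⟨V, hV, m, hm⟩ := isInvertible_iff.mp hM y
  obtain ⟨W, hW, i⟩ := hp.exists_comap_le y V hV
  have key : ∀ z : Y.space, ∃ u : X.stalk (p.base z), ∀ hz : p.base z ∈ W, IsUnit u ∧
      p.stalkMap z u • g z = germ M.sheaf (i (Opens.mem_comap.mpr hz)) m := by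
    intro z
    by_cases hz : p.base z ∈ W
    · have hmz := hm z (i (Opens.mem_comap.mpr hz))
      obtain ⟨b, hb⟩ := (hg z).2 (germ M.sheaf (i (Opens.mem_comap.mpr hz)) m)
      dsimp only at hb
      rw [← hb] at hmz
      obtain ⟨u, hu, rfl⟩ := hp.exists_isUnit z b ((hg z).isUnit_of_smul hmz)
      exact ⟨u, fun _ => ⟨hu, hb⟩⟩
    · exact ⟨0, fun h => absurd h hz⟩
  obtain ⟨f, hf⟩ := hp.exists_family (T := fun x => X.stalk x) key
  refine ⟨W, hW, res M.sheaf i m, f, fun z hz => ?_⟩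
  rw [germ_res]
  exact hf z hz

theorem descentPred_coord {W : Opens X.space}
    {m : M.sec (Opens.comap p.base W)} {f : ∀ x, X.stalk x}
    (hf : ∀ (y : Y.space) (hy : p.base y ∈ W), IsUnit (f (p.base y)) ∧
        p.stalkMap y (f (p.base y)) • g y = germ M.sheaf (Opens.mem_comap.mpr hy) m)
    (a : X.sec W) :
    (descentPred p M g).pred fun x : W => germ X.sheaf x.2 a * f x.1 := by
  intro x
  refine ⟨W, x.2, le_rfl, a, m, fun y hy => ?_⟩
  obtain ⟨h1, h2⟩ := hf y hy
  exact ⟨_, h1, h2, rfl⟩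

theorem IsUnitEquiv.descentPred_zero (hp : p.IsUnitEquiv) (hM : M.IsInvertible)
    (hg : ∀ y, IsFreeGen (Y.stalk y) (g y)) (U : Opens X.space) :
    (descentPred p M g).pred fun _ : U => 0 := by
  intro x
  obtain ⟨W, hW, m, f, hf⟩ := hp.exists_coord hM hg x.1
  -- The section `a` is `0`, but the condition still requires a local generator `m`, whose
  -- coordinates are units.
  refine ⟨W ⊓ U, ⟨hW, x.2⟩, inf_le_right, 0,
    res M.sheaf (Opens.comap_mono p.base inf_le_left) m, fun y hy => ?_⟩
  obtain ⟨h1, h2⟩ := hf y hy.1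
  refine ⟨_, h1, ?_, ?_⟩
  · rw [germ_res, h2]
  · rw [MonoidedSpace.germ_zero, zero_mul]

theorem descentPred_smul {U : Opens X.space} (a : X.sec U) {f : ∀ x : U, X.stalk x.1}
    (h : (descentPred p M g).pred f) :
    (descentPred p M g).pred fun x : U => germ X.sheaf x.2 a • f x := by
  intro x
  obtain ⟨W, hW, i, b, m, e⟩ := h x
  refine ⟨W, hW, i, res X.sheaf i a * b, m, fun y hy => ?_⟩
  obtain ⟨u, hu, h1, h2⟩ := e y hy
  refine ⟨u, hu, h1, ?_⟩
  rw [germ_mul, germ_res, mul_assoc, ← h2]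
  rfl

/-- The sheaf on `X` with inverse image `M`. -/
def descent (hp : p.IsUnitEquiv) (hM : M.IsInvertible)
    (hg : ∀ y, IsFreeGen (Y.stalk y) (g y)) : ActSheaf X :=
  ofPred (descentPred p M g) (hp.descentPred_zero hM hg) descentPred_smul

variable (hp : p.IsUnitEquiv) (hM : M.IsInvertible) (hg : ∀ y, IsFreeGen (Y.stalk y) (g y))

/-- The stalk of the descended sheaf. -/
def descentEv (x : X.space) : (descent hp hM hg).stalk x → X.stalk x :=
  ev (hzero := hp.descentPred_zero hM hg) (hsmul := descentPred_smul) x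

theorem descentEv_smul (x : X.space) (a : X.stalk x) (t : (descent hp hM hg).stalk x) :
    descentEv hp hM hg x (a • t) = a * descentEv hp hM hg x t :=
  ev_smul (hzero := hp.descentPred_zero hM hg) (hsmul := descentPred_smul) x a t

theorem descentEv_germ {U : Opens X.space} {x : X.space} (hx : x ∈ U)
    (f : (descent hp hM hg).sec U) :
    descentEv hp hM hg x (germ (descent hp hM hg).sheaf hx f) = f.1 ⟨x, hx⟩ :=
  ev_germ (hzero := hp.descentPred_zero hM hg) (hsmul := descentPred_smul) hx f

/-- Locally a family is a section `a` of `𝒜_X` times the coordinate `u` of a generator `m`. For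
injectivity the two generators `m` and `m'` used by two families are compared: their ratio is a unit
on `Y`, it lifts to a section `c` of units on `X`, and equality of `a` and `a' * c` spreads from the
stalk to a neighbourhood. -/
theorem descentEv_bijective (x : X.space) : Function.Bijective (descentEv hp hM hg x) := by
  constructor
  · refine ev_injective (hzero := hp.descentPred_zero hM hg) (hsmul := descentPred_smul) x ?_
    intro U U' hU hU' f f' hf hf' h
    obtain ⟨W, hW, i, a, m, e⟩ := hf ⟨x, hU⟩
    obtain ⟨W', hW', i', a', m', e'⟩ := hf' ⟨x, hU'⟩
    obtain ⟨y, rfl⟩ := hp.bijective.2 x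
    have gen : ∀ z (u : X.stalk (p.base z)), IsUnit u →
        IsFreeGen (Y.stalk z) (p.stalkMap z u • g z) :=
      fun z u hu => (hg z).smul (hu.map (p.stalkMap z))
    obtain ⟨u, hu, h1, h2⟩ := e y hW
    obtain ⟨u', hu', h1', h2'⟩ := e' y hW'
    have hm := gen y u hu
    have hm' := gen y u' hu'
    rw [h1] at hm
    rw [h1'] at hm'
    -- `b` is the ratio of `m'` to `m` at `y`; both are free generators, so it is a unit.
    obtain ⟨b, hb⟩ := hm.2 (germ M.sheaf (Opens.mem_comap.mpr hW') m')
    dsimp only at hb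
    rw [← hb] at hm'
    have hbu := hm.isUnit_of_smul hm'
    obtain ⟨V, hV, b, rfl⟩ := exists_germ b
    have hy : y ∈ V ⊓ Opens.comap p.base W := ⟨hV, hW⟩
    have q : germ M.sheaf hy (res Y.sheaf (inf_le_left : V ⊓ Opens.comap p.base W ≤ V) b •
        res M.sheaf inf_le_right m) = germ M.sheaf (Opens.mem_comap.mpr hW') m' := by
      rw [germ_smul, germ_res, germ_res, hb]
    obtain ⟨V', hV', j, j', q⟩ := germ_eq q
    obtain ⟨W₁, hW₁, c, k, hc⟩ := hp.exists_near (Opens.mem_inf.mpr ⟨hV, hV'⟩)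
      (res Y.sheaf inf_le_left b) (by rw [germ_res]; exact hbu)
    -- With `c` lifting `b`, the relation `m' = b • m` between sections becomes `u' = c * u` between
    -- coordinates: compare the coefficients of `g z` and use injectivity on units.
    have rel : ∀ z (h1 : p.base z ∈ W₁) (h2 : p.base z ∈ W) (h3 : p.base z ∈ W')
        (u u' : X.stalk (p.base z)), IsUnit u → IsUnit u' →
        p.stalkMap z u • g z = germ M.sheaf (Opens.mem_comap.mpr h2) m →
        p.stalkMap z u' • g z = germ M.sheaf (Opens.mem_comap.mpr h3) m' →
        u' = germ X.sheaf h1 c * u := by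
      intro z k1 k2 k3 u u' hu hu' e1 e2
      refine hp.eq_of_isUnit z _ _ hu' ((hc z k1).1.mul hu) ((hg z).1 ?_)
      have hz : z ∈ V' := (k (Opens.mem_comap.mpr k1)).2
      have q := congrArg (germ M.sheaf hz) q
      rw [germ_res, germ_res, germ_smul, germ_res, germ_res] at q
      dsimp only
      rw [e2, map_mul, mul_smul, e1, (hc z k1).2, germ_res, q]
    -- From `a * u = a' * u' = a' * c * u` at the given point, cancelling the unit `u`.
    have q' : germ X.sheaf hW a = germ X.sheaf (show p.base y ∈ W₁ ⊓ W' from ⟨hW₁, hW'⟩)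
        (res X.sheaf inf_le_right a' * res X.sheaf inf_le_left c) := by
      rw [germ_mul, germ_res, germ_res]
      refine hu.mul_right_cancel ?_
      rw [mul_assoc, ← rel y hW₁ hW hW' u u' hu hu' h1 h1', ← h2, ← h2']
      exact h
    obtain ⟨W₂, hW₂, l, l', q'⟩ := germ_eq q'
    refine ⟨W₂, hW₂, l.trans i, (l'.trans inf_le_right).trans i', fun z => ?_⟩
    obtain ⟨z, hz⟩ := z
    obtain ⟨z, rfl⟩ := hp.bijective.2 z
    obtain ⟨v, hv, e1, e2⟩ := e z (l hz)
    obtain ⟨v', hv', e1', e2'⟩ := e' z (l' hz).2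
    dsimp only
    rw [e2, e2', rel z (l' hz).1 (l hz) (l' hz).2 v v' hv hv' e1 e1', ← mul_assoc]
    congr 1
    have := congrArg (germ X.sheaf hz) q'
    rwa [germ_res, germ_res, germ_mul, germ_res, germ_res] at this
  · refine ev_surjective (hzero := hp.descentPred_zero hM hg) (hsmul := descentPred_smul) x ?_
    intro t
    obtain ⟨W, hW, m, f, hf⟩ := hp.exists_coord hM hg x
    have hu : IsUnit (f x) := by
      obtain ⟨y, rfl⟩ := hp.bijective.2 x
      exact (hf y hW).1
    -- To obtain the value `t` at `x`, take `a` with germ `t * v`, where `v` inverts the coordinate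
    -- at `x`.
    obtain ⟨v, hv⟩ := hu.exists_left_inv
    obtain ⟨V, hV, a, ha⟩ := exists_germ (t * v)
    have hx : x ∈ W ⊓ V := ⟨hW, hV⟩
    refine ⟨W ⊓ V, hx, _, descentPred_coord
      (m := res M.sheaf (Opens.comap_mono p.base inf_le_left) m) (f := f) (fun y hy => ?_)
      (res X.sheaf inf_le_right a), ?_⟩
    · rw [germ_res]
      exact hf y hy.1
    · dsimp only
      rw [germ_res, ha, mul_assoc, hv, mul_one]

theorem descent_isFreeGen {x : X.space} {t : (descent hp hM hg).stalk x}
    (h : IsUnit (descentEv hp hM hg x t)) : IsFreeGen (X.stalk x) t := by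
  refine (Function.Bijective.of_comp_iff' (descentEv_bijective hp hM hg x) _).mp ?_
  have : (descentEv hp hM hg x ∘ fun a : X.stalk x => a • t) =
      fun a => a • descentEv hp hM hg x t := funext fun a => descentEv_smul hp hM hg x a t
  rw [this]
  exact isFreeGen_of_isUnit h

theorem descent_isInvertible : (descent hp hM hg).IsInvertible := by
  rw [isInvertible_iff]
  intro x
  obtain ⟨W, hW, m, f, hf⟩ := hp.exists_coord hM hg x
  refine ⟨W, hW, ⟨_, descentPred_coord hf 1⟩, fun z hz => descent_isFreeGen hp hM hg ?_⟩
  obtain ⟨y, rfl⟩ := hp.bijective.2 z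
  refine (congrArg IsUnit (descentEv_germ hp hM hg hz _)).mpr ?_
  dsimp only
  rw [germ_one, one_mul]
  exact (hf y hz).1

/-- The map `f ↦ f • g y` on stalks takes sections to sections, by the very condition `f • g = a •
m` defining the descended sheaf, and takes the family with value `1` at `y` to `g y`. -/
theorem pullback_descent : Nonempty (Iso (pullback p (descent hp hM hg)) M) := by
  refine pullback_iso_of_map
    (fun y t => p.stalkMap y (descentEv hp hM hg _ t) • g y) ?_ ?_ ?_
  · intro y a t
    rw [descentEv_smul, map_mul, mul_smul]
  · intro U s y hy
    obtain ⟨W, hW, i, a, m, e⟩ := s.2 ⟨p.base y, hy⟩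
    refine ⟨Opens.comap p.base W, hW, fun z hz => i (Opens.mem_comap.mp hz), p.app W a • m,
      fun z hz => ?_⟩
    obtain ⟨u, hu, h1, h2⟩ := e z (Opens.mem_comap.mp hz)
    rw [descentEv_germ, h2, map_mul, mul_smul, h1, germ_smul, p.stalkMap_germ]
  · intro y
    obtain ⟨t, ht⟩ := (descentEv_bijective hp hM hg (p.base y)).2 1
    refine ⟨t, descent_isFreeGen hp hM hg (ht ▸ isUnit_one), ?_⟩
    rw [ht, map_one, one_smul]
    exact hg y

end Descent

/-! ### The isomorphism of Picard groups -/

variable {X Y : MonoidedSpace.{u}} {p : Hom Y X}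

/-- The homomorphism property is `pullback_smash`, a trivial kernel is `unit_iso`, and surjectivity
is `pullback_descent`, applied to an arbitrary choice of generators of the stalks. -/
theorem IsUnitEquiv.exists_picEquiv (hp : p.IsUnitEquiv) :
    ∃ e : Pic X ≃* Pic Y, ∀ L : InvertibleSheaf X, e (Pic.mk L) = Pic.mk (L.pullback p) := by
  let F : Pic X →* Pic Y := MonoidHom.mk' (Quotient.lift (fun L => Pic.mk (L.pullback p))
      fun L M ⟨e⟩ => Pic.mk_eq_mk.mpr (pullback_congr L.isInvertible e)) fun a b => by
    induction a using Pic.ind with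
    | h L =>
      induction b using Pic.ind with
      | h M => exact Pic.mk_eq_mk.mpr (pullback_smash L.isInvertible M.isInvertible)
  have hF : ∀ L : InvertibleSheaf X, F (Pic.mk L) = Pic.mk (L.pullback p) := fun _ => rfl
  refine ⟨MulEquiv.ofBijective F ⟨?_, ?_⟩, hF⟩
  · rw [injective_iff_map_eq_one]
    intro a ha
    induction a using Pic.ind with
    | h L =>
      rw [hF, Pic.one_def, Pic.mk_eq_mk] at ha
      obtain ⟨e⟩ := ha
      obtain ⟨e'⟩ := hp.unit_iso L.isInvertible e
      exact Pic.mk_eq_mk.mpr ⟨e'.symm⟩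
  · intro b
    induction b using Pic.ind with
    | h M =>
      choose g hg using fun y => M.isInvertible.exists_freeGen y
      exact ⟨Pic.mk ⟨_, descent_isInvertible hp M.isInvertible hg⟩,
        Pic.mk_eq_mk.mpr (pullback_descent hp M.isInvertible hg)⟩

end MonoidedSpace.Hom
end
end MonoidGeom

namespace MonoidGeom
noncomputable section

/-! ## Affine charts -/

namespace MonoidedSpace

/-- Taking germs, as a homomorphism of pointed monoids. -/
def germHom {X : MonoidedSpace.{u}} {U : Opens X.space} {x : X.space} (hx : x ∈ U) :
    X.sec U →*₀ X.stalk x where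
  toFun := germ X.sheaf hx
  map_zero' := germ_zero hx
  map_one' := germ_one hx
  map_mul' := germ_mul hx

/-- The homomorphism `α : A → 𝒜(U)` identifies the open subspace `U` with `MSpec A`. -/
structure IsChart {X : MonoidedSpace.{u}} {A : Type u} [CommMonoidWithZero A] (U : Opens X.space)
    (α : A →*₀ X.sec U) : Prop where
  zero_ne_one : ∀ x ∈ U, (0 : X.stalk x) ≠ 1
  exists_frac : ∀ (x : X.space) (hx : x ∈ U) (t : X.stalk x), ∃ a s : A,
    IsUnit (germ X.sheaf hx (α s)) ∧ germ X.sheaf hx (α s) * t = germ X.sheaf hx (α a)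
  exists_eq : ∀ (x : X.space) (hx : x ∈ U) (a b : A),
    germ X.sheaf hx (α a) = germ X.sheaf hx (α b) →
      ∃ s : A, IsUnit (germ X.sheaf hx (α s)) ∧ s * a = s * b
  exists_point : ∀ q : Set A, IsPrimeIdeal q → ∃ (x : X.space) (hx : x ∈ U),
    ∀ a, IsUnit (germ X.sheaf hx (α a)) ↔ a ∉ q
  point_unique : ∀ (x y : X.space) (hx : x ∈ U) (hy : y ∈ U),
    (∀ a, IsUnit (germ X.sheaf hx (α a)) ↔ IsUnit (germ X.sheaf hy (α a))) → x = y
  exists_basic : ∀ (x : X.space) (hx : x ∈ U) (V : Opens X.space), x ∈ V →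
    ∃ s : A, IsUnit (germ X.sheaf hx (α s)) ∧
      ∀ z (hz : z ∈ U), IsUnit (germ X.sheaf hz (α s)) → z ∈ V

namespace IsChart

variable {X : MonoidedSpace.{u}} {A : Type u} [CommMonoidWithZero A] {U : Opens X.space}
  {α : A →*₀ X.sec U}

theorem isPrimeIdeal (h : IsChart U α) {x : X.space} (hx : x ∈ U) :
    IsPrimeIdeal {a : A | ¬ IsUnit (germ X.sheaf hx (α a))} where
  zero_mem := by
    intro h0
    rw [map_zero, germ_zero, isUnit_zero_iff] at h0
    exact h.zero_ne_one x hx h0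
  mul_mem a b hb hab := hb (by
    rw [map_mul, germ_mul] at hab
    exact isUnit_of_mul_isUnit_right hab)
  one_notMem := not_not.mpr (by rw [map_one, germ_one]; exact isUnit_one)
  mem_or_mem a b hab := by
    by_contra! hc
    simp only [Set.mem_ofPred_eq, not_not] at hc
    refine hab ?_
    rw [map_mul, germ_mul]
    exact hc.1.mul hc.2

theorem isPrimeIdeal_nonunits {A : Type u} [CommMonoidWithZero A] (h : (0 : A) ≠ 1) :
    IsPrimeIdeal {a : A | ¬ IsUnit a} where
  zero_mem h0 := h (isUnit_zero_iff.mp h0)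
  mul_mem _ _ hb hab := hb (isUnit_of_mul_isUnit_right hab)
  one_notMem := not_not.mpr isUnit_one
  mem_or_mem a b hab := by
    by_contra! hc
    simp only [Set.mem_ofPred_eq, not_not] at hc
    exact hab (hc.1.mul hc.2)

theorem zero_ne_one_of_mem (h : IsChart U α) {x : X.space} (hx : x ∈ U) : (0 : A) ≠ 1 := by
  intro e
  apply h.zero_ne_one x hx
  rw [← germ_zero hx, ← germ_one hx, ← map_zero α, ← map_one α, e]

/-- The nonunits of `A` form the largest prime ideal. A neighbourhood of the corresponding point
contains some `D(s)` with `s` a unit of `A`, and then `D(s)` is all of `U`. -/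
theorem exists_closed_point (h : IsChart U α) (h01 : (0 : A) ≠ 1) :
    ∃ (x : X.space) (hx : x ∈ U), (∀ a, IsUnit (germ X.sheaf hx (α a)) → IsUnit a) ∧
      ∀ V : Opens X.space, x ∈ V → U ≤ V := by
  obtain ⟨x, hx, e⟩ := h.exists_point _ (isPrimeIdeal_nonunits h01)
  simp only [Set.mem_ofPred_eq, not_not] at e
  refine ⟨x, hx, fun a => (e a).1, fun V hV z hz => ?_⟩
  obtain ⟨s, hs, k⟩ := h.exists_basic x hx V hV
  exact k z hz ((((e s).1 hs).map α).map (germHom hz))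

/-- The stalk at the closed point is a localization of `A` at elements which are already units, that
is, `A` itself. Every neighbourhood of this point contains `U`, so germs there determine, and extend
to, sections over `U`. If `0 = 1` in `A`, then `U` has no points. -/
theorem bijective (h : IsChart U α) : Function.Bijective α := by
  by_cases h01 : (0 : A) = 1
  · have : Subsingleton A := subsingleton_of_zero_eq_one h01
    refine ⟨fun a b _ => Subsingleton.elim a b, fun f => ⟨0, sec_ext fun x hx => ?_⟩⟩
    exact absurd h01 (h.zero_ne_one_of_mem hx)
  · obtain ⟨x, hx, hu, hV⟩ := h.exists_closed_point h01
    constructor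
    · intro a b e
      obtain ⟨s, hs, e⟩ := h.exists_eq x hx a b (by rw [e])
      exact (hu s hs).mul_left_cancel e
    · intro f
      obtain ⟨a, s, hs, e⟩ := h.exists_frac x hx (germ X.sheaf hx f)
      obtain ⟨t, ht⟩ := (hu s hs).exists_left_inv
      refine ⟨t * a, ?_⟩
      have e' : germ X.sheaf hx (α (t * a)) = germ X.sheaf hx f := by
        rw [map_mul, germ_mul, ← e, ← mul_assoc, ← germ_mul, ← map_mul, ht, map_one, germ_one,
          one_mul]
      obtain ⟨W, hW, i, j, e'⟩ := germ_eq e'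
      refine sec_ext fun z hz => ?_
      have := congrArg (germ X.sheaf (hV W hW hz)) e'
      rwa [germ_res, germ_res] at this

/-- Serves to replace a chart `α` by the tautological one, the identity of `X.sec U`, taking `e =
α`. -/
theorem comp_surjective (h : IsChart U α) {B : Type u} [CommMonoidWithZero B] (e : A →*₀ B)
    {β : B →*₀ X.sec U} (hβ : ∀ a, β (e a) = α a) (he : Function.Surjective e) :
    IsChart U β where
  zero_ne_one := h.zero_ne_one
  exists_frac x hx t := by
    obtain ⟨a, s, h1, h2⟩ := h.exists_frac x hx t
    exact ⟨e a, e s, by rwa [hβ], by rwa [hβ, hβ]⟩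
  exists_eq x hx a b q := by
    obtain ⟨a, rfl⟩ := he a
    obtain ⟨b, rfl⟩ := he b
    rw [hβ, hβ] at q
    obtain ⟨s, hs, q⟩ := h.exists_eq x hx a b q
    exact ⟨e s, by rwa [hβ], by rw [← map_mul, ← map_mul, q]⟩
  exists_point q hq := by
    obtain ⟨x, hx, k⟩ := h.exists_point (e ⁻¹' q)
      { zero_mem := by rw [Set.mem_preimage, map_zero]; exact hq.zero_mem
        mul_mem := fun a b hb => by
          rw [Set.mem_preimage, map_mul]; exact hq.mul_mem _ _ hb
        one_notMem := by rw [Set.mem_preimage, map_one]; exact hq.one_notMem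
        mem_or_mem := fun a b hab => by
          rw [Set.mem_preimage, map_mul] at hab; exact hq.mem_or_mem _ _ hab }
    refine ⟨x, hx, fun b => ?_⟩
    obtain ⟨a, rfl⟩ := he b
    rw [hβ]
    exact k a
  point_unique x y hx hy k := h.point_unique x y hx hy fun a => by
    rw [← hβ]
    exact k (e a)
  exists_basic x hx V hV := by
    obtain ⟨s, hs, k⟩ := h.exists_basic x hx V hV
    exact ⟨e s, by rwa [hβ], fun z hz => by rw [hβ]; exact k z hz⟩

end IsChart

end MonoidedSpace

/-! ### The standard chart of `MSpec A` -/

section MSpecChart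

variable (A : Type u) [CommMonoidWithZero A]

variable {A} in
/-- The prime ideal underlying a point of `MSpec A`. -/
def MSpec.prime (p : (MSpec A).space) : PrimeIdeals A := p

variable {A} in
/-- The value of a section of the structure sheaf at a point. -/
def MSpec.val {U : Opens (MSpec A).space} (f : (MSpec A).sec U) {p : (MSpec A).space}
    (hp : p ∈ U) : Localization (MSpec.prime p).compl := f.1 ⟨p, hp⟩

variable {A} in
/-- A section of the structure sheaf given by its values. -/
def MSpec.ofVal {U : Opens (MSpec A).space}
    (f : ∀ p : (MSpec A).space, p ∈ U → Localization (MSpec.prime p).compl)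
    (hf : ∀ p ∈ U, ∃ (V : Opens (MSpec A).space) (_ : p ∈ V) (i : V ≤ U) (a s : A),
      ∀ q (hq : q ∈ V), ∃ hs : s ∈ (MSpec.prime q).compl,
        f q (i hq) = Localization.mk a ⟨s, hs⟩) : (MSpec A).sec U :=
  ⟨fun p => f p.1 p.2, fun p => by
    obtain ⟨V, hV, i, a, s, e⟩ := hf p.1 p.2
    exact ⟨V, hV, i, a, s, fun q => e q.1 q.2⟩⟩

section

variable {A}

theorem MSpec.val_ofVal {U : Opens (MSpec A).space}
    (f : ∀ p : (MSpec A).space, p ∈ U → Localization (MSpec.prime p).compl)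
    (hf : ∀ p ∈ U, ∃ (V : Opens (MSpec A).space) (_ : p ∈ V) (i : V ≤ U) (a s : A),
      ∀ q (hq : q ∈ V), ∃ hs : s ∈ (MSpec.prime q).compl,
        f q (i hq) = Localization.mk a ⟨s, hs⟩) {p : (MSpec A).space} (hp : p ∈ U) :
    MSpec.val (MSpec.ofVal f hf) hp = f p hp := rfl

theorem MSpec.val_ext {U : Opens (MSpec A).space} {f g : (MSpec A).sec U}
    (h : ∀ p (hp : p ∈ U), MSpec.val f hp = MSpec.val g hp) : f = g :=
  Subtype.ext (funext fun p => h p.1 p.2)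

theorem MSpec.val_mul {U : Opens (MSpec A).space} (f g : (MSpec A).sec U) {p : (MSpec A).space}
    (hp : p ∈ U) : MSpec.val (f * g) hp = MSpec.val f hp * MSpec.val g hp := rfl

theorem MSpec.val_one {U : Opens (MSpec A).space} {p : (MSpec A).space}
    (hp : p ∈ U) : MSpec.val (1 : (MSpec A).sec U) hp = 1 := rfl

theorem MSpec.val_zero {U : Opens (MSpec A).space} {p : (MSpec A).space}
    (hp : p ∈ U) : MSpec.val (0 : (MSpec A).sec U) hp = 0 := rfl

theorem MSpec.val_res {U V : Opens (MSpec A).space} (h : V ≤ U) (f : (MSpec A).sec U)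
    {p : (MSpec A).space} (hp : p ∈ V) :
    MSpec.val (res (MSpec A).sheaf h f) hp = MSpec.val f (h hp) := rfl

theorem MSpec.exists_mk {U : Opens (MSpec A).space} (f : (MSpec A).sec U) {p : (MSpec A).space}
    (hp : p ∈ U) : ∃ (V : Opens (MSpec A).space) (_ : p ∈ V) (i : V ≤ U) (a s : A),
      ∀ q (hq : q ∈ V), ∃ hs : s ∈ (MSpec.prime q).compl,
        MSpec.val f (i hq) = Localization.mk a ⟨s, hs⟩ := by
  obtain ⟨V, hV, i, a, s, e⟩ := f.2 ⟨p, hp⟩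
  exact ⟨V, hV, i, a, s, fun q hq => e ⟨q, hq⟩⟩

end

/-- Elements of `A` as sections of the structure sheaf of `MSpec A`. -/
def MSpec.const (U : Opens (MSpec A).space) : A →*₀ (MSpec A).sec U where
  toFun a := MSpec.ofVal (fun _ _ => Localization.mk a 1)
    fun _ hp => ⟨U, hp, le_rfl, a, 1, fun _ _ => ⟨Submonoid.one_mem _, rfl⟩⟩
  map_zero' := MSpec.val_ext fun p hp => by
    rw [MSpec.val_ofVal, MSpec.val_zero, Localization.mk_zero]
  map_one' := MSpec.val_ext fun p hp => by
    rw [MSpec.val_ofVal, MSpec.val_one, Localization.mk_one]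
  map_mul' a b := MSpec.val_ext fun p hp => by
    rw [MSpec.val_mul, MSpec.val_ofVal, MSpec.val_ofVal, MSpec.val_ofVal, Localization.mk_mul,
      mul_one]

variable {A}

theorem MSpec.val_const {U : Opens (MSpec A).space} (a : A) {p : (MSpec A).space} (hp : p ∈ U) :
    MSpec.val (MSpec.const A U a) hp = Localization.mk a 1 := rfl

theorem MSpec.res_const {U V : Opens (MSpec A).space} (h : V ≤ U) (a : A) :
    res (MSpec A).sheaf h (MSpec.const A U a) = MSpec.const A V a :=
  MSpec.val_ext fun p hp => by rw [MSpec.val_res, MSpec.val_const, MSpec.val_const]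

theorem MSpec.val_eq_of_germ_eq {U V : Opens (MSpec A).space} {p : (MSpec A).space} (hU : p ∈ U)
    (hV : p ∈ V) {f : (MSpec A).sec U} {g : (MSpec A).sec V}
    (h : germ (MSpec A).sheaf hU f = germ (MSpec A).sheaf hV g) :
    MSpec.val f hU = MSpec.val g hV := by
  obtain ⟨W, hW, i, j, e⟩ := germ_eq h
  rw [← MSpec.val_res i f hW, e, MSpec.val_res]

/-- The basic open subset `D(s)`. -/
def PrimeIdeals.basicOpen (s : A) : Opens (MSpec A).space :=
  ⟨{p : PrimeIdeals A | s ∉ p.1}, TopologicalSpace.isOpen_generateFrom_of_mem ⟨s, rfl⟩⟩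

/-- The subbasis of the sets `D(s)` is a basis because `D(s) ∩ D(t) = D(s * t)`. -/
theorem PrimeIdeals.exists_basicOpen_le (V : Opens (MSpec A).space) (p : (MSpec A).space)
    (hp : p ∈ V) : ∃ s : A, p ∈ PrimeIdeals.basicOpen s ∧ PrimeIdeals.basicOpen s ≤ V := by
  obtain ⟨V, hV⟩ := V
  change TopologicalSpace.GenerateOpen _ V at hV
  change p ∈ V at hp
  change ∃ s : A, s ∉ p.1 ∧ {p : PrimeIdeals A | s ∉ p.1} ⊆ V
  induction hV with
  | basic V hV =>
    obtain ⟨s, rfl⟩ := hV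
    exact ⟨s, hp, le_rfl⟩
  | univ => exact ⟨1, p.2.one_notMem, Set.subset_univ _⟩
  | inter V W _ _ ih ih' =>
    obtain ⟨s, hs, i⟩ := ih hp.1
    obtain ⟨t, ht, j⟩ := ih' hp.2
    refine ⟨s * t, fun h => (p.2.mem_or_mem _ _ h).elim hs ht, fun q hq => ⟨i ?_, j ?_⟩⟩
    · intro h
      apply hq
      rw [mul_comm]
      exact q.2.mul_mem t s h
    · exact fun h => hq (q.2.mul_mem s t h)
  | sUnion S _ ih =>
    obtain ⟨V, hV, hp⟩ := hp
    obtain ⟨s, hs, i⟩ := ih V hV hp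
    exact ⟨s, hs, i.trans (Set.subset_sUnion_of_mem hV)⟩

theorem PrimeIdeals.mem_basicOpen {s : A} {p : (MSpec A).space} :
    p ∈ PrimeIdeals.basicOpen s ↔ s ∈ (MSpec.prime p).compl := Iff.rfl

/-- The section `1 / s` over `D(s)`. -/
def MSpec.inv (s : A) : (MSpec A).sec (PrimeIdeals.basicOpen s) :=
  MSpec.ofVal (fun _ hp => Localization.mk 1 ⟨s, PrimeIdeals.mem_basicOpen.1 hp⟩)
    fun _ hp => ⟨_, hp, le_rfl, 1, s, fun _ hq => ⟨PrimeIdeals.mem_basicOpen.1 hq, rfl⟩⟩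

theorem MSpec.const_mul_inv (s : A) : MSpec.const A (PrimeIdeals.basicOpen s) s * MSpec.inv s = 1 :=
  MSpec.val_ext fun p hp => by
    rw [MSpec.val_mul, MSpec.val_const, MSpec.inv, MSpec.val_ofVal, MSpec.val_one,
      Localization.mk_mul, mul_one, one_mul]
    exact Localization.mk_self (⟨s, hp⟩ : (MSpec.prime p).compl)

theorem MSpec.isUnit_val {U : Opens (MSpec A).space} {p : (MSpec A).space} (hp : p ∈ U)
    {f : (MSpec A).sec U} (h : IsUnit (germ (MSpec A).sheaf hp f)) :
    IsUnit (MSpec.val f hp) := by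
  obtain ⟨t, ht⟩ := h.exists_right_inv
  obtain ⟨V, hV, t, rfl⟩ := exists_germ t
  have hx' : p ∈ U ⊓ V := ⟨hp, hV⟩
  refine IsUnit.of_mul_eq_one (MSpec.val t hV) ?_
  have := MSpec.val_eq_of_germ_eq hx' hx' (f := res (MSpec A).sheaf inf_le_left f *
    res (MSpec A).sheaf inf_le_right t) (g := 1) (by
      rw [MonoidedSpace.germ_mul, germ_res, germ_res, MonoidedSpace.germ_one, ht])
  rwa [MSpec.val_mul, MSpec.val_res, MSpec.val_res, MSpec.val_one] at this

/-- If `s / 1` has inverse `b / c`, then `d * s * b = d * c` for some `d ∉ p`. The right-hand side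
is not in `p`, so neither is `s`. -/
theorem MSpec.isUnit_mk {p : PrimeIdeals A} {s : A} (h : IsUnit (Localization.mk s (1 : p.compl))) :
    s ∉ p.1 := by
  obtain ⟨t, ht⟩ := h.exists_right_inv
  induction t using Localization.induction_on with
  | H y =>
    obtain ⟨b, c⟩ := y
    rw [Localization.mk_mul, ← Localization.mk_one, Localization.mk_eq_mk_iff,
      Localization.r_iff_exists] at ht
    obtain ⟨d, hd⟩ := ht
    intro hs
    simp only [OneMemClass.coe_one, one_mul, mul_one] at hd
    have h1 : (d : A) * (s * b) ∈ p.1 := by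
      refine p.2.mul_mem _ _ ?_
      rw [mul_comm]
      exact p.2.mul_mem _ _ hs
    rw [hd] at h1
    exact (d * c).2 h1

theorem MSpec.isUnit_germ_const {U : Opens (MSpec A).space} {p : (MSpec A).space} (hp : p ∈ U)
    (s : A) : IsUnit (germ (MSpec A).sheaf hp (MSpec.const A U s)) ↔ s ∉ (MSpec.prime p).1 := by
  constructor
  · intro h
    exact MSpec.isUnit_mk (MSpec.isUnit_val hp h)
  · intro hs
    have hps : p ∈ PrimeIdeals.basicOpen s := hs
    refine IsUnit.of_mul_eq_one (germ (MSpec A).sheaf hps (MSpec.inv s)) ?_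
    have hx' : p ∈ U ⊓ PrimeIdeals.basicOpen s := ⟨hp, hps⟩
    have e : germ (MSpec A).sheaf hp (MSpec.const A U s) =
        germ (MSpec A).sheaf hps (MSpec.const A (PrimeIdeals.basicOpen s) s) := by
      rw [← germ_res (inf_le_left : U ⊓ PrimeIdeals.basicOpen s ≤ U) hx',
        ← germ_res (inf_le_right : U ⊓ PrimeIdeals.basicOpen s ≤ _) hx', MSpec.res_const,
        MSpec.res_const]
    rw [e, ← MonoidedSpace.germ_mul, MSpec.const_mul_inv, MonoidedSpace.germ_one]

theorem MSpec.exists_frac {U : Opens (MSpec A).space} {p : (MSpec A).space} (hp : p ∈ U)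
    (f : (MSpec A).sec U) : ∃ (V : Opens (MSpec A).space) (_ : p ∈ V) (i : V ≤ U) (a s : A),
      (∀ q ∈ V, s ∉ (MSpec.prime q).1) ∧
        MSpec.const A V s * res (MSpec A).sheaf i f = MSpec.const A V a := by
  obtain ⟨V, hV, i, a, s, e⟩ := MSpec.exists_mk f hp
  refine ⟨V, hV, i, a, s, fun q hq => (e q hq).choose, MSpec.val_ext fun q hq => ?_⟩
  obtain ⟨hs, e⟩ := e q hq
  rw [MSpec.val_mul, MSpec.val_res, e, MSpec.val_const, MSpec.val_const, Localization.mk_mul,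
    one_mul, Localization.mk_eq_mk_iff, Localization.r_iff_exists]
  refine ⟨1, ?_⟩
  simp

/-- Stated for any `U` containing all points, because it is applied to the preimage of an open set
of an ambient space under an open immersion. -/
theorem MSpec.isChart {U : Opens (MSpec A).space} (hU : ∀ p, p ∈ U) :
    MonoidedSpace.IsChart U (MSpec.const A U) where
  zero_ne_one p hp e := by
    have := (MSpec.isUnit_germ_const hp 0).1 (by
      rw [map_zero, MonoidedSpace.germ_zero, e]
      exact isUnit_one)
    exact this p.2.zero_mem
  exists_frac p hp t := by
    obtain ⟨W, hW, f, rfl⟩ := exists_germ t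
    obtain ⟨V, hV, i, a, s, hs, e⟩ := MSpec.exists_frac hW f
    refine ⟨a, s, (MSpec.isUnit_germ_const hp s).2 (hs p hV), ?_⟩
    have e := congrArg (germ (MSpec A).sheaf hV) e
    have h : ∀ a, germ (MSpec A).sheaf hp (MSpec.const A U a) =
        germ (MSpec A).sheaf hV (MSpec.const A V a) := by
      intro a
      rw [← germ_res (fun q _ => hU q : V ≤ U) hV, MSpec.res_const]
    rw [h, h, ← e, MonoidedSpace.germ_mul, germ_res]
  exists_eq p hp a b e := by
    have e := MSpec.val_eq_of_germ_eq _ _ e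
    rw [MSpec.val_const, MSpec.val_const, Localization.mk_eq_mk_iff,
      Localization.r_iff_exists] at e
    obtain ⟨s, e⟩ := e
    exact ⟨s, (MSpec.isUnit_germ_const hp _).2 s.2, by simpa using e⟩
  exists_point q hq := ⟨(⟨q, hq⟩ : PrimeIdeals A), hU _, fun a => MSpec.isUnit_germ_const _ a⟩
  point_unique p q hp hq h := Subtype.ext (Set.ext fun a => not_iff_not.mp
    ((MSpec.isUnit_germ_const hp a).symm.trans ((h a).trans (MSpec.isUnit_germ_const hq a))))
  exists_basic p hp V hV := by
    obtain ⟨s, hs, i⟩ := PrimeIdeals.exists_basicOpen_le V p hV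
    exact ⟨s, (MSpec.isUnit_germ_const hp s).2 hs,
      fun z hz h => i ((MSpec.isUnit_germ_const hz s).1 h)⟩

end MSpecChart

end
end MonoidGeom

namespace MonoidGeom
noncomputable section
namespace MonoidedSpace

open Hom

/-! ### Transport of charts along open immersions -/

section OpenImmersion

variable {X Z : MonoidedSpace.{u}} {j : Hom Z X}

theorem Hom.isUnit_stalkMap {z : Z.space} {a : X.stalk (j.base z)} :
    IsUnit (j.stalkMap z a) ↔ IsUnit a := by
  refine ⟨fun h => ?_, fun h => h.map _⟩
  obtain ⟨U, hU, a, rfl⟩ := exists_germ a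
  rw [j.stalkMap_germ] at h
  exact j.isLocal z U hU a h

theorem Hom.IsOpenImmersion.exists_image (hj : j.IsOpenImmersion) (V : Opens Z.space) :
    ∃ W : Opens X.space, (W : Set X.space) ⊆ Set.range j.base ∧ ∀ z, j.base z ∈ W ↔ z ∈ V := by
  refine ⟨⟨j.base '' V, hj.isOpenEmbedding.isOpenMap _ V.2⟩, Set.image_subset_range _ _,
    fun z => ?_⟩
  exact hj.isOpenEmbedding.injective.mem_set_image

/-- Every neighbourhood of `z` is the preimage of an open subset of the image of `j`, over which `j`
is bijective on sections. -/
theorem Hom.IsOpenImmersion.stalkMap_bijective (hj : j.IsOpenImmersion) (z : Z.space) :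
    Function.Bijective (j.stalkMap z) := by
  constructor
  · intro a b e
    obtain ⟨U, hU, a, b, rfl, rfl⟩ := exists_germ₂ a b
    rw [j.stalkMap_germ, j.stalkMap_germ] at e
    obtain ⟨V, hV, i, _, e⟩ := germ_eq e
    obtain ⟨W, hW, k⟩ := hj.exists_image V
    have hWU : W ≤ U := by
      intro x hx
      obtain ⟨z', rfl⟩ := hW hx
      exact i ((k z').1 hx)
    have hWV : Opens.comap j.base W ≤ V := fun z' hz' => (k z').1 hz'
    have q : res X.sheaf hWU a = res X.sheaf hWU b := by
      refine (hj.bijective W hW).1 ?_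
      rw [j.app_res, j.app_res]
      have := congrArg (res Z.sheaf hWV) e
      rwa [res_res, res_res] at this
    have hx : j.base z ∈ W := (k z).2 hV
    rw [← germ_res hWU hx, q, germ_res]
  · intro t
    obtain ⟨V, hV, t, rfl⟩ := exists_germ t
    obtain ⟨W, hW, k⟩ := hj.exists_image V
    have hWV : Opens.comap j.base W ≤ V := fun z' hz' => (k z').1 hz'
    obtain ⟨s, hs⟩ := (hj.bijective W hW).2 (res Z.sheaf hWV t)
    refine ⟨germ X.sheaf ((k z).2 hV) s, ?_⟩
    rw [j.stalkMap_germ, hs, germ_res]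

/-- Charts of an open subspace are charts of the ambient space. -/
theorem IsChart.of_openImmersion (hj : j.IsOpenImmersion) {U : Opens X.space}
    (hU : Set.range j.base = U) {A : Type u} [CommMonoidWithZero A] {α : A →*₀ X.sec U}
    {β : A →*₀ Z.sec (Opens.comap j.base U)} (hαβ : ∀ a, j.app U (α a) = β a)
    (h : IsChart (Opens.comap j.base U) β) : IsChart U α := by
  have lift : ∀ x ∈ U, ∃ z, j.base z = x := fun x hx => by
    rwa [← SetLike.mem_coe, ← hU] at hx
  have hs : ∀ z (hz : j.base z ∈ U) a, j.stalkMap z (germ X.sheaf hz (α a)) =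
      germ Z.sheaf (Opens.mem_comap.mpr hz) (β a) := fun z hz a => by
    rw [j.stalkMap_germ, hαβ]
  have hu : ∀ z (hz : j.base z ∈ U) a, IsUnit (germ X.sheaf hz (α a)) ↔
      IsUnit (germ Z.sheaf (Opens.mem_comap.mpr hz) (β a)) := fun z hz a => by
    rw [← hs, isUnit_stalkMap]
  constructor
  · intro x hx e
    obtain ⟨z, rfl⟩ := lift x hx
    apply h.zero_ne_one z hx
    rw [← map_zero (j.stalkMap z), e, map_one]
  · intro x hx t
    obtain ⟨z, rfl⟩ := lift x hx
    obtain ⟨a, s, h1, h2⟩ := h.exists_frac z hx (j.stalkMap z t)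
    refine ⟨a, s, (hu z hx s).2 h1, (hj.stalkMap_bijective z).1 ?_⟩
    rw [map_mul, hs, hs, h2]
  · intro x hx a b e
    obtain ⟨z, rfl⟩ := lift x hx
    obtain ⟨s, h1, h2⟩ := h.exists_eq z hx a b (by rw [← hs z hx, e, hs])
    exact ⟨s, (hu z hx s).2 h1, h2⟩
  · intro q hq
    obtain ⟨z, hz, k⟩ := h.exists_point q hq
    exact ⟨j.base z, hz, fun a => (hu z hz a).trans (k a)⟩
  · intro x y hx hy k
    obtain ⟨z, rfl⟩ := lift x hx
    obtain ⟨w, rfl⟩ := lift y hy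
    rw [h.point_unique z w hx hy fun a => by rw [← hu z hx, k, hu w hy]]
  · intro x hx V hV
    obtain ⟨z, rfl⟩ := lift x hx
    obtain ⟨s, h1, h2⟩ := h.exists_basic z hx (Opens.comap j.base V) hV
    refine ⟨s, (hu z hx s).2 h1, fun y hy hys => ?_⟩
    obtain ⟨w, rfl⟩ := lift y hy
    exact h2 w hy ((hu w hy s).1 hys)

end OpenImmersion

/-! ### Affine open subspaces have charts, and open subspaces with charts are affine -/

variable {X : MonoidedSpace.{u}} {U : Opens X.space}

/-- The standard chart of `MSpec A`, carried over by the open immersion, is a chart `A → X.sec U`. A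
chart is bijective, so `A` may be replaced by `X.sec U`. -/
theorem IsAffineOpen.isChart (h : X.IsAffineOpen U) :
    IsChart U (MonoidWithZeroHom.id (X.sec U)) := by
  obtain ⟨A, _, j, hj, hU⟩ := h
  let e : X.sec U ≃* (MSpec A).sec (Opens.comap j.base U) :=
    MulEquiv.ofBijective (j.app U) (hj.bijective U hU.ge)
  let α : A →*₀ X.sec U := ({ (e.symm : _ →* X.sec U) with map_zero' := map_zero e.symm } : _ →*₀ X.sec U).comp
    (MSpec.const A (Opens.comap j.base U))
  have hα : IsChart U α := by
    refine IsChart.of_openImmersion hj hU (β := MSpec.const A (Opens.comap j.base U))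
      (fun a => ?_) (MSpec.isChart fun p => ?_)
    · exact e.apply_symm_apply _
    · change j.base p ∈ (U : Set X.space)
      rw [← hU]
      exact Set.mem_range_self p
  exact hα.comp_surjective α (fun _ => rfl) hα.bijective.2

namespace IsChart

variable {A : Type u} [CommMonoidWithZero A] {α : A →*₀ X.sec U}

/-- The point corresponding to a prime ideal. -/
def pt (h : IsChart U α) (p : (MSpec A).space) : X.space :=
  (h.exists_point (MSpec.prime p).1 (MSpec.prime p).2).choose

theorem pt_mem (h : IsChart U α) (p : (MSpec A).space) : h.pt p ∈ U :=
  (h.exists_point (MSpec.prime p).1 (MSpec.prime p).2).choose_spec.choose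

theorem isUnit_pt (h : IsChart U α) (p : (MSpec A).space) (a : A) :
    IsUnit (germ X.sheaf (h.pt_mem p) (α a)) ↔ a ∈ (MSpec.prime p).compl :=
  (h.exists_point (MSpec.prime p).1 (MSpec.prime p).2).choose_spec.choose_spec a

theorem exists_pt (h : IsChart U α) {x : X.space} (hx : x ∈ U) : ∃ p, h.pt p = x := by
  let p : (MSpec A).space := (⟨_, h.isPrimeIdeal hx⟩ : PrimeIdeals A)
  refine ⟨p, h.point_unique _ _ (h.pt_mem p) hx fun a => (h.isUnit_pt p a).trans ?_⟩
  exact not_not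

theorem pt_injective (h : IsChart U α) : Function.Injective h.pt := by
  intro p q e
  refine Subtype.ext (Set.ext fun a => not_iff_not.mp ?_)
  refine (h.isUnit_pt p a).symm.trans (Iff.trans ?_ (h.isUnit_pt q a))
  have : ∀ x y (hx : x ∈ U) (hy : y ∈ U), x = y →
      (IsUnit (germ X.sheaf hx (α a)) ↔ IsUnit (germ X.sheaf hy (α a))) := by
    rintro x _ hx hy rfl
    rfl
  exact this _ _ _ _ e

/-- The map `MSpec A → X` of a chart. -/
def base (h : IsChart U α) : C((MSpec A).space, X.space) where
  toFun := h.pt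
  continuous_toFun := by
    refine continuous_def.2 fun V hV => isOpen_iff_forall_mem_open.2 fun p hp => ?_
    obtain ⟨s, hs, k⟩ := h.exists_basic (h.pt p) (h.pt_mem p) ⟨V, hV⟩ hp
    refine ⟨PrimeIdeals.basicOpen s, fun q hq => ?_, (PrimeIdeals.basicOpen s).2,
      (h.isUnit_pt p s).1 hs⟩
    exact k _ (h.pt_mem q) ((h.isUnit_pt q s).2 hq)

theorem pt_mem_of_mem_comap (h : IsChart U α) {V : Opens X.space} {p : (MSpec A).space}
    (hp : p ∈ Opens.comap h.base V) : h.pt p ∈ V := hp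

/-- The stalks as localizations. -/
def localizationMap (h : IsChart U α) (p : (MSpec A).space) :
    (MSpec.prime p).compl.LocalizationMap (X.stalk (h.pt p)) where
  toMulHom := (((germHom (h.pt_mem p)).comp α : A →*₀ _) : A →* X.stalk (h.pt p)).toMulHom
  isLocalizationMap :=
    { map_units := fun s => (h.isUnit_pt p s).2 s.2
      surj := fun t => by
        obtain ⟨a, s, h1, h2⟩ := h.exists_frac _ (h.pt_mem p) t
        exact ⟨⟨a, ⟨s, (h.isUnit_pt p s).1 h1⟩⟩, (mul_comm _ _).trans h2⟩
      exists_of_eq := fun {a b} e => by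
        obtain ⟨s, h1, h2⟩ := h.exists_eq _ (h.pt_mem p) a b e
        exact ⟨⟨s, (h.isUnit_pt p s).1 h1⟩, h2⟩ }

/-- The isomorphisms from the localizations to the stalks. -/
def stalkEquiv (h : IsChart U α) (p : (MSpec A).space) :
    Localization (MSpec.prime p).compl ≃* X.stalk (h.pt p) :=
  Localization.mulEquivOfQuotient (h.localizationMap p)

theorem stalkEquiv_mk_eq_iff (h : IsChart U α) (p : (MSpec A).space) (a : A)
    (s : (MSpec.prime p).compl) (t : X.stalk (h.pt p)) :
    h.stalkEquiv p (Localization.mk a s) = t ↔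
      germ X.sheaf (h.pt_mem p) (α s) * t = germ X.sheaf (h.pt_mem p) (α a) := by
  rw [stalkEquiv, Localization.mulEquivOfQuotient_mk, Submonoid.LocalizationMap.mk'_eq_iff_eq_mul,
    mul_comm, eq_comm]
  rfl

/-- The map on sections of the morphism `MSpec A → X` of a chart. -/
def appFun (h : IsChart U α) (V : Opens X.space) (f : X.sec V) :
    (MSpec A).sec (Opens.comap h.base V) :=
  MSpec.ofVal (fun p hp => (h.stalkEquiv p).symm (germ X.sheaf (Opens.mem_comap.mp hp) f)) (by
    intro p hp
    have hpV : h.pt p ∈ V := hp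
    obtain ⟨a, s, h1, h2⟩ := h.exists_frac _ (h.pt_mem p) (germ X.sheaf hpV f)
    have hx : h.pt p ∈ U ⊓ V := ⟨h.pt_mem p, hpV⟩
    have e : germ X.sheaf hx (res X.sheaf inf_le_left (α s) * res X.sheaf inf_le_right f) =
        germ X.sheaf hx (res X.sheaf inf_le_left (α a)) := by
      rw [germ_mul, germ_res, germ_res, germ_res, h2]
    obtain ⟨W, hW, i, _, e⟩ := germ_eq e
    refine ⟨Opens.comap h.base W ⊓ PrimeIdeals.basicOpen s,
      ⟨hW, (h.isUnit_pt p s).1 h1⟩, fun q hq => (i hq.1).2, a, s, fun q hq => ?_⟩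
    refine ⟨hq.2, ?_⟩
    rw [MulEquiv.symm_apply_eq, eq_comm, stalkEquiv_mk_eq_iff]
    have hqW : h.pt q ∈ W := hq.1
    have e := congrArg (germ X.sheaf hqW) e
    rwa [germ_res, germ_res, germ_mul, germ_res, germ_res, germ_res] at e)

theorem val_appFun (h : IsChart U α) (V : Opens X.space) (f : X.sec V) {p : (MSpec A).space}
    (hp : h.pt p ∈ V) : MSpec.val (h.appFun V f) (Opens.mem_comap.mpr hp) =
      (h.stalkEquiv p).symm (germ X.sheaf hp f) := rfl

/-- The morphism `MSpec A → X` of a chart. -/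
def hom (h : IsChart U α) : Hom (MSpec A) X where
  base := h.base
  app V :=
    { toFun := h.appFun V
      map_zero' := MSpec.val_ext fun p hp => by
        refine (h.val_appFun V 0 (h.pt_mem_of_mem_comap hp)).trans ?_
        rw [germ_zero, MSpec.val_zero, MulEquiv.symm_apply_eq]
        exact (map_zero (h.stalkEquiv p)).symm
      map_one' := MSpec.val_ext fun p hp => by
        refine (h.val_appFun V 1 (h.pt_mem_of_mem_comap hp)).trans ?_
        rw [germ_one, MSpec.val_one, map_one]
      map_mul' := fun a b => MSpec.val_ext fun p hp => by
        refine (h.val_appFun V (a * b) (h.pt_mem_of_mem_comap hp)).trans ?_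
        rw [germ_mul, MSpec.val_mul, map_mul]
        rfl }
  app_res {V W} k s := MSpec.val_ext fun p hp => by
    refine (h.val_appFun W _ (h.pt_mem_of_mem_comap hp)).trans ?_
    rw [germ_res]
    rfl
  isLocal p V hp s hs := by
    have := MSpec.isUnit_val _ hs
    have := this.map (h.stalkEquiv p)
    change IsUnit (h.stalkEquiv p ((h.stalkEquiv p).symm (germ X.sheaf hp s))) at this
    rwa [MulEquiv.apply_symm_apply] at this

theorem range_hom (h : IsChart U α) : Set.range h.hom.base = U :=
  Set.ext fun x => ⟨by rintro ⟨p, rfl⟩; exact h.pt_mem p, fun hx => h.exists_pt hx⟩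

/-- Both sheaves consist of families of elements of the stalks, and the stalks are identified by
`stalkEquiv`. What remains is that locally a fraction `a / s` on `MSpec A` is a section of `𝒜` on
`X`, namely the product of `α a` with an inverse of `α s`. -/
theorem isOpenImmersion (h : IsChart U α) : h.hom.IsOpenImmersion where
  isOpenEmbedding := by
    refine .of_continuous_injective_isOpenMap h.base.continuous h.pt_injective fun V hV => ?_
    refine isOpen_iff_forall_mem_open.2 ?_
    rintro _ ⟨p, hp, rfl⟩
    obtain ⟨s, hs, k⟩ := PrimeIdeals.exists_basicOpen_le ⟨V, hV⟩ p hp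
    -- The image of `D(s)` is the locus in `U` where `α s` is invertible, and invertibility is an
    -- open condition.
    obtain ⟨W, hW, i, hu⟩ := isUnit_germ_near (h.pt_mem p) (α s) ((h.isUnit_pt p s).2 hs)
    refine ⟨W, fun x hx => ?_, W.2, hW⟩
    obtain ⟨q, rfl⟩ := h.exists_pt (i hx)
    exact ⟨q, k ((h.isUnit_pt q s).1 (hu _ hx)), rfl⟩
  bijective V hV := by
    have lift : ∀ x ∈ V, ∃ p, h.pt p = x := fun x hx => hV hx
    have hVU : V ≤ U := fun x hx => by
      obtain ⟨p, rfl⟩ := lift x hx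
      exact h.pt_mem p
    constructor
    · intro f g e
      refine sec_ext fun x hx => ?_
      obtain ⟨p, rfl⟩ := lift x hx
      refine (h.stalkEquiv p).symm.injective ?_
      rw [← h.val_appFun V f hx, ← h.val_appFun V g hx]
      exact congrArg (fun f : (MSpec A).sec (Opens.comap h.base V) =>
        MSpec.val f (Opens.mem_comap.mpr hx)) e
    · intro f
      -- The values of `f` are moved to the points of `X`. Injectivity of `h.pt` makes this
      -- consistent, and the value `0` outside `V` plays no role.
      have fam : ∀ x : X.space, ∃ t : X.stalk x, ∀ p (e : h.pt p = x)
          (hp : p ∈ Opens.comap h.base V),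
          (h.stalkEquiv p).symm (e ▸ t) = MSpec.val f hp := by
        intro x
        by_cases hx : x ∈ V
        · obtain ⟨p, rfl⟩ := lift x hx
          refine ⟨h.stalkEquiv p (MSpec.val f (Opens.mem_comap.mpr hx)), fun q e hq => ?_⟩
          obtain rfl := h.pt_injective e
          exact (h.stalkEquiv q).symm_apply_apply _
        · refine ⟨0, ?_⟩
          rintro p rfl hp
          exact absurd (Opens.mem_comap.mp hp) hx
      choose t ht using fam
      have ht' : ∀ p (hp : h.pt p ∈ V),
          t (h.pt p) = h.stalkEquiv p (MSpec.val f (Opens.mem_comap.mpr hp)) := fun p hp =>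
        ((h.stalkEquiv p).symm_apply_eq).1 (ht _ p rfl hp)
      obtain ⟨g, hg⟩ := exists_sec (F := X.sheaf) (U := V) (fun x _ => t x) (by
        intro x hx
        obtain ⟨p, rfl⟩ := lift x hx
        obtain ⟨V', hV', i, a, s, e⟩ := MSpec.exists_mk f (Opens.mem_comap.mpr hx)
        obtain ⟨s', hs', k⟩ := PrimeIdeals.exists_basicOpen_le V' p hV'
        obtain ⟨W₁, hW₁, i₁, hu₁⟩ :=
          isUnit_germ_near (h.pt_mem p) (α s') ((h.isUnit_pt p s').2 hs')
        have hW₁' : ∀ q, h.pt q ∈ W₁ → q ∈ V' := fun q hq =>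
          k ((h.isUnit_pt q s').1 (hu₁ _ hq))
        have hW₁V : W₁ ≤ V := fun x hx => by
          obtain ⟨q, rfl⟩ := h.exists_pt (i₁ hx)
          exact i (hW₁' q hx)
        -- On `W₁` the denominator `α s` has invertible germs, hence an inverse `v`, and `v * α a`
        -- realizes the fraction.
        obtain ⟨v, hv⟩ := (isUnit_of_germ (res X.sheaf i₁ (α s)) fun x hx => by
          rw [germ_res]
          obtain ⟨q, rfl⟩ := h.exists_pt (i₁ hx)
          exact (h.isUnit_pt q s).2 (e q (hW₁' q hx)).choose).exists_right_inv
        refine ⟨W₁, hW₁, hW₁V, v * res X.sheaf i₁ (α a), fun x hx => ?_⟩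
        obtain ⟨q, rfl⟩ := h.exists_pt (i₁ hx)
        obtain ⟨hs, e⟩ := e q (hW₁' q hx)
        rw [ht' q (hW₁V hx), e, eq_comm, stalkEquiv_mk_eq_iff, germ_mul, germ_res, ← mul_assoc]
        have hv := congrArg (germ X.sheaf hx) hv
        rw [germ_mul, germ_res, germ_one] at hv
        rw [hv, one_mul])
      refine ⟨g, MSpec.val_ext fun p hp => ?_⟩
      refine (h.val_appFun V g (h.pt_mem_of_mem_comap hp)).trans ?_
      rw [hg _ (h.pt_mem_of_mem_comap hp), ht' p (h.pt_mem_of_mem_comap hp),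
        MulEquiv.symm_apply_apply]

/-- An open subspace with a chart is affine. -/
theorem isAffineOpen (h : IsChart U α) : X.IsAffineOpen U :=
  ⟨A, _, h.hom, h.isOpenImmersion, h.range_hom⟩

end IsChart

end MonoidedSpace
end
end MonoidGeom

namespace MonoidGeom
noncomputable section

/-! ## Homomorphisms which are bijective up to powers -/

section PowerEquiv

variable {A B : Type u} [CommMonoidWithZero A] [CommMonoidWithZero B]

/-- A homomorphism which is surjective up to large powers and injective up to powers. -/
structure IsPowerEquiv (φ : A →*₀ B) : Prop where
  pow_mem : ∀ b : B, ∃ N : ℕ, ∀ n ≥ N, b ^ n ∈ Set.range φ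
  pow_eq : ∀ a a' : A, φ a = φ a' → ∃ k : ℕ, 0 < k ∧ a ^ k = a' ^ k

theorem IsPrimeIdeal.pow_mem_iff {p : Set A} (hp : IsPrimeIdeal p) {n : ℕ} (hn : 0 < n) {a : A} :
    a ^ n ∈ p ↔ a ∈ p := by
  constructor
  · clear hn
    induction n with
    | zero =>
      intro h
      rw [pow_zero] at h
      exact absurd h hp.one_notMem
    | succ n ih =>
      intro h
      rw [pow_succ] at h
      exact (hp.mem_or_mem _ _ h).elim ih id
  · intro h
    obtain ⟨k, rfl⟩ := Nat.exists_eq_succ_of_ne_zero hn.ne'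
    rw [pow_succ]
    exact hp.mul_mem _ _ h

theorem IsMonoidSeminormalization.isPowerEquiv {φ : A →*₀ B} (h : IsMonoidSeminormalization φ) :
    IsPowerEquiv φ where
  pow_mem := h.pow_mem
  pow_eq a a' e := by
    obtain rfl | ⟨⟨n, hn⟩, m, hm⟩ := (h.injective_red a a').1 e
    · exact ⟨1, one_pos, rfl⟩
    -- A positive exponent at which both nilpotent elements vanish.
    · refine ⟨n + m + 1, Nat.succ_pos _, ?_⟩
      rw [pow_succ, pow_add, hn, zero_mul, zero_mul, pow_succ, pow_add, hm, mul_zero, zero_mul]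

namespace IsPowerEquiv

variable {φ : A →*₀ B}

theorem exists_pow (h : IsPowerEquiv φ) (b : B) : ∃ n : ℕ, 0 < n ∧ ∃ a, φ a = b ^ n := by
  obtain ⟨N, hN⟩ := h.pow_mem b
  exact ⟨N + 1, N.succ_pos, hN _ N.le_succ⟩

/-- Membership of `b` in a prime ideal is decided by a positive power of `b` lying in the image of
`φ`. -/
theorem prime_unique (h : IsPowerEquiv φ) {q q' : Set B} (hq : IsPrimeIdeal q)
    (hq' : IsPrimeIdeal q') (e : ∀ a, φ a ∈ q ↔ φ a ∈ q') : q = q' := by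
  ext b
  obtain ⟨n, hn, a, ha⟩ := h.exists_pow b
  rw [← hq.pow_mem_iff hn, ← hq'.pow_mem_iff hn, ← ha, e]

/-- The prime over `p` consists of the elements some positive power of which is the image of an
element of `p`. -/
theorem exists_prime (h : IsPowerEquiv φ) {p : Set A} (hp : IsPrimeIdeal p) :
    ∃ q : Set B, IsPrimeIdeal q ∧ ∀ a, φ a ∈ q ↔ a ∈ p := by
  -- Elements with the same image have a common positive power, so `p` is a union of fibres of `φ`.
  have mem : ∀ a a', φ a = φ a' → a' ∈ p → a ∈ p := by
    intro a a' e ha'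
    obtain ⟨k, hk, e⟩ := h.pow_eq a a' e
    rw [← hp.pow_mem_iff hk, e]
    exact (hp.pow_mem_iff hk).2 ha'
  refine ⟨{b | ∃ n > 0, ∃ a ∈ p, φ a = b ^ n}, ⟨⟨?_, ?_⟩, ?_, ?_⟩, fun a => ⟨?_, ?_⟩⟩
  · exact ⟨1, one_pos, 0, hp.zero_mem, by rw [map_zero, pow_one]⟩
  · rintro c b ⟨n, hn, a, ha, e⟩
    obtain ⟨m, hm, a', e'⟩ := h.exists_pow c
    refine ⟨n * m, Nat.mul_pos hn hm, a' ^ n * a ^ m,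
      hp.mul_mem _ _ ((hp.pow_mem_iff hm).2 ha), ?_⟩
    rw [map_mul, map_pow, map_pow, e, e', mul_pow, ← pow_mul, ← pow_mul, mul_comm m n]
  · rintro ⟨n, -, a, ha, e⟩
    rw [one_pow, ← map_one φ] at e
    exact hp.one_notMem (mem 1 a e.symm ha)
  · rintro b c ⟨n, hn, a, ha, e⟩
    obtain ⟨m, hm, b', eb⟩ := h.exists_pow b
    obtain ⟨k, hk, c', ec⟩ := h.exists_pow c
    -- The powers `b ^ m`, `c ^ k` and `(b * c) ^ n` lie in the image; passing to the common
    -- exponent `m * k * n` gives this product the same image as `a ^ (m * k)`.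
    have : b' ^ (k * n) * c' ^ (m * n) ∈ p := by
      refine mem _ (a ^ (m * k)) ?_ ((hp.pow_mem_iff (Nat.mul_pos hm hk)).2 ha)
      rw [map_mul, map_pow, map_pow, map_pow, eb, ec, e, mul_pow, mul_pow, ← pow_mul, ← pow_mul,
        ← pow_mul, ← pow_mul]
      congr 2 <;> ring
    rcases hp.mem_or_mem _ _ this with h1 | h1
    · exact Or.inl ⟨m, hm, b', (hp.pow_mem_iff (Nat.mul_pos hk hn)).1 h1, eb⟩
    · exact Or.inr ⟨k, hk, c', (hp.pow_mem_iff (Nat.mul_pos hm hn)).1 h1, ec⟩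
  · rintro ⟨n, hn, a', ha', e⟩
    rw [← map_pow] at e
    exact (hp.pow_mem_iff hn).1 (mem _ _ e.symm ha')
  · intro ha
    exact ⟨1, one_pos, a, ha, (pow_one _).symm⟩

end IsPowerEquiv

end PowerEquiv

/-! ### Seminormalizations are homeomorphisms and identify the units of the stalks -/

namespace MonoidedSpace.Hom

variable {X Y : MonoidedSpace.{u}} {p : Hom Y X}

theorem isUnit_germ_app {U : Opens X.space} {y : Y.space} (hy : p.base y ∈ U) (a : X.sec U) :
    IsUnit (germ Y.sheaf (Opens.mem_comap.mpr hy) (p.app U a)) ↔ IsUnit (germ X.sheaf hy a) := by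
  rw [← p.stalkMap_germ, isUnit_stalkMap]

section Chart

variable {U : Opens X.space}

theorem injective_of_chart
    (hV : IsChart (Opens.comap p.base U) (MonoidWithZeroHom.id (Y.sec (Opens.comap p.base U))))
    (hφ : IsPowerEquiv (p.app U)) {y y' : Y.space} (hy : p.base y ∈ U)
    (e : p.base y = p.base y') : y = y' := by
  have hy' : p.base y' ∈ U := e ▸ hy
  have key : ∀ x x' (hx : x ∈ U) (hx' : x' ∈ U) (a : X.sec U), x = x' →
      (IsUnit (germ X.sheaf hx a) ↔ IsUnit (germ X.sheaf hx' a)) := by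
    rintro x _ hx hx' a rfl
    rfl
  refine hV.point_unique y y' hy hy' fun b => ?_
  have := hφ.prime_unique (hV.isPrimeIdeal (x := y) hy) (hV.isPrimeIdeal (x := y') hy')
    fun a => not_congr ((isUnit_germ_app hy a).trans
      ((key _ _ hy hy' a e).trans (isUnit_germ_app hy' a).symm))
  exact not_iff_not.1 (Set.ext_iff.1 this b)

theorem surjective_of_chart
    (hU : IsChart U (MonoidWithZeroHom.id (X.sec U)))
    (hV : IsChart (Opens.comap p.base U) (MonoidWithZeroHom.id (Y.sec (Opens.comap p.base U))))
    (hφ : IsPowerEquiv (p.app U)) {x : X.space} (hx : x ∈ U) :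
    ∃ y, p.base y = x := by
  obtain ⟨q, hq, k⟩ := hφ.exists_prime (hU.isPrimeIdeal hx)
  obtain ⟨y, hy, hyq⟩ := hV.exists_point q hq
  refine ⟨y, hU.point_unique _ _ (Opens.mem_comap.mp hy) hx fun a => ?_⟩
  refine (isUnit_germ_app (Opens.mem_comap.mp hy) a).symm.trans ((hyq _).trans ?_)
  exact (not_congr (k a)).trans not_not

/-- `D(s) = D(s ^ n)`, and some positive power `s ^ n` comes from a section `a` on `X`, whose locus
of invertibility is the required open set. -/
theorem exists_comap_le_of_chart
    (hV : IsChart (Opens.comap p.base U) (MonoidWithZeroHom.id (Y.sec (Opens.comap p.base U))))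
    (hφ : IsPowerEquiv (p.app U)) {y : Y.space} (hy : p.base y ∈ U)
    (V : Opens Y.space) (hyV : y ∈ V) :
    ∃ W : Opens X.space, p.base y ∈ W ∧ Opens.comap p.base W ≤ V := by
  obtain ⟨s, hs, k⟩ := hV.exists_basic y hy V hyV
  obtain ⟨n, hn, a, ha⟩ := hφ.exists_pow s
  have pow : ∀ z (hz : p.base z ∈ U),
      IsUnit (germ Y.sheaf (Opens.mem_comap.mpr hz) s) ↔ IsUnit (germ X.sheaf hz a) := by
    intro z hz
    rw [← isUnit_germ_app hz, ha]
    have := map_pow (germHom (Opens.mem_comap.mpr hz)) s n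
    change germ Y.sheaf _ (s ^ n) = germ Y.sheaf _ s ^ n at this
    rw [this, isUnit_pow_iff hn.ne']
  obtain ⟨W, hW, i, hu⟩ := isUnit_germ_near hy a ((pow y hy).1 hs)
  exact ⟨W, hW, fun z hz => k z (i hz) ((pow z (i hz)).2 (hu _ hz))⟩

/-- Clearing denominators turns the equality of images into an equality `φ (r * (a * s')) = φ (r *
(a' * s))` between sections. Either the arguments agree, which gives `u = v`, or they are nilpotent,
which is impossible as the germ of the first is a unit. -/
theorem eq_of_isUnit_of_chart
    (hU : IsChart U (MonoidWithZeroHom.id (X.sec U)))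
    (hV : IsChart (Opens.comap p.base U) (MonoidWithZeroHom.id (Y.sec (Opens.comap p.base U))))
    (hφ : IsMonoidSeminormalization (p.app U)) {y : Y.space} (hy : p.base y ∈ U) {u v : X.stalk (p.base y)} (hu : IsUnit u)
    (e : p.stalkMap y u = p.stalkMap y v) : u = v := by
  have hyV := Opens.mem_comap.mpr hy
  let γ : X.sec U →*₀ X.stalk (p.base y) := germHom hy
  let δ : Y.sec (Opens.comap p.base U) →*₀ Y.stalk y := germHom hyV
  have hδ : ∀ a, δ (p.app U a) = p.stalkMap y (γ a) := fun a => (p.stalkMap_germ y hy a).symm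
  obtain ⟨a, s, hs, e1⟩ := hU.exists_frac _ hy u
  obtain ⟨a', s', hs', e2⟩ := hU.exists_frac _ hy v
  change IsUnit (γ s) at hs
  change IsUnit (γ s') at hs'
  change γ s * u = γ a at e1
  change γ s' * v = γ a' at e2
  obtain ⟨t, ht, e3⟩ := hV.exists_eq y hyV (p.app U (a * s')) (p.app U (a' * s)) (by
    change δ (p.app U (a * s')) = δ (p.app U (a' * s))
    rw [hδ, hδ, map_mul γ, map_mul γ, ← e1, ← e2]
    simp only [map_mul, e]
    ac_rfl)
  change IsUnit (δ t) at ht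
  -- The factor `t` witnessing equality of fractions lives on `Y`; a power of it serves as well and
  -- comes from `r` on `X`.
  obtain ⟨n, hn, r, hr⟩ := hφ.isPowerEquiv.exists_pow t
  have hru : IsUnit (γ r) := by
    rw [← isUnit_stalkMap, ← hδ, hr, map_pow]
    exact ht.pow n
  have e4 : p.app U (r * (a * s')) = p.app U (r * (a' * s)) := by
    obtain ⟨m, rfl⟩ := Nat.exists_eq_succ_of_ne_zero hn.ne'
    rw [map_mul, map_mul (p.app U) r, hr, pow_succ, mul_assoc, e3, mul_assoc]
  rcases (hφ.injective_red _ _).1 e4 with e5 | ⟨⟨k, hk⟩, -⟩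
  · have e5 := congrArg γ e5
    simp only [map_mul, ← e1, ← e2] at e5
    refine ((hru.mul hs).mul hs').mul_left_cancel ?_
    calc γ r * γ s * γ s' * u = γ r * (γ s * u * γ s') := by ac_rfl
      _ = _ := e5
      _ = _ := by ac_rfl
  · exfalso
    have h0 : IsUnit (γ (r * (a * s'))) := by
      rw [map_mul, map_mul, ← e1]
      exact hru.mul ((hs.mul hu).mul hs')
    have h1 := h0.pow k
    rw [← map_pow, hk, map_zero, isUnit_zero_iff] at h1
    exact hU.zero_ne_one _ hy h1

/-- Write `b = β / σ`. Then `b = b ^ (n + 1) / b ^ n = (β ^ (n + 1) * σ ^ n) / (σ ^ (n + 1) * β ^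
n)`, and for large `n` all four powers are images of sections on `X`, whose germs are units because
`p` is local. -/
theorem exists_isUnit_of_chart
    (hV : IsChart (Opens.comap p.base U) (MonoidWithZeroHom.id (Y.sec (Opens.comap p.base U))))
    (hφ : IsPowerEquiv (p.app U)) {y : Y.space} (hy : p.base y ∈ U) {b : Y.stalk y} (hb : IsUnit b) :
    ∃ u : X.stalk (p.base y), IsUnit u ∧ p.stalkMap y u = b := by
  have hyV := Opens.mem_comap.mpr hy
  let γ : X.sec U →*₀ X.stalk (p.base y) := germHom hy
  let δ : Y.sec (Opens.comap p.base U) →*₀ Y.stalk y := germHom hyV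
  have hδ : ∀ a, δ (p.app U a) = p.stalkMap y (γ a) := fun a => (p.stalkMap_germ y hy a).symm
  obtain ⟨β, σ, hσ, e⟩ := hV.exists_frac y hyV b
  change IsUnit (δ σ) at hσ
  change δ σ * b = δ β at e
  obtain ⟨N, hN⟩ := hφ.pow_mem β
  obtain ⟨M, hM⟩ := hφ.pow_mem σ
  -- The exponent `n = N + M` is large enough for both `β` and `σ`.
  obtain ⟨a, ha⟩ := hN (N + M) (by omega)
  obtain ⟨a', ha'⟩ := hN (N + M + 1) (by omega)
  obtain ⟨c, hc⟩ := hM (N + M) (by omega)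
  obtain ⟨c', hc'⟩ := hM (N + M + 1) (by omega)
  have hβ : IsUnit (δ β) := e ▸ hσ.mul hb
  have unit : ∀ {a} {β} (n : ℕ), IsUnit (δ β) → p.app U a = β ^ n → IsUnit (γ a) := by
    intro a β n hβ h
    rw [← isUnit_stalkMap, ← hδ, h, map_pow]
    exact hβ.pow n
  obtain ⟨w, hw⟩ := ((unit _ hσ hc').mul (unit _ hβ ha)).exists_left_inv
  refine ⟨w * (γ a' * γ c), (IsUnit.of_mul_eq_one _ hw).mul
    ((unit _ hβ ha').mul (unit _ hσ hc)), ?_⟩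
  have key : p.stalkMap y (γ a' * γ c) = p.stalkMap y (γ c' * γ a) * b := by
    rw [map_mul, map_mul, ← hδ, ← hδ, ← hδ, ← hδ, ha, ha', hc, hc']
    simp only [map_pow, ← e]
    generalize δ σ = s
    rw [pow_succ (s * b), pow_succ s]
    ac_rfl
  rw [map_mul, key, ← mul_assoc, ← map_mul, hw, map_one, one_mul]

end Chart

theorem IsSeminormalization.isUnitEquiv (hp : p.IsSeminormalization) : p.IsUnitEquiv where
  bijective := by
    constructor
    · intro y y' e
      obtain ⟨U, hU, h1, h2, h3⟩ := hp (p.base y)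
      exact injective_of_chart h2.isChart h3.isPowerEquiv hU e
    · intro x
      obtain ⟨U, hU, h1, h2, h3⟩ := hp x
      exact surjective_of_chart h1.isChart h2.isChart h3.isPowerEquiv hU
  exists_comap_le y V hV := by
    obtain ⟨U, hU, -, h2, h3⟩ := hp (p.base y)
    exact exists_comap_le_of_chart h2.isChart h3.isPowerEquiv hU V hV
  eq_of_isUnit y a b ha _ e := by
    obtain ⟨U, hU, h1, h2, h3⟩ := hp (p.base y)
    exact eq_of_isUnit_of_chart h1.isChart h2.isChart h3 hU ha e
  exists_isUnit y b hb := by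
    obtain ⟨U, hU, -, h2, h3⟩ := hp (p.base y)
    exact exists_isUnit_of_chart h2.isChart h3.isPowerEquiv hU hb

end MonoidedSpace.Hom
end
end MonoidGeom

namespace MonoidGeom
noncomputable section

/-! ## The seminormalization of a pointed monoid -/

section PowerSequences

variable {A B C : Type u} [CommMonoidWithZero A] [CommMonoidWithZero B] [CommMonoidWithZero C]

/-- A sequence which behaves like the sequence of the large powers of an element. -/
def IsPowerSeq (a : ℕ → A) : Prop := ∃ N, ∀ m ≥ N, ∀ n ≥ N, a (m + n) = a m * a n

theorem IsPowerSeq.mul {a b : ℕ → A} (ha : IsPowerSeq a) (hb : IsPowerSeq b) :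
    IsPowerSeq (a * b) := by
  obtain ⟨N, ha⟩ := ha
  obtain ⟨M, hb⟩ := hb
  refine ⟨N + M, fun m hm n hn => ?_⟩
  rw [Pi.mul_apply, ha m (by omega) n (by omega), hb m (by omega) n (by omega), mul_mul_mul_comm]
  rfl

theorem isPowerSeq_zero : IsPowerSeq fun _ => (0 : A) := ⟨0, fun _ _ _ _ => (mul_zero 0).symm⟩

theorem isPowerSeq_one : IsPowerSeq fun _ => (1 : A) := ⟨0, fun _ _ _ _ => (mul_one 1).symm⟩

theorem isPowerSeq_pow (a : A) : IsPowerSeq fun n => a ^ n := ⟨0, fun m _ n _ => pow_add a m n⟩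

theorem IsPowerSeq.map {a : ℕ → A} (ha : IsPowerSeq a) (φ : A →*₀ B) :
    IsPowerSeq (φ ∘ a) := by
  obtain ⟨N, ha⟩ := ha
  exact ⟨N, fun m hm n hn => by
    rw [Function.comp_apply, ha m hm n hn, map_mul, Function.comp_apply, Function.comp_apply]⟩

/-- The exponent is positive because the initial terms of the sequence, `a 0` among them, are
arbitrary. -/
theorem pow_of_add {a : ℕ → A} {N : ℕ} (ha : ∀ m ≥ N, ∀ n ≥ N, a (m + n) = a m * a n) {n : ℕ}
    (hn : N ≤ n) (k : ℕ) : a (n * (k + 1)) = a n ^ (k + 1) := by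
  induction k with
  | zero => rw [zero_add, mul_one, pow_one]
  | succ k ih =>
    rw [pow_succ, ← ih, ← ha _ (hn.trans (Nat.le_mul_of_pos_right n k.succ_pos)) _ hn]
    rfl

theorem IsPowerSeq.pow {a : ℕ → A} (ha : IsPowerSeq a) :
    ∃ N, ∀ n ≥ N, ∀ k > 0, a (n * k) = a n ^ k := by
  obtain ⟨N, ha⟩ := ha
  refine ⟨N, fun n hn k hk => ?_⟩
  obtain ⟨k, rfl⟩ := Nat.exists_eq_succ_of_ne_zero hk.ne'
  exact pow_of_add ha hn k

/-- All large numbers are nonnegative combinations of `N` and `N + 1`. -/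
theorem exists_add_of_le {N r : ℕ} (hN : 0 < N) (K : ℕ) (h : (2 * N + 1) * K + N * N ≤ r) :
    ∃ i ≥ K, ∃ j ≥ K, N * i + (N + 1) * j = r := by
  obtain ⟨r, rfl⟩ := Nat.exists_eq_add_of_le h
  have h1 := Nat.div_add_mod r N
  have h2 := Nat.mod_lt r hN
  generalize r / N = q at h1
  generalize r % N = s at h1 h2
  obtain ⟨d, rfl⟩ := Nat.exists_eq_add_of_le h2.le
  -- The excess over the bound is `N * q + s` with `N = s + d`. Since `N * d + (N + 1) * s = N * N +
  -- s`, these coefficients give the right sum.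
  refine ⟨K + (q + d), by omega, K + s, by omega, ?_⟩
  rw [← h1]
  ring

variable (A) in
/-- The germs at infinity of sequences which behave like the large powers of an element. -/
def powerGerms : Submonoid (Filter.Germ (Filter.atTop : Filter ℕ) A) where
  carrier := {f | ∃ a : ℕ → A, IsPowerSeq a ∧ (a : Filter.Germ Filter.atTop A) = f}
  one_mem' := ⟨1, ⟨0, fun _ _ _ _ => (mul_one 1).symm⟩, rfl⟩
  mul_mem' := by
    rintro _ _ ⟨a, ha, rfl⟩ ⟨b, hb, rfl⟩
    exact ⟨a * b, ha.mul hb, rfl⟩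

variable (A) in
/-- The seminormalization of `A`: its elements are given by compatible systems of elements of `A`
which play the role of their large powers. -/
def SN : Type u := powerGerms A

namespace SN

/-- The element of the seminormalization whose large powers are given by the sequence `a`. -/
def mk (a : ℕ → A) (ha : IsPowerSeq a) : SN A := ⟨a, a, ha, rfl⟩

theorem ind {P : SN A → Prop} (h : ∀ a ha, P (mk a ha)) (β : SN A) : P β := by
  obtain ⟨_, a, ha, rfl⟩ := β
  exact h a ha

theorem mk_eq_mk {a b : ℕ → A} {ha : IsPowerSeq a} {hb : IsPowerSeq b} :
    mk a ha = mk b hb ↔ ∃ N, ∀ n ≥ N, a n = b n := by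
  rw [← Filter.eventually_atTop]
  exact Subtype.ext_iff.trans Filter.Germ.coe_eq

instance : CommMonoid (SN A) := inferInstanceAs (CommMonoid (powerGerms A))

instance : Zero (SN A) := ⟨mk _ isPowerSeq_zero⟩

theorem mk_mul_mk {a b : ℕ → A} (ha : IsPowerSeq a) (hb : IsPowerSeq b) :
    mk a ha * mk b hb = mk (a * b) (ha.mul hb) := rfl

theorem one_def : (1 : SN A) = mk _ isPowerSeq_one := rfl

theorem zero_def : (0 : SN A) = mk _ isPowerSeq_zero := rfl

instance : CommMonoidWithZero (SN A) where
  zero_mul β := by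
    induction β using ind with
    | h a ha =>
      rw [zero_def, mk_mul_mk]
      exact mk_eq_mk.2 ⟨0, fun n _ => zero_mul _⟩
  mul_zero β := by
    induction β using ind with
    | h a ha =>
      rw [zero_def, mk_mul_mk]
      exact mk_eq_mk.2 ⟨0, fun n _ => mul_zero _⟩

variable (A) in
/-- The canonical map to the seminormalization. -/
def of : A →*₀ SN A where
  toFun a := mk (fun n => a ^ n) (isPowerSeq_pow a)
  map_zero' := (mk_eq_mk (hb := isPowerSeq_zero)).2 ⟨1, fun n hn => zero_pow (by omega)⟩
  map_one' := (mk_eq_mk (hb := isPowerSeq_one)).2 ⟨0, fun n _ => one_pow n⟩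
  map_mul' a b := by
    rw [mk_mul_mk]
    exact mk_eq_mk.2 ⟨0, fun n _ => mul_pow a b n⟩

theorem of_eq_of {a b : A} : of A a = of A b ↔ ∃ N, ∀ n ≥ N, a ^ n = b ^ n :=
  mk_eq_mk (ha := isPowerSeq_pow a) (hb := isPowerSeq_pow b)

/-- The map induced on seminormalizations. -/
def map (φ : A →*₀ B) : SN A →*₀ SN B where
  toFun β := ⟨Filter.Germ.map φ β.1, by
    obtain ⟨_, a, ha, rfl⟩ := β
    exact ⟨φ ∘ a, ha.map φ, rfl⟩⟩
  map_zero' := (mk_eq_mk (ha := isPowerSeq_zero.map φ) (hb := isPowerSeq_zero)).2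
    ⟨0, fun _ _ => map_zero φ⟩
  map_one' := (mk_eq_mk (ha := isPowerSeq_one.map φ) (hb := isPowerSeq_one)).2
    ⟨0, fun _ _ => map_one φ⟩
  map_mul' β γ := by
    induction β using ind with
    | h a ha =>
      induction γ using ind with
      | h b hb =>
        exact (mk_eq_mk (ha := (ha.mul hb).map φ) (hb := (ha.map φ).mul (hb.map φ))).2
          ⟨0, fun n _ => map_mul φ (a n) (b n)⟩

theorem map_mk (φ : A →*₀ B) {a : ℕ → A} (ha : IsPowerSeq a) :
    map φ (mk a ha) = mk (φ ∘ a) (ha.map φ) := rfl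

theorem map_of (φ : A →*₀ B) (a : A) : map φ (of A a) = of B (φ a) :=
  (mk_eq_mk (ha := (isPowerSeq_pow a).map φ) (hb := isPowerSeq_pow (φ a))).2
    ⟨0, fun n _ => map_pow φ a n⟩

theorem map_map (ψ : B →*₀ C) (φ : A →*₀ B) (β : SN A) :
    map ψ (map φ β) = map (ψ.comp φ) β := by
  induction β using ind with
  | h a ha => rfl

theorem mk_pow {a : ℕ → A} (ha : IsPowerSeq a) (k : ℕ) :
    ∃ h, mk a ha ^ k = mk (fun n => a n ^ k) h := by
  induction k with
  | zero => exact ⟨⟨0, fun _ _ _ _ => by simp⟩, by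
      rw [pow_zero, one_def]; exact mk_eq_mk.2 ⟨0, fun n _ => (pow_zero _).symm⟩⟩
  | succ k ih =>
    obtain ⟨h, e⟩ := ih
    refine ⟨?_, ?_⟩
    · simp only [pow_succ]
      exact h.mul ha
    · rw [pow_succ, e, mk_mul_mk]
      exact mk_eq_mk.2 ⟨0, fun n _ => (pow_succ _ _).symm⟩

/-- For large `n` and `k` one has `(a k) ^ n = a (k * n) = (a n) ^ k`; so the terms of the sequence
really are the large powers of the element it defines. -/
theorem mk_pow_eq {a : ℕ → A} (ha : IsPowerSeq a) : ∃ N, ∀ n ≥ N, mk a ha ^ n = of A (a n) := by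
  obtain ⟨N, h⟩ := ha.pow
  refine ⟨N + 1, fun n hn => ?_⟩
  obtain ⟨_, e⟩ := mk_pow ha n
  rw [e]
  refine (mk_eq_mk (hb := isPowerSeq_pow (a n))).2 ⟨N + 1, fun k hk => ?_⟩
  rw [← h k (by omega) n (by omega), ← h n (by omega) k (by omega), mul_comm]

theorem pow_mem (β : SN A) : ∃ N : ℕ, ∀ n ≥ N, β ^ n ∈ Set.range (of A) := by
  induction β using ind with
  | h a ha =>
    obtain ⟨N, h⟩ := mk_pow_eq ha
    exact ⟨N, fun n hn => ⟨a n, (h n hn).symm⟩⟩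

theorem isPowerEquiv_of : IsPowerEquiv (of A) where
  pow_mem := pow_mem
  pow_eq a b e := by
    obtain ⟨N, h⟩ := of_eq_of.1 e
    exact ⟨N + 1, N.succ_pos, h _ N.le_succ⟩

/-- Every element is determined by two elements of `A`, which are consecutive powers of it. -/
theorem exists_pow_eq (β : SN A) : ∃ N, 0 < N ∧ ∃ a b : A, a ^ (N + 1) = b ^ N ∧
    β ^ N = of A a ∧ β ^ (N + 1) = of A b := by
  induction β using ind with
  | h a ha =>
    obtain ⟨N, h⟩ := mk_pow_eq ha
    obtain ⟨M, h'⟩ := ha.pow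
    refine ⟨N + M + 1, by omega, a (N + M + 1), a (N + M + 1 + 1), ?_, h _ (by omega),
      h _ (by omega)⟩
    rw [← h' _ (by omega) _ (by omega), ← h' _ (by omega) _ (by omega), mul_comm]

/-- Elements are determined by consecutive powers. -/
theorem ext_pow {β γ : SN A} (N : ℕ) (h : β ^ N = γ ^ N) (h' : β ^ (N + 1) = γ ^ (N + 1)) :
    β = γ := by
  rcases Nat.eq_zero_or_pos N with rfl | hN
  · simpa using h'
  -- Every `n ≥ N * N` is a nonnegative combination of `N` and `N + 1`.
  have key : ∀ n ≥ N * N, β ^ n = γ ^ n := by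
    intro n hn
    obtain ⟨i, -, j, -, rfl⟩ := exists_add_of_le hN 0 (by simpa using hn)
    rw [pow_add β, pow_mul, pow_mul, h, h', ← pow_mul, ← pow_mul, ← pow_add γ]
  induction β using ind with
  | h a ha =>
    induction γ using ind with
    | h b hb =>
      obtain ⟨N₁, h₁⟩ := mk_pow_eq ha
      obtain ⟨N₂, h₂⟩ := mk_pow_eq hb
      obtain ⟨N₃, h₃⟩ := ha.pow
      obtain ⟨N₄, h₄⟩ := hb.pow
      obtain ⟨N₅, h₅⟩ := ha
      obtain ⟨N₆, h₆⟩ := hb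
      have k : ∀ n ≥ N * N + N₁ + N₂, ∃ K, ∀ k ≥ K, a n ^ k = b n ^ k := by
        intro n hn
        rw [← of_eq_of, ← h₁ n (by omega), ← h₂ n (by omega), key n (by omega)]
      obtain ⟨n, hn⟩ : ∃ n, n = N * N + N₁ + N₂ + N₃ + N₄ + N₅ + N₆ + 1 := ⟨_, rfl⟩
      obtain ⟨K, hK⟩ := k n (by omega)
      obtain ⟨K', hK'⟩ := k (n + 1) (by omega)
      -- The sequences are known to agree only after raising the terms at `n` and `n + 1` to large
      -- powers. Beyond this bound `m = n * i + (n + 1) * j` with `i` and `j` large, and the term at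
      -- `m` is the product of such powers.
      refine mk_eq_mk.2 ⟨(2 * n + 1) * (K + K' + 1) + n * n, fun m hm => ?_⟩
      obtain ⟨i, hi, j, hj, rfl⟩ := exists_add_of_le (by omega) _ hm
      have hni : n ≤ n * i := Nat.le_mul_of_pos_right n (by omega)
      have hnj : n + 1 ≤ (n + 1) * j := Nat.le_mul_of_pos_right (n + 1) (by omega)
      rw [h₅ _ (by omega) _ (by omega), h₆ _ (by omega) _ (by omega), h₃ n (by omega) i (by omega),
        h₃ (n + 1) (by omega) j (by omega), h₄ n (by omega) i (by omega),
        h₄ (n + 1) (by omega) j (by omega), hK i (by omega), hK' j (by omega)]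

/-- If `α ^ N = β` and `α ^ (N + 1) = γ`, then `α ^ r = β ^ i * γ ^ j` for `r = N * i + (N + 1) *
j`. So the sequence of `α` is defined by `c r = a i * b j`, and the point is independence of the
representation of `r`. -/
theorem exists_root {N : ℕ} (hN : 0 < N) {β γ : SN A} (h : β ^ (N + 1) = γ ^ N) :
    ∃ α : SN A, α ^ N = β ∧ α ^ (N + 1) = γ := by
  induction β using ind with
  | h a ha =>
    induction γ using ind with
    | h b hb =>
      obtain ⟨_, e₁⟩ := mk_pow ha (N + 1)
      obtain ⟨_, e₂⟩ := mk_pow hb N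
      rw [e₁, e₂] at h
      obtain ⟨N₀, h⟩ := mk_eq_mk.1 h
      obtain ⟨N₁, h₁⟩ := ha.pow
      obtain ⟨N₂, h₂⟩ := hb.pow
      obtain ⟨N₃, h₃⟩ := id ha
      obtain ⟨N₄, h₄⟩ := id hb
      obtain ⟨K, hK⟩ : ∃ K, K = N₀ + N₁ + N₂ + N₃ + N₄ + 1 := ⟨_, rfl⟩
      -- The relation `β ^ (N + 1) = γ ^ N`, read on the sequences.
      have hab : ∀ k ≥ K, a ((N + 1) * k) = b (N * k) := by
        intro k hk
        rw [mul_comm, h₁ k (by omega) _ (by omega), mul_comm, h₂ k (by omega) _ (by omega),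
          h k (by omega)]
      -- The exchange of `(N + 1) * t` in the index of `a` against `N * t` in that of `b`. As `hab`
      -- needs large arguments, a block `(N + 1) * K` is split off from `i` and converted together
      -- with `t`.
      have step : ∀ i ≥ K + (N + 1) * K, ∀ j ≥ K, ∀ t,
          a (i + (N + 1) * t) * b j = a i * b (j + N * t) := by
        intro i hi j hj t
        rcases Nat.eq_zero_or_pos t with rfl | ht
        · simp
        obtain ⟨d, rfl⟩ := Nat.exists_eq_add_of_le hi
        have g1 : K ≤ (N + 1) * K := Nat.le_mul_of_pos_left K N.succ_pos
        have g2 : K ≤ N * K := Nat.le_mul_of_pos_left K hN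
        have g3 : (N + 1) * (K + t) = (N + 1) * K + (N + 1) * t := mul_add _ _ _
        have g4 : N * (K + t) = N * K + N * t := mul_add _ _ _
        have r1 : a (K + (N + 1) * K + d + (N + 1) * t) = a (K + d) * a ((N + 1) * (K + t)) := by
          rw [← h₃ _ (by omega) _ (by omega)]
          congr 1
          omega
        have r2 : a (K + (N + 1) * K + d) = a (K + d) * a ((N + 1) * K) := by
          rw [← h₃ _ (by omega) _ (by omega)]
          congr 1
          omega
        rw [r1, r2, hab _ (by omega), hab _ le_rfl, mul_assoc, mul_assoc,
          ← h₄ _ (by omega) _ (by omega), ← h₄ _ (by omega) _ (by omega)]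
        congr 2
        omega
      obtain ⟨M, hM⟩ : ∃ M, M = K + (N + 1) * K := ⟨_, rfl⟩
      rw [← hM] at step
      -- As `N` and `N + 1` are coprime, two representations of the same number differ by a multiple
      -- of `(N + 1, -N)`, which is the exchange above.
      have wd' : ∀ i ≥ M, ∀ j ≥ M, ∀ i' ≥ M, ∀ j' ≥ M, i ≤ i' →
          N * i + (N + 1) * j = N * i' + (N + 1) * j' → a i * b j = a i' * b j' := by
        intro i hi j hj i' hi' j' hj' hii e
        obtain ⟨d, rfl⟩ := Nat.exists_eq_add_of_le hii
        have hjj : j' ≤ j := by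
          have : (N + 1) * j' ≤ (N + 1) * j := by
            rw [mul_add] at e
            omega
          exact Nat.le_of_mul_le_mul_left this N.succ_pos
        obtain ⟨c, rfl⟩ := Nat.exists_eq_add_of_le hjj
        have e' : (N + 1) * c = N * d := by
          rw [mul_add, mul_add] at e
          omega
        obtain ⟨t, rfl⟩ : N + 1 ∣ d :=
          Nat.Coprime.dvd_of_dvd_mul_left (by simp) (Dvd.intro c e')
        obtain rfl : c = N * t := Nat.eq_of_mul_eq_mul_left N.succ_pos (by rw [e', Nat.succ_eq_add_one]; ring)
        exact (step i hi j' (by omega) t).symm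
      have wd : ∀ i ≥ M, ∀ j ≥ M, ∀ i' ≥ M, ∀ j' ≥ M,
          N * i + (N + 1) * j = N * i' + (N + 1) * j' → a i * b j = a i' * b j' := by
        intro i hi j hj i' hi' j' hj' e
        rcases le_total i i' with h | h
        · exact wd' i hi j hj i' hi' j' hj' h e
        · exact (wd' i' hi' j' hj' i hi j hj h e.symm).symm
      -- Below the bound the value `0` is arbitrary; only the germ at infinity matters.
      have ex : ∀ n, ∃ c, n ≥ (2 * N + 1) * M + N * N →
          ∃ i ≥ M, ∃ j ≥ M, N * i + (N + 1) * j = n ∧ c = a i * b j := by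
        intro n
        by_cases hn : n ≥ (2 * N + 1) * M + N * N
        · obtain ⟨i, hi, j, hj, e⟩ := exists_add_of_le hN M hn
          exact ⟨_, fun _ => ⟨i, hi, j, hj, e, rfl⟩⟩
        · exact ⟨0, fun h => absurd h hn⟩
      choose c hc using ex
      have hcp : IsPowerSeq c := by
        refine ⟨(2 * N + 1) * M + N * N, fun m hm n hn => ?_⟩
        obtain ⟨i, hi, j, hj, e, q⟩ := hc (m + n) (by omega)
        obtain ⟨i₁, hi₁, j₁, hj₁, e₁, q₁⟩ := hc m hm
        obtain ⟨i₂, hi₂, j₂, hj₂, e₂, q₂⟩ := hc n hn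
        rw [q, q₁, q₂, mul_mul_mul_comm, ← h₃ _ (by omega) _ (by omega),
          ← h₄ _ (by omega) _ (by omega)]
        refine wd i hi j hj _ (by omega) _ (by omega) ?_
        rw [e, ← e₁, ← e₂]
        ring
      refine ⟨mk c hcp, ?_, ?_⟩
      · obtain ⟨_, e⟩ := mk_pow hcp N
        rw [e]
        refine mk_eq_mk.2 ⟨(2 * N + 1) * M + N * N, fun n hn => ?_⟩
        obtain ⟨i, hi, j, hj, e, q⟩ := hc n hn
        have g1 : i ≤ i * N := Nat.le_mul_of_pos_right i hN
        have g2 : j ≤ (N + 1) * j := Nat.le_mul_of_pos_left j N.succ_pos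
        -- `(a i * b j) ^ N = a (N * i) * b (N * j)`, and `b (N * j) = a ((N + 1) * j)` by `hab`, so
        -- the product is `a n`.
        rw [q, mul_pow, ← h₁ i (by omega) N hN, ← h₂ j (by omega) N hN, mul_comm j,
          ← hab j (by omega), ← h₃ _ (by omega) _ (by omega), ← e, mul_comm i]
      · obtain ⟨_, e⟩ := mk_pow hcp (N + 1)
        rw [e]
        refine mk_eq_mk.2 ⟨(2 * N + 1) * M + N * N, fun n hn => ?_⟩
        obtain ⟨i, hi, j, hj, e, q⟩ := hc n hn
        have g1 : i ≤ N * i := Nat.le_mul_of_pos_left i hN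
        have g2 : j ≤ j * (N + 1) := Nat.le_mul_of_pos_right j N.succ_pos
        rw [q, mul_pow, ← h₁ i (by omega) (N + 1) N.succ_pos,
          ← h₂ j (by omega) (N + 1) N.succ_pos, mul_comm i,
          hab i (by omega), ← h₄ _ (by omega) _ (by omega), ← e, mul_comm j]

theorem exists_of_pow {N : ℕ} (hN : 0 < N) {a b : A} (h : a ^ (N + 1) = b ^ N) :
    ∃ α : SN A, α ^ N = of A a ∧ α ^ (N + 1) = of A b :=
  exists_root hN (by rw [← map_pow, ← map_pow, h])

theorem isSeminormal : IsSeminormal (SN A) where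
  -- The exponent `n + 1` is used since `0 ^ n` need not vanish for `n = 0`.
  reduced := ⟨fun β ⟨n, hn⟩ => ext_pow (n + 1) (by rw [pow_succ, hn, zero_mul, zero_pow (by omega)])
    (by rw [pow_succ, pow_succ, hn, zero_mul, zero_mul, zero_pow (by omega)])⟩
  exists_root _ _ h := exists_root two_pos h

/-- A power of an inverse comes from some `b : A`. Then `a ^ n * b` has image `1`, so a positive
power of it is `1`. -/
theorem isUnit_of {a : A} : IsUnit (of A a) ↔ IsUnit a := by
  refine ⟨fun h => ?_, fun h => h.map _⟩
  obtain ⟨β, hβ⟩ := h.exists_right_inv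
  obtain ⟨n, hn, b, hb⟩ := isPowerEquiv_of.exists_pow β
  have : of A (a ^ n * b) = of A 1 := by
    rw [map_mul, map_pow, hb, ← mul_pow, hβ, one_pow, map_one]
  obtain ⟨k, hk, e⟩ := isPowerEquiv_of.pow_eq _ _ this
  have : IsUnit ((a ^ n * b) ^ k) := by
    rw [e]
    exact isUnit_one.pow k
  rw [isUnit_pow_iff hk.ne'] at this
  exact (isUnit_pow_iff hn.ne').1 (isUnit_of_mul_isUnit_left this)

theorem zero_ne_one (h : (0 : A) ≠ 1) : (0 : SN A) ≠ 1 := by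
  intro e
  rw [← map_zero (of A), ← map_one (of A)] at e
  obtain ⟨N, hN⟩ := of_eq_of.1 e
  apply h
  simpa using hN (N + 1) (by omega)

/-- Equality in `SN A` gives `a ^ N = a' ^ N` and `a ^ (N + 1) = a' ^ (N + 1)`, hence `a ^ N * a = a
^ N * a'`. Lifting to the cancellative monoid `C`, either both sides lie in the ideal, and then `a`
and `a'` are nilpotent, or `c ^ N` can be cancelled. -/
theorem of_eq_of_iff (h : IsPartiallyCancellative A) (a a' : A) :
    of A a = of A a' ↔ a = a' ∨ (IsNilpotent a ∧ IsNilpotent a') := by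
  constructor
  · intro e
    obtain ⟨N, hN⟩ := of_eq_of.1 e
    by_cases h0 : a ^ (N + 1) = 0
    · exact Or.inr ⟨⟨_, h0⟩, _, (hN (N + 1) (by omega)) ▸ h0⟩
    · left
      obtain ⟨C, _, _, I, π, hI, hπ, h⟩ := h
      obtain ⟨c, rfl⟩ := hπ a
      obtain ⟨d, rfl⟩ := hπ a'
      have e1 := hN (N + 1) (by omega)
      have e2 := hN N le_rfl
      rw [pow_succ, pow_succ, ← e2, ← map_pow, ← map_mul, ← map_mul] at e1
      rcases (h _ _).1 e1 with e3 | ⟨e3, -⟩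
      · refine congrArg π (mul_left_cancel₀ (fun hc => h0 ?_) e3)
        rw [pow_succ, ← map_pow, hc, map_zero, zero_mul]
      · exfalso
        apply h0
        rw [pow_succ, ← map_pow, ← map_mul, ← map_zero π, h]
        exact Or.inr ⟨e3, hI.zero_mem⟩
  · rintro (rfl | ⟨⟨n, hn⟩, m, hm⟩)
    · rfl
    · refine of_eq_of.2 ⟨n + m, fun k hk => ?_⟩
      rw [pow_eq_zero_of_le (by omega) hn, pow_eq_zero_of_le (by omega) hm]

/-! ### Seminormalization commutes with localization -/

section Localization

variable {S : Type u} [CommMonoidWithZero S] {γ : A →*₀ S}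

/-- Seminormalization commutes with localization: fractions. -/
theorem exists_frac
    (hfrac : ∀ t : S, ∃ a s : A, IsUnit (γ s) ∧ γ s * t = γ a)
    (heq : ∀ a b : A, γ a = γ b → ∃ s : A, IsUnit (γ s) ∧ s * a = s * b) (τ : SN S) :
    ∃ (β : SN A) (s : A), IsUnit (γ s) ∧ of S (γ s) * τ = map γ β := by
  -- `τ` is replaced by its consecutive powers `x` and `y`, subject to one equation.
  obtain ⟨N, hN, x, y, hxy, hx, hy⟩ := exists_pow_eq τ
  obtain ⟨a, s, hs, ha⟩ := hfrac x
  obtain ⟨b, s', hs', hb⟩ := hfrac y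
  obtain ⟨N, rfl⟩ := Nat.exists_eq_succ_of_ne_zero hN.ne'
  rw [Nat.succ_eq_add_one] at *
  -- `r` is a common denominator of `x` and `y`. The elements of `A` formed next represent `(r * τ)
  -- ^ (N + 1)` and `(r * τ) ^ (N + 2)`, in terms of the shifted `N`.
  obtain ⟨r, hr⟩ : ∃ r, r = s * s' := ⟨_, rfl⟩
  have hru : IsUnit (γ r) := by rw [hr, map_mul]; exact hs.mul hs'
  have ha' : γ (s' * a) = γ r * x := by rw [map_mul, ← ha, hr, map_mul]; ac_rfl
  have hb' : γ (s * b) = γ r * y := by rw [map_mul, ← hb, hr, map_mul]; ac_rfl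
  have h1 : γ (r ^ N * (s' * a)) = γ r ^ (N + 1) * x := by
    rw [map_mul, ha', map_pow, pow_succ, mul_assoc]
  have h2 : γ (r ^ (N + 1) * (s * b)) = γ r ^ (N + 1 + 1) * y := by
    rw [map_mul, hb', map_pow, pow_succ _ (N + 1), mul_assoc]
  -- The equation between these two elements holds only in `S`; one further factor `t` makes it hold
  -- in `A`. Inserting `t ^ (N + 1)` and `t ^ (N + 2)` provides it while keeping consecutive powers,
  -- now of `t * r * τ`.
  obtain ⟨t, ht, e⟩ := heq ((r ^ N * (s' * a)) ^ (N + 1 + 1))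
    ((r ^ (N + 1) * (s * b)) ^ (N + 1)) (by
      rw [map_pow, map_pow, h1, h2, mul_pow, mul_pow, hxy, ← pow_mul, ← pow_mul, mul_comm (N + 1)])
  obtain ⟨β, hβ, hβ'⟩ := exists_of_pow hN (a := t ^ (N + 1) * (r ^ N * (s' * a)))
    (b := t ^ (N + 1 + 1) * (r ^ (N + 1) * (s * b))) (by
      rw [mul_pow (t ^ _), mul_pow (t ^ _), ← pow_mul, ← pow_mul, mul_comm (N + 1 + 1) (N + 1)]
      have : (N + 1) * (N + 1 + 1) = (N + 1) * (N + 1) + N + 1 := by ring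
      rw [this, pow_succ, mul_assoc, mul_assoc, e])
  refine ⟨β, t * r, ?_, ext_pow (N + 1) ?_ ?_⟩
  · rw [map_mul]
    exact ht.mul hru
  · rw [mul_pow, hx, ← map_pow, ← map_pow (map γ), hβ, map_of, map_mul γ _ (r ^ N * _), h1, ← map_mul,
      map_mul γ, mul_pow, map_pow, mul_assoc]
  · rw [mul_pow, hy, ← map_pow, ← map_pow (map γ), hβ', map_of, map_mul γ _ (r ^ (N + 1) * _), h2,
      ← map_mul, map_mul γ, mul_pow, map_pow, mul_assoc]

/-- Seminormalization commutes with localization: equality of fractions. -/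
theorem exists_eq
    (heq : ∀ a b : A, γ a = γ b → ∃ s : A, IsUnit (γ s) ∧ s * a = s * b) {β β' : SN A}
    (h : map γ β = map γ β') : ∃ s : A, IsUnit (γ s) ∧ of A s * β = of A s * β' := by
  induction β using ind with
  | h a ha =>
    induction β' using ind with
    | h b hb =>
      rw [map_mk, map_mk] at h
      obtain ⟨N₀, h₀⟩ := mk_eq_mk.1 h
      obtain ⟨N₁, h₁⟩ := mk_pow_eq ha
      obtain ⟨N₂, h₂⟩ := mk_pow_eq hb
      obtain ⟨N, hN⟩ : ∃ N, N = N₀ + N₁ + N₂ := ⟨_, rfl⟩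
      obtain ⟨s, hs, e⟩ := heq _ _ (h₀ (N + 1) (by omega))
      obtain ⟨t, ht, e'⟩ := heq _ _ (h₀ (N + 1 + 1) (by omega))
      -- `s` and `t` equalize the terms at two consecutive indices, so `s * t` equalizes two
      -- consecutive powers, which suffices.
      refine ⟨s * t, by rw [map_mul]; exact hs.mul ht, ext_pow (N + 1) ?_ ?_⟩
      · rw [mul_pow, mul_pow, h₁ _ (by omega), h₂ _ (by omega), ← map_pow, ← map_mul, ← map_mul]
        congr 1
        calc (s * t) ^ (N + 1) * a (N + 1) = (s * t) ^ N * t * (s * a (N + 1)) := by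
              rw [pow_succ]; ac_rfl
          _ = (s * t) ^ N * t * (s * b (N + 1)) := by rw [e]
          _ = _ := by rw [pow_succ]; ac_rfl
      · rw [mul_pow, mul_pow, h₁ _ (by omega), h₂ _ (by omega), ← map_pow, ← map_mul, ← map_mul]
        congr 1
        calc (s * t) ^ (N + 1 + 1) * a (N + 1 + 1)
            = (s * t) ^ (N + 1) * s * (t * a (N + 1 + 1)) := by rw [pow_succ]; ac_rfl
          _ = (s * t) ^ (N + 1) * s * (t * b (N + 1 + 1)) := by rw [e']
          _ = _ := by rw [pow_succ _ (N + 1)]; ac_rfl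

end Localization

end SN

end PowerSequences
end
end MonoidGeom

namespace MonoidGeom
noncomputable section

/-! ## The seminormalization of a monoid scheme -/

namespace MonoidedSpace

variable (X : MonoidedSpace.{u})

/-- Restriction of sections, as a homomorphism of pointed monoids. -/
def resHom {U V : Opens X.space} (h : V ≤ U) : X.sec U →*₀ X.sec V where
  toFun := res X.sheaf h
  map_zero' := X.res_zero h
  map_one' := X.res_one h
  map_mul' := X.res_mul h

variable {X} in
theorem germHom_comp_resHom {U V : Opens X.space} (h : V ≤ U) {x : X.space} (hx : x ∈ V) :
    (germHom hx).comp (resHom X h) = germHom (h hx) :=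
  MonoidWithZeroHom.ext fun s => germ_res h hx s

/-- Families of elements of the seminormalizations of the stalks which are locally given by an
element of the seminormalization of the monoid of sections. -/
def snPred : TopCat.LocalPredicate fun x : X.space => SN (X.stalk x) where
  pred {U} f := ∀ x : U, ∃ (W : Opens X.space) (_ : x.1 ∈ W) (i : W ≤ U) (β : SN (X.sec W)),
    ∀ y : W, f ⟨y.1, i y.2⟩ = SN.map (germHom y.2) β
  res {V U} i f h x := by
    obtain ⟨W, hW, j, β, e⟩ := h ⟨x.1, i.le x.2⟩
    refine ⟨W ⊓ V, ⟨hW, x.2⟩, inf_le_right, SN.map (resHom X inf_le_left) β, fun y => ?_⟩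
    rw [SN.map_map, germHom_comp_resHom]
    exact e ⟨y.1, y.2.1⟩
  locality {U} f h x := by
    obtain ⟨V, hV, i, h⟩ := h x
    obtain ⟨W, hW, j, β, e⟩ := h ⟨x.1, hV⟩
    exact ⟨W, hW, j.trans i.le, β, e⟩

theorem snPred_map {X : MonoidedSpace.{u}} {U : Opens X.space} (β : SN (X.sec U)) :
    X.snPred.pred fun x : U => SN.map (germHom x.2) β :=
  fun x => ⟨U, x.2, le_rfl, β, fun _ => rfl⟩

theorem snPred_mul {X : MonoidedSpace.{u}} {U : Opens X.space} {f g : ∀ x : U, SN (X.stalk x.1)}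
    (hf : X.snPred.pred f) (hg : X.snPred.pred g) : X.snPred.pred fun x => f x * g x := by
  intro x
  obtain ⟨V, hV, i, β, e⟩ := hf x
  obtain ⟨W, hW, j, γ, e'⟩ := hg x
  refine ⟨V ⊓ W, ⟨hV, hW⟩, inf_le_left.trans i,
    SN.map (resHom X inf_le_left) β * SN.map (resHom X inf_le_right) γ, fun y => ?_⟩
  rw [map_mul, SN.map_map, SN.map_map, germHom_comp_resHom, germHom_comp_resHom]
  exact congrArg₂ (· * ·) (e ⟨y.1, y.2.1⟩) (e' ⟨y.1, y.2.2⟩)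

instance (U : Opens X.space) : CommMonoidWithZero (Sec (TopCat.subsheafToTypes X.snPred) U) where
  mul f g := ⟨fun x => f.1 x * g.1 x, snPred_mul f.2 g.2⟩
  one := ⟨fun _ => 1, by
    have := snPred_map (X := X) (U := U) 1
    simpa only [map_one] using this⟩
  zero := ⟨fun _ => 0, by
    have := snPred_map (X := X) (U := U) 0
    simpa only [map_zero] using this⟩
  mul_assoc f g h := Subtype.ext (funext fun p => mul_assoc _ _ _)
  mul_comm f g := Subtype.ext (funext fun p => mul_comm _ _)
  one_mul f := Subtype.ext (funext fun p => one_mul _)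
  mul_one f := Subtype.ext (funext fun p => mul_one _)
  zero_mul f := Subtype.ext (funext fun p => zero_mul _)
  mul_zero f := Subtype.ext (funext fun p => mul_zero _)

/-- The seminormalization of a space with a sheaf of pointed monoids. -/
def sn : MonoidedSpace.{u} where
  space := X.space
  sheaf := TopCat.subsheafToTypes X.snPred
  res_zero _ := rfl
  res_one _ := rfl
  res_mul _ _ _ := rfl

/-! ### Sections, stalks and charts of the seminormalization -/

section

variable {X}

/-- An open subset as an open subset of the seminormalization. -/
def snOpens (U : Opens X.space) : Opens X.sn.space := U

/-- The value of a section of the seminormalization at a point. -/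
def snVal {U : Opens X.space} (f : X.sn.sec (snOpens U)) {x : X.space} (hx : x ∈ U) :
    SN (X.stalk x) := f.1 ⟨x, hx⟩

/-- The section of the seminormalization defined by an element of the seminormalization of the
monoid of sections. -/
def snSec {U : Opens X.space} : SN (X.sec U) →*₀ X.sn.sec (snOpens U) where
  toFun β := (⟨_, snPred_map β⟩ : {f : ∀ x : U, SN (X.stalk x.1) // X.snPred.pred f})
  map_zero' := Subtype.ext (funext fun x => map_zero (SN.map (germHom x.2)))
  map_one' := Subtype.ext (funext fun x => map_one (SN.map (germHom x.2)))
  map_mul' β γ := Subtype.ext (funext fun x => map_mul (SN.map (germHom x.2)) β γ)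

theorem snVal_snSec {U : Opens X.space} (β : SN (X.sec U)) {x : X.space} (hx : x ∈ U) :
    snVal (snSec β) hx = SN.map (germHom hx) β := rfl

theorem snVal_ext {U : Opens X.space} {f g : X.sn.sec (snOpens U)}
    (h : ∀ x (hx : x ∈ U), snVal f hx = snVal g hx) : f = g :=
  Subtype.ext (funext fun x => h x.1 x.2)

/-- A point as a point of the seminormalization. -/
def snPt (x : X.space) : X.sn.space := x

/-- The germ of a section of the seminormalization. -/
def snGerm {U : Opens X.space} {x : X.space} (hx : x ∈ U) :
    X.sn.sec (snOpens U) →*₀ X.sn.stalk (snPt x) :=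
  germHom (X := X.sn) (U := snOpens U) (x := snPt x) hx

theorem snGerm_eq_of_res {U V W : Opens X.space} {x : X.space} (hx : x ∈ W) (i : W ≤ U) (j : W ≤ V)
    {f : X.sn.sec (snOpens U)} {g : X.sn.sec (snOpens V)}
    (h : ∀ y (hy : y ∈ W), snVal f (i hy) = snVal g (j hy)) :
    snGerm (i hx) f = snGerm (j hx) g :=
  (germ_res (F := X.sn.sheaf) (U := snOpens U) (V := snOpens W) (x := snPt x) i hx f).symm.trans
    ((congrArg (snGerm hx) (snVal_ext h)).trans
      (germ_res (F := X.sn.sheaf) (U := snOpens V) (V := snOpens W) (x := snPt x) j hx g))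

theorem exists_snGerm {x : X.space} (t : X.sn.stalk (snPt x)) :
    ∃ (U : Opens X.space) (hx : x ∈ U) (β : SN (X.sec U)), snGerm hx (snSec β) = t := by
  obtain ⟨U, hU, f, rfl⟩ := exists_germ t
  obtain ⟨W, hW, i, β, e⟩ := f.2 ⟨x, hU⟩
  refine ⟨W, hW, β, ?_⟩
  exact (snGerm_eq_of_res (X := X) (x := x) (U := U) (f := f) (g := snSec β) hW i le_rfl fun y hy => e ⟨y, hy⟩).symm

/-- The value of the germ of a section. -/
def snEv (x : X.space) : X.sn.stalk (snPt x) →*₀ SN (X.stalk x) where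
  toFun := TopCat.stalkToFiber X.snPred x
  map_zero' := by
    rw [← germ_zero (X := X.sn) (x := snPt x) (Opens.mem_top _)]
    exact TopCat.stalkToFiber_germ X.snPred ⊤ x (Opens.mem_top x) _
  map_one' := by
    rw [← germ_one (X := X.sn) (x := snPt x) (Opens.mem_top _)]
    exact TopCat.stalkToFiber_germ X.snPred ⊤ x (Opens.mem_top x) _
  map_mul' s t := by
    obtain ⟨U, hx, s, t, rfl, rfl⟩ := exists_germ₂ s t
    rw [← germ_mul]
    refine (TopCat.stalkToFiber_germ X.snPred U x hx _).trans ?_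
    exact congrArg₂ (· * ·) (TopCat.stalkToFiber_germ X.snPred U x hx s).symm
      (TopCat.stalkToFiber_germ X.snPred U x hx t).symm

theorem snEv_germ {U : Opens X.space} {x : X.space} (hx : x ∈ U) (f : X.sn.sec (snOpens U)) :
    snEv x (snGerm hx f) = snVal f hx :=
  TopCat.stalkToFiber_germ X.snPred U x hx f

/-- `SN` commutes with the passage to stalks because it is finitary: an equality in `SN` follows
from two equalities between consecutive powers, and an element is given by two elements with one
relation. Each of these finitely many conditions on germs already holds on a neighbourhood. -/
theorem snEv_bijective (x : X.space) : Function.Bijective (snEv x) := by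
  constructor
  · intro s t e
    obtain ⟨U, hU, β, rfl⟩ := exists_snGerm s
    obtain ⟨V, hV, γ, rfl⟩ := exists_snGerm t
    rw [snEv_germ, snEv_germ, snVal_snSec, snVal_snSec] at e
    induction β using SN.ind with
    | h a ha =>
      induction γ using SN.ind with
      | h b hb =>
        rw [SN.map_mk, SN.map_mk] at e
        obtain ⟨N₀, h₀⟩ := SN.mk_eq_mk.1 e
        obtain ⟨N₁, h₁⟩ := SN.mk_pow_eq ha
        obtain ⟨N₂, h₂⟩ := SN.mk_pow_eq hb
        obtain ⟨N, hN⟩ : ∃ N, N = N₀ + N₁ + N₂ := ⟨_, rfl⟩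
        obtain ⟨W, hW, i, j, q⟩ := germ_eq (h₀ N (by omega))
        obtain ⟨W', hW', i', j', q'⟩ := germ_eq (h₀ (N + 1) (by omega))
        have hx : x ∈ W ⊓ W' := ⟨hW, hW'⟩
        refine snGerm_eq_of_res hx (inf_le_left.trans i) (inf_le_left.trans j) fun z hz => ?_
        rw [snVal_snSec, snVal_snSec]
        refine SN.ext_pow N ?_ ?_
        · rw [← map_pow, ← map_pow, h₁ _ (by omega), h₂ _ (by omega), SN.map_of, SN.map_of]
          refine congrArg _ ?_
          have := congrArg (germ X.sheaf hz.1) q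
          rwa [germ_res, germ_res] at this
        · rw [← map_pow, ← map_pow, h₁ _ (by omega), h₂ _ (by omega), SN.map_of, SN.map_of]
          refine congrArg _ ?_
          have := congrArg (germ X.sheaf hz.2) q'
          rwa [germ_res, germ_res] at this
  · intro τ
    obtain ⟨N, hN, s, t, e, hs, ht⟩ := SN.exists_pow_eq τ
    obtain ⟨U, hU, a, b, rfl, rfl⟩ := exists_germ₂ s t
    -- The relation between the two consecutive powers spreads out to a neighbourhood of `x`, over
    -- which `exists_of_pow` produces a section with value `τ`.
    have q : germ X.sheaf hU (a ^ (N + 1)) = germ X.sheaf hU (b ^ N) := by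
      have h1 := map_pow (germHom hU) a (N + 1)
      have h2 := map_pow (germHom hU) b N
      exact h1.trans (e.trans h2.symm)
    obtain ⟨W, hW, i, j, q⟩ := germ_eq q
    have q' : (resHom X i a) ^ (N + 1) = (resHom X i b) ^ N := by
      rw [← map_pow, ← map_pow]
      exact q
    obtain ⟨β, h1, h2⟩ := SN.exists_of_pow hN q'
    refine ⟨snGerm hW (snSec β), ?_⟩
    rw [snEv_germ, snVal_snSec]
    refine SN.ext_pow N ?_ ?_
    · rw [← map_pow, h1, hs, SN.map_of]
      exact congrArg _ (germ_res i hW a)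
    · rw [← map_pow, h2, ht, SN.map_of]
      exact congrArg _ (germ_res i hW b)

theorem isUnit_snEv {x : X.space} {t : X.sn.stalk (snPt x)} : IsUnit (snEv x t) ↔ IsUnit t :=
  isUnit_map_iff (MulEquiv.ofBijective (snEv x) (snEv_bijective x)) t

/-- The seminormalization of a chart. -/
theorem IsChart.sn {A : Type u} [CommMonoidWithZero A] {U : Opens X.space} {α : A →*₀ X.sec U}
    (h : IsChart U α) : IsChart (snOpens U) (snSec.comp (SN.map α)) := by
  have ev : ∀ x (hx : x ∈ U) β, snEv x (snGerm hx (snSec (SN.map α β))) =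
      SN.map ((germHom hx).comp α) β := by
    intro x hx β
    rw [snEv_germ, snVal_snSec, SN.map_map]
  have unit : ∀ x (hx : x ∈ U) β, IsUnit (snGerm hx (snSec (SN.map α β))) ↔
      IsUnit (SN.map ((germHom hx).comp α) β) := by
    intro x hx β
    rw [← isUnit_snEv, ev]
  have unit_of : ∀ x (hx : x ∈ U) a, IsUnit (snGerm hx (snSec (SN.map α (SN.of A a)))) ↔
      IsUnit (germ X.sheaf hx (α a)) := by
    intro x hx a
    rw [unit, SN.map_of, SN.isUnit_of]
    rfl
  have frac : ∀ x (hx : x ∈ U) (t : X.sn.stalk (snPt x)), ∃ β s,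
      IsUnit (snGerm hx (snSec (SN.map α s))) ∧
        snGerm hx (snSec (SN.map α s)) * t = snGerm hx (snSec (SN.map α β)) := by
    intro x hx t
    obtain ⟨β, s, hs, e⟩ := SN.exists_frac (γ := (germHom hx).comp α) (h.exists_frac x hx)
      (h.exists_eq x hx) (snEv x t)
    refine ⟨β, SN.of A s, (unit_of x hx s).2 hs, (snEv_bijective x).1 ?_⟩
    rw [map_mul (snEv x), ev, ev, ← e, SN.map_of]
  have eq : ∀ x (hx : x ∈ U) β γ, snGerm hx (snSec (SN.map α β)) = snGerm hx (snSec (SN.map α γ)) →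
      ∃ s, IsUnit (snGerm hx (snSec (SN.map α s))) ∧ s * β = s * γ := by
    intro x hx β γ e
    have e := congrArg (snEv x) e
    rw [ev, ev] at e
    obtain ⟨s, hs, e⟩ := SN.exists_eq (h.exists_eq x hx) e
    exact ⟨SN.of A s, (unit_of x hx s).2 hs, e⟩
  have ne : ∀ x (hx : x ∈ U), (0 : SN (X.stalk x)) ≠ 1 := fun x hx =>
    SN.zero_ne_one fun e => h.zero_ne_one x hx e
  constructor
  · intro x hx e
    refine ne x hx ?_
    rw [← map_zero (snEv (X := X) x), ← map_one (snEv (X := X) x)]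
    exact congrArg (snEv (X := X) x) e
  · exact frac
  · exact eq
  · intro q hq
    obtain ⟨x, hx, k⟩ := h.exists_point (SN.of A ⁻¹' q)
      { zero_mem := by rw [Set.mem_preimage, map_zero]; exact hq.zero_mem
        mul_mem := fun a b hb => by
          rw [Set.mem_preimage, map_mul]; exact hq.mul_mem _ _ hb
        one_notMem := by rw [Set.mem_preimage, map_one]; exact hq.one_notMem
        mem_or_mem := fun a b hab => by
          rw [Set.mem_preimage, map_mul] at hab; exact hq.mem_or_mem _ _ hab }
    refine ⟨x, hx, fun β => (unit x hx β).trans ?_⟩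
    have h0 := IsChart.isPrimeIdeal_nonunits (ne x hx)
    -- The elements of `SN A` which are not invertible at `x` form a prime with the same trace on
    -- `A` as `q`, hence equal to `q`.
    have := SN.isPowerEquiv_of.prime_unique
      (q := {β | ¬ IsUnit (SN.map ((germHom hx).comp α) β)})
      { zero_mem := by
          rw [Set.mem_ofPred_eq, map_zero]; exact h0.zero_mem
        mul_mem := fun a b hb => by
          rw [Set.mem_ofPred_eq, map_mul]; exact h0.mul_mem _ _ hb
        one_notMem := by
          rw [Set.mem_ofPred_eq, map_one]; exact h0.one_notMem
        mem_or_mem := fun a b hab => by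
          rw [Set.mem_ofPred_eq, map_mul] at hab; exact h0.mem_or_mem _ _ hab } hq fun a => by
        rw [Set.mem_ofPred_eq, ← unit, unit_of, k, not_not, Set.mem_preimage]
    rw [← this, Set.mem_ofPred_eq, not_not]
  · intro x y hx hy k
    exact h.point_unique x y hx hy fun a =>
      (unit_of x hx a).symm.trans ((k (SN.of A a)).trans (unit_of y hy a))
  · intro x hx V hV
    obtain ⟨s, hs, k⟩ := h.exists_basic x hx V hV
    exact ⟨SN.of A s, (unit_of x hx s).2 hs, fun z hz hzs => k z hz ((unit_of z hz s).1 hzs)⟩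

end

/-- The canonical morphism from the seminormalization. -/
def snHom : Hom X.sn X where
  base := ContinuousMap.id X.space
  app U := snSec.comp (SN.of (X.sec U))
  app_res {U V} h s := snVal_ext fun x hx => by
    have e : SN.map (germHom (X := X) (U := V) hx) (SN.of (X.sec V) (res X.sheaf h s)) =
        SN.map (germHom (X := X) (U := U) (h hx)) (SN.of (X.sec U) s) := by
      rw [SN.map_of, SN.map_of]
      exact congrArg _ (germ_res h hx s)
    exact e
  isLocal x U hx s hs := by
    have hs : IsUnit (snGerm hx (snSec (SN.of _ s))) := hs
    rw [← isUnit_snEv, snEv_germ, snVal_snSec, SN.map_of, SN.isUnit_of] at hs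
    exact hs

variable {X}

/-- Over an affine `U` with partially cancellative sections, `IsChart.sn` makes `U` affine in
`X.sn`, and bijectivity of charts identifies the sections there with `SN (X.sec U)`. The required
properties are then those of `SN.of`. -/
theorem isSeminormalization_snHom (hX : X.IsPCMonoidScheme) : X.snHom.IsSeminormalization := by
  intro x
  obtain ⟨U, hU, h1, h2⟩ := hX x
  have hc := h1.isChart.sn
  refine ⟨U, hU, h1, hc.isAffineOpen, ?_⟩
  have hid : ∀ β : SN (X.sec U), SN.map (MonoidWithZeroHom.id (X.sec U)) β = β := by
    intro β
    induction β using SN.ind with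
    | h a ha => rfl
  -- This is where affineness of `U` yields that no further sections arise by sheafification.
  have hb : Function.Bijective (snSec : SN (X.sec U) →*₀ X.sn.sec (snOpens U)) := by
    have : (snSec.comp (SN.map (MonoidWithZeroHom.id (X.sec U))) :
        SN (X.sec U) →*₀ X.sn.sec (snOpens U)) = snSec :=
      MonoidWithZeroHom.ext fun β => congrArg snSec (hid β)
    rw [← this]
    exact hc.bijective
  change IsMonoidSeminormalization ((snSec : SN (X.sec U) →*₀ X.sn.sec (snOpens U)).comp
    (SN.of (X.sec U)))
  refine ⟨⟨⟨fun f hf => ?_⟩, fun b c e => ?_⟩, fun a a' => ?_, fun f => ?_⟩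
  · obtain ⟨β, rfl⟩ := hb.2 f
    obtain ⟨n, hn⟩ := hf
    rw [← map_pow, ← map_zero snSec] at hn
    rw [SN.isSeminormal.reduced.eq_zero β ⟨n, hb.1 hn⟩, map_zero]
  · obtain ⟨b, rfl⟩ := hb.2 b
    obtain ⟨c, rfl⟩ := hb.2 c
    rw [← map_pow, ← map_pow] at e
    obtain ⟨a, rfl, rfl⟩ := SN.isSeminormal.exists_root b c (hb.1 e)
    exact ⟨snSec a, (map_pow _ _ _).symm, (map_pow _ _ _).symm⟩
  · exact hb.1.eq_iff.trans (SN.of_eq_of_iff h2 a a')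
  · obtain ⟨β, rfl⟩ := hb.2 f
    obtain ⟨N, hN⟩ := SN.pow_mem β
    refine ⟨N, fun n hn => ?_⟩
    obtain ⟨a, ha⟩ := hN n hn
    refine ⟨a, ?_⟩
    rw [← map_pow, ← ha]
    rfl

end MonoidedSpace
end
end MonoidGeom

/-! ### The proposition -/

theorem mainTheorem3 (X : MonoidGeom.MonoidedSpace.{u}) (hX : X.IsPCMonoidScheme) :
    (∃ (Y : MonoidGeom.MonoidedSpace.{u}) (p : MonoidGeom.MonoidedSpace.Hom Y X),
      p.IsSeminormalization) ∧
    ∀ (Y : MonoidGeom.MonoidedSpace.{u}) (p : MonoidGeom.MonoidedSpace.Hom Y X),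
      p.IsSeminormalization →
        ∃ e : MonoidGeom.Pic X ≃* MonoidGeom.Pic Y,
          ∀ L : MonoidGeom.InvertibleSheaf X,
            e (MonoidGeom.Pic.mk L) = MonoidGeom.Pic.mk (L.pullback p) := by
  exact ⟨⟨X.sn, X.snHom, MonoidGeom.MonoidedSpace.isSeminormalization_snHom hX⟩,
    fun _ _ hp => hp.isUnitEquiv.exists_picEquiv⟩
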